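/- Let $G$ be a finitely generated fully residually free group (for every finite set of non-trivial elements of $G$ there is a homomorphism from $G$ to a free group that kills none of them). Write $a^b=b^{-1}ab$ and $[a,b]=a^{-1}b^{-1}ab$. Consider an orientable quadratic equation over $G$ in the variables $X=\{z_1,\dots,z_m,x_1,y_1,\dots,x_n,y_n\}$, written as $$S=\prod_{i=1}^{m}z_i^{-1}c_iz_i\ \prod_{i=1}^{n}[x_i,y_i]\ d^{-1}=1,\qquad c_i,d\in G,\quad c_i\neq 1,$$ where either $d\neq 1$ and $m+n\ge 1$, or $d=1$, $m=0$ and $n\ge 1$ (the coefficient $d$ is then said not to occur). Its atoms, in order, are $r_1,\dots,r_{m+n}=z_1^{-1}c_1z_1,\dots,z_m^{-1}c_mz_m,[x_1,y_1],\dots,[x_n,y_n]$. A solution of $S=1$ in $G$ is a homomorphism $\beta:G[X]=G*F(X)\to G$ that is the identity on $G$ and satisfies $\beta(S)=1$; it is commutative if $[\beta(r_i),\beta(r_{i+1})]=1$ for all $i<m+n$, and in general position if $[\beta(r_i),\beta(r_{i+1})]\neq 1$ for all $i<m+n$. Let $\kappa(S)=m+2n+\varepsilon$, with $\varepsilon=1$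 if $d\ne1$ and $\varepsilon=0$ if $d=1$. The equation is regular if $\kappa(S)\ge 4$ and it has a non-commutative solution in $G$, or if it is $[x_1,y_1]=d$ with $d\neq 1$. Let $R(S)$ be the set of all elements of $G[X]$ that are sent to $1$ by every solution of $S=1$ in $G$, and $G_{R(S)}=G[X]/R(S)$. For a group $H$ and $u\in H$ let $H(u,t)=\langle H,t\mid t^{-1}ht=h\ (h\in C_H(u))\rangle$ be the extension of the centralizer of $u$. Given a solution $\beta$, construct a chain of extensions of centralizers, starting with $H=G$ and the $G$-homomorphism $\alpha=\beta:G[X]\to H$, by successive steps. Each step replaces $H$ by $H(u,t)$, for the indicated element $u$ and a new letter $t$, and replaces $\alpha$ by the $G$-homomorphism with the indicated values on $X$ (writing $v$ for the old value $\alpha(v)$ of a variable $v$; variables not mentioned keep their values). One round consists of the following steps in this order: 1. for $i=1,\dots,m-1$: $u=c_i^{z_i}c_{i+1}^{z_{i+1}}$; $\ z_i\mapsto z_it$, $z_{i+1}\mapsto z_{i+1}t$; 2. if $m,n>0$: $u=c_m^{z_m}x_1^{-1}$; $\ z_m\mapsto z_mt$, $x_1\mapsto x_1^{t}$, $y_1\mapsto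 t^{-1}y_1$; 3. for $i=1,\dots,n$, in succession: $u=x_i$, $y_i\mapsto ty_i$; then $u=y_i$, $x_i\mapsto tx_i$; then $u=x_i$, $y_i\mapsto ty_i$; then, if $i<n$, $u=y_ix_{i+1}^{-1}$, $x_i\mapsto t^{-1}x_i$, $y_i\mapsto y_i^{t}$, $x_{i+1}\mapsto x_{i+1}^{t}$, $y_{i+1}\mapsto t^{-1}y_{i+1}$. Carry out two rounds, the second one starting from the group and the homomorphism that the first one ends with. Let $G(U,T)$ be the last group and $\hat\lambda_\beta:G[X]\to G(U,T)$ the last homomorphism. **Proposition.** If $S=1$ is regular and $\beta$ is a solution of $S=1$ in $G$ in general position, then $\hat\lambda_\beta$ induces a homomorphism $\lambda_\beta:G_{R(S)}\to G(U,T)$, and $\lambda_\beta$ is injective. -/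

import Mathlib

universe u

/-- `G` is fully residually free: every finite set of non-trivial elements survives in some
homomorphism from `G` to a free group. -/
def IsFullyResiduallyFree (G : Type u) [Group G] : Prop :=
  ∀ A : Finset G, (∀ g ∈ A, g ≠ 1) →
    ∃ (ι : Type) (f : G →* FreeGroup ι), ∀ g ∈ A, f g ≠ 1

/-- The variables `x_1, y_1, …, x_n, y_n, z_1, …, z_m`. -/
inductive QVar (m n : ℕ) : Type
  | x (i : Fin n)
  | y (i : Fin n)
  | z (i : Fin m)

/-- The free product `G[X] = G * F(X)`. -/
abbrev GX (G : Type u) [Group G] (m n : ℕ) : Type u :=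
  Monoid.Coprod G (FreeGroup (QVar m n))

namespace GX

variable {G : Type u} [Group G] {m n : ℕ}

/-- A constant of `G`, as an element of `G[X]`. -/
def const (g : G) : GX G m n := Monoid.Coprod.inl g

/-- A variable, as an element of `G[X]`. -/
def var (v : QVar m n) : GX G m n := Monoid.Coprod.inr (FreeGroup.of v)

end GX

/-- The data of an orientable quadratic equation
`∏ z_i⁻¹ c_i z_i ∏ [x_i, y_i] = d` in the variables `z_1, …, z_m, x_1, y_1, …, x_n, y_n`. -/
structure QuadEq (G : Type u) (m n : ℕ) where
  /-- the coefficients `c_i` -/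
  c : Fin m → G
  /-- the right-hand side -/
  d : G

namespace QuadEq

variable {G : Type u} [Group G] {m n : ℕ}

/-- The atoms `r_1, …, r_{m+n}`: first `z_i⁻¹ c_i z_i`, then `[x_i, y_i] = x_i⁻¹ y_i⁻¹ x_i y_i`. -/
def atom (E : QuadEq G m n) : Fin (m + n) → GX G m n :=
  Fin.append
    (fun i => (GX.var (.z i))⁻¹ * GX.const (E.c i) * GX.var (.z i))
    (fun i => (GX.var (.x i))⁻¹ * (GX.var (.y i))⁻¹ * GX.var (.x i) * GX.var (.y i))

/-- The left-hand side `S = r_1 ⋯ r_{m+n} d⁻¹` of the equation `S = 1`. -/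
def word (E : QuadEq G m n) : GX G m n :=
  (List.ofFn E.atom).prod * GX.const E.d⁻¹

/-- The equation is standard: the `c_i` are non-trivial, and either the coefficient `d` occurs
(that is, `d ≠ 1`) and there is at least one atom, or `d` does not occur and the equation is
`[x_1, y_1] ⋯ [x_n, y_n] = 1` with `n > 0`. -/
def IsStandard (E : QuadEq G m n) : Prop :=
  (∀ i, E.c i ≠ 1) ∧ ((E.d ≠ 1 ∧ 0 < m + n) ∨ (E.d = 1 ∧ m = 0 ∧ 0 < n))

/-- A solution of `S = 1` in `G`: a `G`-homomorphism `G[X] → G` that sends `S` to `1`. -/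
def IsSolution (E : QuadEq G m n) (β : GX G m n →* G) : Prop :=
  (∀ g : G, β (GX.const g) = g) ∧ β E.word = 1

/-- The images of any two neighbouring atoms commute. -/
def IsCommutative (E : QuadEq G m n) (β : GX G m n →* G) : Prop :=
  ∀ (i : ℕ) (h : i + 1 < m + n),
    Commute (β (E.atom ⟨i, Nat.lt_of_succ_lt h⟩)) (β (E.atom ⟨i + 1, h⟩))

/-- The images of no two neighbouring atoms commute. -/
def InGeneralPosition (E : QuadEq G m n) (β : GX G m n →* G) : Prop :=
  ∀ (i : ℕ) (h : i + 1 < m + n),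
    ¬ Commute (β (E.atom ⟨i, Nat.lt_of_succ_lt h⟩)) (β (E.atom ⟨i + 1, h⟩))

open Classical in
/-- `κ(S) = |X| + ε(S)`, where `ε(S)` is `1` or `0` as the coefficient `d` occurs or not. -/
noncomputable def kappa (E : QuadEq G m n) : ℕ :=
  (m + 2 * n) + (if E.d = 1 then 0 else 1)

/-- The standard equation is regular: `κ(S) ≥ 4` and there is a non-commutative solution in `G`,
or it is of the form `[x, y] = d` with `d ≠ 1`. -/
def IsRegular (E : QuadEq G m n) : Prop :=
  E.IsStandard ∧
    ((4 ≤ E.kappa ∧ ∃ β, E.IsSolution β ∧ ¬ E.IsCommutative β) ∨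
      (m = 0 ∧ n = 1 ∧ E.d ≠ 1))

/-- The radical `R(S)`: the words that vanish at every solution of `S = 1` in `G`
(all of `G[X]` if there is no solution). -/
def radical (E : QuadEq G m n) : Subgroup (GX G m n) :=
  ⨅ β : {β : GX G m n →* G // E.IsSolution β}, β.1.ker

instance (E : QuadEq G m n) : E.radical.Normal :=
  Subgroup.normal_iInf_normal fun β => MonoidHom.normal_ker β.1

/-- The coordinate group `G_{R(S)} = G[X] / R(S)`. -/
abbrev CoordinateGroup (E : QuadEq G m n) : Type u :=
  GX G m n ⧸ E.radical

end QuadEq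

/-- The extension of the centralizer of `w` in `H`:
`H(w, t) = ⟨H, t | t⁻¹ h t = h for all h ∈ C_H(w)⟩`. -/
abbrev CentralizerExtension (H : Type u) [Group H] (w : H) : Type u :=
  HNNExtension H (Subgroup.centralizer {w}) (Subgroup.centralizer {w}) (MulEquiv.refl _)

/-- The kinds of steps in the construction of `G(U, T)`. Indices start at `0`. -/
inductive Move (m n : ℕ) : Type
  /-- `z_i ↦ z_i t`, `z_{i+1} ↦ z_{i+1} t`, where `t` extends the centralizer of the value of
  `c_i^{z_i} c_{i+1}^{z_{i+1}}` -/
  | zz (i : Fin (m - 1))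
  /-- `z_m ↦ z_m t`, `x_1 ↦ x_1^t`, `y_1 ↦ t⁻¹ y_1`, where `t` extends the centralizer of the
  value of `c_m^{z_m} x_1⁻¹` (`z_m` is the last `z`-variable, `x_1`, `y_1` are the first ones) -/
  | zx (hm : 0 < m) (hn : 0 < n)
  /-- `y_i ↦ t y_i`, where `t` extends the centralizer of the value of `x_i` -/
  | twistY (i : Fin n)
  /-- `x_i ↦ t x_i`, where `t` extends the centralizer of the value of `y_i` -/
  | twistX (i : Fin n)
  /-- `x_i ↦ t⁻¹ x_i`, `y_i ↦ y_i^t`, `x_{i+1} ↦ x_{i+1}^t`, `y_{i+1} ↦ t⁻¹ y_{i+1}`, where `t`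
  extends the centralizer of the value of `y_i x_{i+1}⁻¹` -/
  | xx (i : Fin (n - 1))

namespace Move

variable {m n : ℕ}

/-- The element of `G[X]` whose value has its centralizer extended. -/
def period {G : Type u} [Group G] (E : QuadEq G m n) : Move m n → GX G m n
  | zz i => E.atom ⟨i, by omega⟩ * E.atom ⟨i + 1, by omega⟩
  | zx hm hn => E.atom ⟨m - 1, by omega⟩ * (GX.var (.x ⟨0, hn⟩))⁻¹
  | twistY i => GX.var (.x i)
  | twistX i => GX.var (.y i)
  | xx i => GX.var (.y ⟨i, by omega⟩) * (GX.var (.x ⟨i + 1, by omega⟩))⁻¹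

/-- The new values of the variables, in terms of the old values `v` and the new letter `t`. -/
def act {K : Type u} [Group K] (t : K) (v : QVar m n → K) : Move m n → QVar m n → K
  | zz i, .z j => if j.1 = i.1 ∨ j.1 = i.1 + 1 then v (.z j) * t else v (.z j)
  | zz _, w => v w
  | zx _ _, .z j => if j.1 = m - 1 then v (.z j) * t else v (.z j)
  | zx _ _, .x j => if j.1 = 0 then t⁻¹ * v (.x j) * t else v (.x j)
  | zx _ _, .y j => if j.1 = 0 then t⁻¹ * v (.y j) else v (.y j)
  | twistY i, .y j => if j = i then t * v (.y j) else v (.y j)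
  | twistY _, w => v w
  | twistX i, .x j => if j = i then t * v (.x j) else v (.x j)
  | twistX _, w => v w
  | xx i, .x j =>
      if j.1 = i.1 then t⁻¹ * v (.x j)
      else if j.1 = i.1 + 1 then t⁻¹ * v (.x j) * t else v (.x j)
  | xx i, .y j =>
      if j.1 = i.1 then t⁻¹ * v (.y j) * t
      else if j.1 = i.1 + 1 then t⁻¹ * v (.y j) else v (.y j)
  | xx _, w => v w

/-- The steps of one round of the construction, in order; there are `m - 1`, `4n - 1` or
`m + 4n - 1` of them as `n = 0`, `m = 0` or `m, n > 0`. -/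
def round (m n : ℕ) : List (Move m n) :=
  (List.finRange (m - 1)).map zz ++
  (if h : 0 < m ∧ 0 < n then [zx h.1 h.2] else []) ++
  (List.finRange n).flatMap fun i =>
    [twistY i, twistX i, twistY i] ++
      (if h : i.1 < n - 1 then [xx ⟨i.1, h⟩] else [])

end Move

/-- A stage of the construction: a group `H` with a homomorphism `G → H` and values in `H` of the
variables, that is, a `G`-homomorphism `G[X] → H`. -/
structure Stage (G : Type u) [Group G] (m n : ℕ) where
  /-- the group `H` -/
  carrier : Type u
  [group : Group carrier]
  /-- the canonical homomorphism `G → H` -/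
  incl : G →* carrier
  /-- the values of the variables -/
  val : QVar m n → carrier

namespace Stage

variable {G : Type u} [Group G] {m n : ℕ}

instance (s : Stage G m n) : Group s.carrier := s.group

/-- The `G`-homomorphism `G[X] → H` given by the values of the variables. -/
def hom (s : Stage G m n) : GX G m n →* s.carrier :=
  Monoid.Coprod.lift s.incl (FreeGroup.lift s.val)

/-- The initial stage: `H = G`, with the values of the variables given by `β`. -/
def start (β : GX G m n →* G) : Stage G m n where
  carrier := G
  incl := MonoidHom.id G
  val := fun w => β (GX.var w)

/-- One step: extend the centralizer of the value of the period by a new letter `t` and change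
the values of the variables. -/
def step (E : QuadEq G m n) (s : Stage G m n) (k : Move m n) : Stage G m n where
  carrier := CentralizerExtension s.carrier (s.hom (k.period E))
  incl := HNNExtension.of.comp s.incl
  val := k.act HNNExtension.t (fun w => HNNExtension.of (s.val w))

end Stage

namespace QuadEq

variable {G : Type u} [Group G] {m n : ℕ}

/-- The last stage of the construction: two successive rounds, starting from `β`. -/
def finalStage (E : QuadEq G m n) (β : GX G m n →* G) : Stage G m n :=
  (Move.round m n ++ Move.round m n).foldl (Stage.step E) (Stage.start β)

/-- The group `G(U, T)`, obtained from `G` by a finite chain of extensions of centralizers. -/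
abbrev GUT (E : QuadEq G m n) (β : GX G m n →* G) : Type u :=
  (E.finalStage β).carrier

/-- The homomorphism `λ_β`, on the level of `G[X]`. -/
def lambdaHom (E : QuadEq G m n) (β : GX G m n →* G) : GX G m n →* E.GUT β :=
  (E.finalStage β).hom

end QuadEq

/-!
Let `λ̂ = λ̂_β`. The homomorphism `λ̂` kills `R(S)` and its kernel lies in the normal closure of
`S`, which lies in `R(S)`; so the kernel is exactly `R(S)`.

`λ̂` kills `R(S)`: every group of the chain is separated by its `G`-retractions onto `G`, obtained
by mapping the new letter `t` to a large power of `u`, and `λ̂` followed by such a retraction is a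
solution of `S = 1`. That large powers suffice is the big powers property of `G`. It reduces to a
free group, embedded in `SL₂` of a field so that no non-trivial element has trace `±2`: there `u`
can be taken to be diagonal, and a product `g₀ u^N g₁ u^N ⋯` is a Laurent polynomial in an
eigenvalue of `u^N` whose leading coefficient is a product of non-zero matrices of rank one.

The kernel of `λ̂` lies in the normal closure of `S`: mapping a letter `t` to `1` can only enlarge
the kernel, so steps may be dropped; and steps at distant atoms commute. The two rounds therefore
contain a sequence of blocks of steps, one block per atom. By Britton's lemma, the block of an atom
makes the values of its variables independent over `G` of those of the variables of the preceding
atoms. At the last atom this leaves no relation but the equation itself.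
-/

section AnisotropicRep

open Matrix Polynomial
open scoped MatrixGroups

theorem trace_conj_specialLinearGroup {R : Type*} [CommRing R] (P g : SL(2, R)) :
    trace (P * g * P⁻¹ : SL(2, R)).1 = trace g.1 := by
  rw [Matrix.SpecialLinearGroup.coe_mul, Matrix.SpecialLinearGroup.coe_mul, trace_mul_cycle,
    ← Matrix.SpecialLinearGroup.coe_mul, inv_mul_cancel, Matrix.SpecialLinearGroup.coe_one, one_mul]

section Torus

variable {K : Type*} [Field K]

/-- The one-parameter subgroup `l ↦ diag (l, l⁻¹)` of `SL₂`. -/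
noncomputable def torus : Kˣ →* SL(2, K) where
  toFun l := Matrix.SpecialLinearGroup.diag2 (l : K) l.ne_zero
  map_one' := Subtype.ext <| by
    rw [Matrix.SpecialLinearGroup.diag2_coe']
    simp [one_fin_two]
  map_mul' l r := Subtype.ext <| by
    simp only [Matrix.SpecialLinearGroup.coe_mul, Matrix.SpecialLinearGroup.diag2_coe']
    simp [mul_comm]

theorem coe_torus (l : Kˣ) :
    (torus l : Matrix (Fin 2) (Fin 2) K) = !![(l : K), 0; 0, (l : K)⁻¹] :=
  Matrix.SpecialLinearGroup.diag2_coe' l.ne_zero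

theorem commute_torus_iff {l : Kˣ} (hl : (l : K) ≠ (l : K)⁻¹) {g : SL(2, K)} :
    Commute g (torus l) ↔ g 0 1 = 0 ∧ g 1 0 = 0 := by
  rw [Commute, SemiconjBy, Matrix.SpecialLinearGroup.ext_iff]
  simp only [Fin.forall_fin_two, Matrix.SpecialLinearGroup.coe_mul, coe_torus]
  simp [mul_apply, mul_comm _ (g _ _), hl, hl.symm]

theorem trace_commutator_torus (g : SL(2, K)) (l : Kˣ) :
    trace (g * torus l * g⁻¹ * (torus l)⁻¹ : SL(2, K)).1 =
      2 - (l - (l : K)⁻¹) ^ 2 * (g 0 1 * g 1 0) := by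
  have hdet := g.2
  rw [det_fin_two] at hdet
  have hl : (l : K) * (l : K)⁻¹ = 1 := mul_inv_cancel₀ l.ne_zero
  rw [← map_inv]
  simp only [Matrix.SpecialLinearGroup.coe_mul, coe_torus, trace_fin_two,
    Matrix.SpecialLinearGroup.coe_inv, adjugate_fin_two, mul_apply, Fin.sum_univ_two]
  simp
  linear_combination (2 * (l : K) * (l : K)⁻¹) * hdet + 2 * hl

theorem conj_torus_zero_one (g : SL(2, K)) (l : Kˣ) :
    (g * torus l * g⁻¹ : SL(2, K)) 0 1 = ((l : K)⁻¹ - l) * (g 0 0 * g 0 1) := by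
  simp only [Matrix.SpecialLinearGroup.coe_mul, coe_torus, Matrix.SpecialLinearGroup.coe_inv,
    adjugate_fin_two, mul_apply, Fin.sum_univ_two]
  simp
  ring

theorem conj_torus_one_zero (g : SL(2, K)) (l : Kˣ) :
    (g * torus l * g⁻¹ : SL(2, K)) 1 0 = (l - (l : K)⁻¹) * (g 1 0 * g 1 1) := by
  simp only [Matrix.SpecialLinearGroup.coe_mul, coe_torus, Matrix.SpecialLinearGroup.coe_inv,
    adjugate_fin_two, mul_apply, Fin.sum_univ_two]
  simp
  ring

theorem trace_mul_self (g : SL(2, K)) : trace (g * g : SL(2, K)).1 = trace g.1 ^ 2 - 2 := by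
  have hdet := g.2
  rw [det_fin_two] at hdet
  simp only [Matrix.SpecialLinearGroup.coe_mul, trace_fin_two, mul_apply, Fin.sum_univ_two]
  linear_combination -2 * hdet

theorem exists_add_inv_eq_of_sq_ne_four [IsAlgClosed K] {s : K} (hs : s ^ 2 ≠ 4) :
    ∃ l : Kˣ, (l : K) + (l : K)⁻¹ = s ∧ (l : K) ≠ (l : K)⁻¹ := by
  obtain ⟨l, hl⟩ := IsAlgClosed.exists_root (X ^ 2 - C s * X + 1 : K[X])
    (by rw [show (X ^ 2 - C s * X + 1 : K[X]).degree = 2 by compute_degree!]; simp)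
  replace hl : l ^ 2 - s * l + 1 = 0 := by simpa [IsRoot] using hl
  have hl0 : l ≠ 0 := by
    rintro rfl
    simp at hl
  have hinv : l * l⁻¹ = 1 := mul_inv_cancel₀ hl0
  have hsum : l + l⁻¹ = s := by linear_combination l⁻¹ * hl + (s - l) * hinv
  refine ⟨.mk0 l hl0, hsum, fun h : l = l⁻¹ => hs ?_⟩
  linear_combination (-s - l - l⁻¹) * hsum + 4 * hinv + (l - l⁻¹) * h

theorem exists_vecMul_eq_smul {U : Matrix (Fin 2) (Fin 2) K} {l : K}
    (hl : l ^ 2 - trace U * l + U.det = 0) : ∃ v ≠ 0, v ᵥ* U = l • v := by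
  obtain ⟨v, hv, h⟩ := exists_vecMul_eq_zero_iff (M := U - l • 1).2 (by
    rw [trace_fin_two, det_fin_two] at hl
    simp only [det_fin_two, Matrix.sub_apply, Matrix.smul_apply, one_apply, Fin.isValue, if_true,
      zero_ne_one, one_ne_zero, if_false, smul_eq_mul]
    linear_combination hl)
  exact ⟨v, hv, by simpa [vecMul_sub, vecMul_smul, sub_eq_zero] using h⟩

theorem det_of_ne_zero_of_vecMul_eq_smul {U : Matrix (Fin 2) (Fin 2) K} {l r : K} (hlr : l ≠ r)
    {v w : Fin 2 → K} (hv : v ≠ 0) (hw : w ≠ 0) (hvU : v ᵥ* U = l • v) (hwU : w ᵥ* U = r • w) :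
    det (of ![v, w]) ≠ 0 := by
  rw [← isUnit_iff_ne_zero, ← isUnit_iff_isUnit_det, ← linearIndependent_rows_iff_isUnit]
  refine Module.End.eigenvectors_linearIndependent' (vecMulLinear U) ![l, r]
    (List.nodup_ofFn.1 (by simpa using hlr)) _ fun i => ?_
  fin_cases i
  · exact ⟨Module.End.mem_eigenspace_iff.2 hvU, hv⟩
  · exact ⟨Module.End.mem_eigenspace_iff.2 hwU, hw⟩

theorem exists_mul_eq_torus_mul [IsAlgClosed K] {U : SL(2, K)} (hU : trace U.1 ^ 2 ≠ 4) :
    ∃ (P : SL(2, K)) (l : Kˣ), (l : K) ≠ (l : K)⁻¹ ∧ P * U = torus l * P := by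
  obtain ⟨l, hsum, hl⟩ := exists_add_inv_eq_of_sq_ne_four hU
  have hinv : (l : K) * (l : K)⁻¹ = 1 := mul_inv_cancel₀ l.ne_zero
  obtain ⟨v, hv, hvU⟩ := exists_vecMul_eq_smul (U := U.1) (l := l) (by
    rw [U.2]; linear_combination l * hsum - hinv)
  obtain ⟨w, hw, hwU⟩ := exists_vecMul_eq_smul (U := U.1) (l := (l : K)⁻¹) (by
    rw [U.2]; linear_combination (l : K)⁻¹ * hsum - hinv)
  obtain ⟨c, hc⟩ : ∃ c, c * det (of ![v, w]) = 1 :=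
    ⟨_, inv_mul_cancel₀ (det_of_ne_zero_of_vecMul_eq_smul hl hv hw hvU hwU)⟩
  have hdet : det (of ![c • v, w]) = 1 := by
    rw [← hc, det_fin_two, det_fin_two]
    simp
    ring
  obtain ⟨P, hP⟩ : ∃ P : SL(2, K), P.1 = of ![c • v, w] := ⟨⟨_, hdet⟩, rfl⟩
  refine ⟨P, l, hl, Subtype.ext ?_⟩
  rw [Matrix.SpecialLinearGroup.coe_mul, Matrix.SpecialLinearGroup.coe_mul, coe_torus, hP]
  ext i j
  fin_cases i
  · have h := congrFun hvU j
    simp only [vecMul_eq_sum, Fin.sum_univ_two] at h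
    simp [mul_apply] at h ⊢
    linear_combination c * h
  · have h := congrFun hwU j
    simp only [vecMul_eq_sum, Fin.sum_univ_two] at h
    simp [mul_apply] at h ⊢
    linear_combination h

end Torus

/-- A representation by `2 × 2` matrices of determinant one in which no non-trivial element
has trace `±2`. -/
def IsAnisotropicRep {H K : Type*} [Group H] [CommRing K] (ρ : H →* SL(2, K)) : Prop :=
  ∀ g ≠ 1, trace (ρ g).1 ^ 2 ≠ 4

namespace IsAnisotropicRep

variable {H K : Type*} [Group H] [Field K] {ρ : H →* SL(2, K)}

theorem eq_one_of_trace_sq_eq_four (hρ : IsAnisotropicRep ρ) {g : H}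
    (h : trace (ρ g).1 ^ 2 = 4) : g = 1 := by
  by_contra hg
  exact hρ g hg h

theorem injective (hρ : IsAnisotropicRep ρ) : Function.Injective ρ := by
  refine (injective_iff_map_eq_one ρ).2 fun g hg => hρ.eq_one_of_trace_sq_eq_four ?_
  rw [hg, Matrix.SpecialLinearGroup.coe_one, trace_one, Fintype.card_fin]
  norm_num

theorem conj (hρ : IsAnisotropicRep ρ) (P : SL(2, K)) :
    IsAnisotropicRep ((MulAut.conj P).toMonoidHom.comp ρ) := by
  intro g hg
  convert hρ g hg using 2
  exact trace_conj_specialLinearGroup P (ρ g)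

theorem exists_map_eq_torus [IsAlgClosed K] (hρ : IsAnisotropicRep ρ) {u : H} (hu : u ≠ 1) :
    ∃ ρ' : H →* SL(2, K), IsAnisotropicRep ρ' ∧
      ∃ l : Kˣ, (l : K) ≠ (l : K)⁻¹ ∧ ρ' u = torus l := by
  obtain ⟨P, l, hl, h⟩ := exists_mul_eq_torus_mul (hρ u hu)
  exact ⟨_, hρ.conj P, l, hl, mul_inv_eq_iff_eq_mul.2 h⟩

section Torus

variable {u : H} {l : Kˣ}

theorem commute_iff_of_map_eq_torus (hρ : IsAnisotropicRep ρ) (hl : (l : K) ≠ (l : K)⁻¹)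
    (hu : ρ u = torus l) {g : H} : Commute g u ↔ ρ g 0 1 = 0 ∧ ρ g 1 0 = 0 := by
  rw [← commute_map_iff hρ.injective, hu, commute_torus_iff hl]

theorem commute_of_apply_mul_apply_eq_zero (hρ : IsAnisotropicRep ρ) (hu : ρ u = torus l) {g : H}
    (h : ρ g 0 1 * ρ g 1 0 = 0) : Commute g u := by
  have htr : trace (ρ (g * u * g⁻¹ * u⁻¹)).1 = 2 := by
    simp only [map_mul, map_inv, hu]
    rw [trace_commutator_torus, h, mul_zero, sub_zero]
  have hone : g * u * g⁻¹ * u⁻¹ = 1 := hρ.eq_one_of_trace_sq_eq_four (by rw [htr]; norm_num)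
  rwa [mul_inv_eq_one, mul_inv_eq_iff_eq_mul] at hone

theorem commute_of_commute_conj_of_map_eq_torus (hρ : IsAnisotropicRep ρ)
    (hl : (l : K) ≠ (l : K)⁻¹) (hu : ρ u = torus l) {g : H} (h : Commute (g * u * g⁻¹) u) :
    Commute g u := by
  rw [hρ.commute_iff_of_map_eq_torus hl hu, map_mul, map_mul, map_inv, hu,
    conj_torus_zero_one, conj_torus_one_zero, mul_eq_zero, mul_eq_zero, mul_eq_zero, mul_eq_zero,
    sub_eq_zero, sub_eq_zero] at h
  by_contra hg
  have hoff : ρ g 0 1 ≠ 0 ∧ ρ g 1 0 ≠ 0 :=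
    mul_ne_zero_iff.1 fun h => hg (hρ.commute_of_apply_mul_apply_eq_zero hu h)
  have htr : trace (ρ g).1 = 0 := by
    rw [trace_fin_two, (h.1.resolve_left hl.symm).resolve_right hoff.1,
      (h.2.resolve_left hl).resolve_left hoff.2, add_zero]
  -- A matrix of determinant one and trace zero squares to `-1`, which has trace `-2`.
  have hsq : g * g = 1 := hρ.eq_one_of_trace_sq_eq_four <| by
    rw [map_mul, trace_mul_self, htr]
    norm_num
  have hfour : (0 : K) = 4 := by
    have := trace_mul_self (ρ g)
    rw [← map_mul, hsq, map_one, Matrix.SpecialLinearGroup.coe_one, trace_one, htr,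
      Fintype.card_fin] at this
    linear_combination -this
  refine hg ?_
  rw [hρ.eq_one_of_trace_sq_eq_four (g := g) (by rw [htr, ← hfour, zero_pow two_ne_zero])]
  exact Commute.one_left u

theorem apply_ne_zero_of_not_commute (hρ : IsAnisotropicRep ρ)
    (hl : (l : K) ≠ (l : K)⁻¹) (hu : ρ u = torus l) {g : H} (hg : ¬ Commute g u) (i j : Fin 2) :
    ρ g i j ≠ 0 := by
  have hoff : ρ g 0 1 * ρ g 1 0 ≠ 0 := fun h => hg (hρ.commute_of_apply_mul_apply_eq_zero hu h)
  have hconj : (ρ g * torus l * (ρ g)⁻¹) 0 1 * (ρ g * torus l * (ρ g)⁻¹) 1 0 ≠ 0 := fun h =>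
    hg <| hρ.commute_of_commute_conj_of_map_eq_torus hl hu <|
      hρ.commute_of_apply_mul_apply_eq_zero hu (by simpa only [map_mul, map_inv, hu] using h)
  rw [conj_torus_zero_one, conj_torus_one_zero] at hconj
  simp only [mul_ne_zero_iff] at hoff hconj
  fin_cases i <;> fin_cases j <;> simp_all

end Torus

theorem commute_trans [IsAlgClosed K] (hρ : IsAnisotropicRep ρ) {u a b : H} (hu : u ≠ 1)
    (ha : Commute a u) (hb : Commute b u) : Commute a b := by
  obtain ⟨ρ', hρ', l, hl, hu⟩ := hρ.exists_map_eq_torus hu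
  rw [hρ'.commute_iff_of_map_eq_torus hl hu] at ha hb
  rw [← commute_map_iff hρ'.injective, Commute, SemiconjBy, Matrix.SpecialLinearGroup.ext_iff]
  simp [Fin.forall_fin_two, mul_apply, ha, hb, mul_comm]

theorem commute_of_commute_conj [IsAlgClosed K] (hρ : IsAnisotropicRep ρ) {u g : H}
    (hu : u ≠ 1) (h : Commute (g * u * g⁻¹) u) : Commute g u := by
  obtain ⟨ρ', hρ', l, hl, hu⟩ := hρ.exists_map_eq_torus hu
  exact hρ'.commute_of_commute_conj_of_map_eq_torus hl hu h

end IsAnisotropicRep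

section RankOne

variable {n R : Type*} [Fintype n] [DecidableEq n] [CommRing R] [NoZeroDivisors R] [Nontrivial R]

theorem exists_prod_vecMulVec_eq_smul (x : (n → R) × (n → R)) (L : List ((n → R) × (n → R)))
    (hL : (x :: L).IsChain fun a b => a.2 ⬝ᵥ b.1 ≠ 0) :
    ∃ c : R, c ≠ 0 ∧ ((x :: L).map fun a => vecMulVec a.1 a.2).prod =
      c • vecMulVec x.1 ((x :: L).getLast (L.cons_ne_nil x)).2 := by
  induction L generalizing x with
  | nil => exact ⟨1, one_ne_zero, by simp⟩
  | cons y L ih =>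
    obtain ⟨hxy, hL⟩ := List.isChain_cons_cons.1 hL
    obtain ⟨c, hc, h⟩ := ih y hL
    refine ⟨c * (x.2 ⬝ᵥ y.1), mul_ne_zero hc hxy, ?_⟩
    rw [List.map_cons, List.prod_cons, h, mul_smul_comm, vecMulVec_mul_vecMulVec,
      vecMulVec_smul, smul_smul, List.getLast_cons_cons]

theorem prod_vecMulVec_ne_zero {L : List ((n → R) × (n → R))} (hL : L ≠ [])
    (hch : L.IsChain fun a b => a.2 ⬝ᵥ b.1 ≠ 0) (hne : ∀ a ∈ L, a.1 ≠ 0 ∧ a.2 ≠ 0) :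
    (L.map fun a => vecMulVec a.1 a.2).prod ≠ 0 := by
  obtain ⟨x, L, rfl⟩ := List.exists_cons_of_ne_nil hL
  obtain ⟨c, hc, h⟩ := exists_prod_vecMulVec_eq_smul x L hch
  rw [h]
  exact smul_ne_zero hc (vecMulVec_ne_zero (hne x List.mem_cons_self).1
    (hne _ (List.getLast_mem _)).2)

theorem trace_prod_vecMulVec_ne_zero {L : List ((n → R) × (n → R))} (hL : L ≠ [])
    (hch : L.IsChain fun a b => a.2 ⬝ᵥ b.1 ≠ 0)
    (hlast : ∀ a ∈ L.getLast?, ∀ b ∈ L.head?, a.2 ⬝ᵥ b.1 ≠ 0) :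
    trace (L.map fun a => vecMulVec a.1 a.2).prod ≠ 0 := by
  obtain ⟨x, L, rfl⟩ := List.exists_cons_of_ne_nil hL
  obtain ⟨c, hc, h⟩ := exists_prod_vecMulVec_eq_smul x L hch
  rw [h, trace_smul, trace_vecMulVec, dotProduct_comm]
  exact mul_ne_zero hc (hlast _ (List.getLast?_eq_some_getLast _) x rfl)

end RankOne

section Dilation

variable {n R A : Type*} [Fintype n] [DecidableEq n] [CommRing R] [CommRing A] [Algebra R A]

/-- For an idempotent matrix `P`, the matrix that acts as `t` on the image of `P` and as `t⁻¹` on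
its kernel. -/
def dilation (P : Matrix n n R) (t : Rˣ) : Matrix n n R :=
  (t : R) • P + (↑t⁻¹ : R) • (1 - P)

/-- The polynomial matrix `((X ^ 2 - 1) P + 1) A`, whose value at `t` is `t • dilation P t * A`. -/
noncomputable def dilationPolynomial (x : Matrix n n R × Matrix n n R) : Matrix n n R[X] :=
  ((X ^ 2 : R[X]) • x.1.map C + (1 - x.1).map C) * x.2.map C

theorem map_aeval_dilationPolynomial (t : Aˣ) (x : Matrix n n R × Matrix n n R) :
    (dilationPolynomial x).map (aeval (t : A)) =
      (t : A) • (dilation (x.1.map (algebraMap R A)) t * x.2.map (algebraMap R A)) := by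
  have hC (M : Matrix n n R) : (M.map C).map (aeval (t : A)) = M.map (algebraMap R A) := by
    ext; simp
  have h1 : (1 - x.1).map (algebraMap R A) = 1 - x.1.map (algebraMap R A) := by
    rw [Matrix.map_sub _ (map_sub _), Matrix.map_one _ (map_zero _) (map_one _)]
  have hX : ((X ^ 2 : R[X]) • x.1.map C).map (aeval (t : A)) =
      (t : A) ^ 2 • x.1.map (algebraMap R A) := by
    ext i j
    simpa using mul_comm (algebraMap R A (x.1 i j)) _
  rw [dilationPolynomial, Matrix.map_mul, Matrix.map_add _ (map_add _), hC, hC, h1, hX, dilation,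
    ← smul_mul_assoc, smul_add, smul_smul, smul_smul, Units.mul_inv, one_smul, sq]

theorem map_aeval_prod_dilationPolynomial (t : Aˣ) (L : List (Matrix n n R × Matrix n n R)) :
    (L.map dilationPolynomial).prod.map (aeval (t : A)) = (t : A) ^ L.length •
      (L.map fun x => dilation (x.1.map (algebraMap R A)) t * x.2.map (algebraMap R A)).prod := by
  induction L with
  | nil => simp
  | cons x L ih =>
    simp only [List.map_cons, List.prod_cons, List.length_cons]
    rw [Matrix.map_mul, ih, map_aeval_dilationPolynomial, smul_mul_smul_comm, pow_succ']

theorem matPolyEquiv_dilationPolynomial (x : Matrix n n R × Matrix n n R) :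
    matPolyEquiv (dilationPolynomial x) = C (x.1 * x.2) * X ^ 2 + C ((1 - x.1) * x.2) := by
  rw [dilationPolynomial, map_mul, map_add, matPolyEquiv_map_C, matPolyEquiv_map_C,
    matPolyEquiv_map_smul, matPolyEquiv_map_C]
  simp only [Polynomial.map_pow, map_X, C_mul]
  rw [add_mul, X_pow_mul, mul_assoc, X_pow_mul, ← mul_assoc]

theorem natDegree_matPolyEquiv_dilationPolynomial_le (x : Matrix n n R × Matrix n n R) :
    (matPolyEquiv (dilationPolynomial x)).natDegree ≤ 2 := by
  rw [matPolyEquiv_dilationPolynomial]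
  compute_degree

theorem coeff_prod_dilationPolynomial (L : List (Matrix n n R × Matrix n n R)) (i j : n) :
    ((L.map dilationPolynomial).prod i j).coeff (L.length * 2) =
      (L.map fun x => x.1 * x.2).prod i j := by
  rw [← matPolyEquiv_coeff_apply, map_list_prod, List.map_map]
  have h := coeff_list_prod_of_natDegree_le (L.map (matPolyEquiv ∘ dilationPolynomial)) 2
    (List.forall_mem_map.2 fun x _ => natDegree_matPolyEquiv_dilationPolynomial_le x)
  rw [List.length_map, List.map_map] at h
  rw [h, List.map_congr_left (g := fun x => x.1 * x.2) fun x _ => ?_]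
  simp only [Function.comp_apply, matPolyEquiv_dilationPolynomial, coeff_add, coeff_C_mul_X_pow,
    if_true, coeff_C_succ, add_zero]

theorem natDegree_prod_dilationPolynomial_le (L : List (Matrix n n R × Matrix n n R)) (i j : n) :
    ((L.map dilationPolynomial).prod i j).natDegree ≤ L.length * 2 := by
  refine natDegree_le_iff_coeff_eq_zero.2 fun N hN => ?_
  rw [← matPolyEquiv_coeff_apply, coeff_eq_zero_of_natDegree_lt, Matrix.zero_apply]
  refine lt_of_le_of_lt ?_ hN
  rw [map_list_prod, List.map_map]
  refine (natDegree_list_prod_le _).trans ?_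
  rw [List.map_map]
  refine (List.sum_le_card_nsmul _ 2 ?_).trans_eq (by simp)
  exact List.forall_mem_map.2 fun x _ => natDegree_matPolyEquiv_dilationPolynomial_le x

end Dilation

section BigPowers

variable {n K : Type*} [Fintype n] [DecidableEq n] [Field K]

theorem finite_setOf_prod_dilation_eq {L : List (Matrix n n K × Matrix n n K)} (hL : L ≠ [])
    (hprod : (L.map fun x => x.1 * x.2).prod ≠ 0) (B : Matrix n n K) :
    {t : Kˣ | (L.map fun x => dilation x.1 t * x.2).prod = B}.Finite := by
  obtain ⟨i, j, hij⟩ : ∃ i j, (L.map fun x => x.1 * x.2).prod i j ≠ 0 := by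
    by_contra! h
    exact hprod (Matrix.ext h)
  set p : K[X] := (L.map dilationPolynomial).prod i j - C (B i j) * X ^ L.length
  have hlen : L.length * 2 ≠ L.length := by
    have := List.length_pos_iff.2 hL
    omega
  have hp : p ≠ 0 := fun h => hij <| by
    rw [← coeff_prod_dilationPolynomial, sub_eq_zero.1 h, coeff_C_mul_X_pow, if_neg hlen]
  refine ((p.rootSet_finite K).preimage (f := Units.val) Units.val_injective.injOn).subset ?_
  rintro t (ht : _ = B)
  have heval := congrFun₂ (map_aeval_prod_dilationPolynomial t L) i j
  simp only [Algebra.algebraMap_self, RingHom.coe_id, Matrix.map_id] at heval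
  rw [ht, map_apply, Matrix.smul_apply, smul_eq_mul] at heval
  rw [Set.mem_preimage, mem_rootSet_of_ne hp, map_sub, heval, map_mul, map_pow, aeval_X, aeval_C,
    Algebra.algebraMap_self, RingHom.id_apply, mul_comm, sub_self]

theorem coe_torus_zpow_units (l : Kˣ) (s : ℤˣ) :
    (torus l ^ (s : ℤ) : SL(2, K)).1 =
      dilation (Matrix.single (if s = 1 then 0 else 1) (if s = 1 then 0 else 1) 1) l := by
  rw [← map_zpow, coe_torus, dilation]
  rcases Int.units_eq_one_or s with rfl | rfl <;>
    · ext i j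
      fin_cases i <;> fin_cases j <;> simp

namespace IsAnisotropicRep

variable {H : Type*} [Group H] {ρ : H →* SL(2, K)} {u : H} {l : Kˣ}

theorem apply_ne_zero (hρ : IsAnisotropicRep ρ) (hl : (l : K) ≠ (l : K)⁻¹) (hu : ρ u = torus l)
    {g : H} {i j : Fin 2} (hg : Commute g u → i = j) : ρ g i j ≠ 0 := by
  by_cases hgu : Commute g u
  · obtain rfl := hg hgu
    obtain ⟨h01, _⟩ := (hρ.commute_iff_of_map_eq_torus hl hu).1 hgu
    have hdet := (ρ g).2
    rw [det_fin_two, h01, zero_mul, sub_zero] at hdet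
    have := mul_ne_zero_iff.1 (hdet.trans_ne one_ne_zero)
    fin_cases i
    exacts [this.1, this.2]
  · exact hρ.apply_ne_zero_of_not_commute hl hu hgu i j

/-- The leading coefficient of the product, as a polynomial in the eigenvalue `l ^ N`, is a product
of matrices of rank one in which no factor annihilates the next one. -/
theorem finite_setOf_prod_eq_of_map_eq_torus (hρ : IsAnisotropicRep ρ) (hl : (l : K) ≠ (l : K)⁻¹)
    (hu : ρ u = torus l) (hord : ¬ IsOfFinOrder u) (h : H) (L : List (ℤˣ × H)) (hL : L ≠ [])
    (hch : L.IsChain fun a b => Commute a.2 u → a.1 = b.1) :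
    {N : ℕ | (L.map fun x => (u ^ N) ^ (x.1 : ℤ) * x.2).prod = h}.Finite := by
  let e (s : ℤˣ) : Fin 2 := if s = 1 then 0 else 1
  have hprod : ((L.map fun x => (Matrix.single (e x.1) (e x.1) (1 : K), (ρ x.2).1)).map
      fun x => x.1 * x.2).prod ≠ 0 := by
    have hrank (x : ℤˣ × H) : Matrix.single (e x.1) (e x.1) (1 : K) * (ρ x.2).1 =
        vecMulVec (Pi.single (e x.1) 1) ((ρ x.2).1 (e x.1)) := by
      rw [single_eq_single_vecMulVec_single, vecMulVec_mul, single_one_vecMul, Matrix.row]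
    let f (x : ℤˣ × H) := ((Pi.single (e x.1) 1 : Fin 2 → K), (ρ x.2).1 (e x.1))
    have hf : (L.map f).IsChain fun a b => a.2 ⬝ᵥ b.1 ≠ 0 :=
      List.isChain_map_of_isChain f (fun a b hab => by
        rw [dotProduct_single_one]
        exact hρ.apply_ne_zero hl hu fun h => congrArg e (hab h)) hch
    have hne : ∀ x ∈ L.map f, x.1 ≠ 0 ∧ x.2 ≠ 0 := List.forall_mem_map.2 fun x _ =>
      ⟨by simp [f], fun h => hρ.apply_ne_zero hl hu (fun _ => rfl) (congrFun h (e x.1))⟩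
    simpa [Function.comp_def, hrank, f] using prod_vecMulVec_ne_zero (by simpa using hL) hf hne
  have hinj : Function.Injective fun N : ℕ => l ^ N := fun N M hNM =>
    injective_pow_iff_not_isOfFinOrder.2 hord <| hρ.injective <| by
      simpa only [map_pow, hu] using congrArg torus hNM
  refine ((finite_setOf_prod_dilation_eq (by simpa using hL) hprod (ρ h).1).preimage
    hinj.injOn).subset ?_
  rintro N rfl
  have htorus (x : ℤˣ × H) : (ρ ((u ^ N) ^ (x.1 : ℤ) * x.2)).1 =
      dilation (Matrix.single (e x.1) (e x.1) 1) (l ^ N) * (ρ x.2).1 := by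
    rw [map_mul, map_zpow, map_pow, hu, ← map_pow, Matrix.SpecialLinearGroup.coe_mul,
      coe_torus_zpow_units]
  have hmap := map_list_prod (Matrix.SpecialLinearGroup.coeMonoidHom.comp ρ)
    (L.map fun x => (u ^ N) ^ (x.1 : ℤ) * x.2)
  simp only [List.map_map, Function.comp_def] at hmap
  refine Eq.trans ?_ hmap.symm
  rw [List.map_map]
  exact congrArg List.prod (List.map_congr_left fun x _ => (htorus x).symm)

theorem finite_setOf_prod_eq [IsAlgClosed K] (hρ : IsAnisotropicRep ρ) (hord : ¬ IsOfFinOrder u)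
    (h : H) (L : List (ℤˣ × H)) (hL : L ≠ [])
    (hch : L.IsChain fun a b => Commute a.2 u → a.1 = b.1) :
    {N : ℕ | (L.map fun x => (u ^ N) ^ (x.1 : ℤ) * x.2).prod = h}.Finite := by
  have hu1 : u ≠ 1 := fun h => hord (h ▸ IsOfFinOrder.one)
  obtain ⟨ρ', hρ', l, hl, hu⟩ := hρ.exists_map_eq_torus hu1
  exact hρ'.finite_setOf_prod_eq_of_map_eq_torus hl hu hord h L hL hch

end IsAnisotropicRep

end BigPowers

section FreeGroup

section Dilation

variable {R : Type*} [CommRing R] {P : Matrix (Fin 2) (Fin 2) R}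

theorem det_dilation (htr : trace P = 1) (hdet : P.det = 0) (t : Rˣ) : (dilation P t).det = 1 := by
  have ht : (t : R) * (↑t⁻¹ : R) = 1 := t.mul_inv
  rw [trace_fin_two, ← eq_sub_iff_add_eq'] at htr
  rw [det_fin_two, htr] at hdet
  simp only [dilation, det_fin_two, Matrix.add_apply, Matrix.sub_apply, Matrix.smul_apply,
    smul_eq_mul, htr]
  simp
  linear_combination ((t : R) - (↑t⁻¹ : R)) ^ 2 * hdet + ht

theorem adjugate_dilation (htr : trace P = 1) (t : Rˣ) :
    (dilation P t).adjugate = dilation (1 - P) t := by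
  rw [trace_fin_two] at htr
  rw [adjugate_fin_two, dilation, dilation, sub_sub_cancel]
  ext i j
  fin_cases i <;> fin_cases j <;> simp
  · linear_combination ((t : R) - (↑t⁻¹ : R)) * htr
  · ring
  · ring
  · linear_combination ((t : R) - (↑t⁻¹ : R)) * htr

variable {ι : Type*} {P : ι × Bool → Matrix (Fin 2) (Fin 2) R}

theorem exists_map_mk_eq_prod_dilation (htr : ∀ x, trace (P x) = 1) (hdet : ∀ x, (P x).det = 0)
    (hP : ∀ i, P (i, false) = 1 - P (i, true)) (t : Rˣ) :
    ∃ ρ : FreeGroup ι →* SL(2, R),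
      ∀ L, (ρ (.mk L)).1 = (L.map fun x => dilation (P x) t).prod := by
  let g (i : ι) : SL(2, R) := ⟨dilation (P (i, true)) t, det_dilation (htr _) (hdet _) t⟩
  have hg (x : ι × Bool) : (cond x.2 (g x.1) (g x.1)⁻¹).1 = dilation (P x) t := by
    obtain ⟨i, _ | _⟩ := x
    · rw [hP, ← adjugate_dilation (htr _)]
      exact Matrix.SpecialLinearGroup.coe_inv _
    · rfl
  refine ⟨FreeGroup.lift g, fun L => ?_⟩
  rw [FreeGroup.lift_mk]
  refine (map_list_prod (Matrix.SpecialLinearGroup.coeMonoidHom (ι := Fin 2) (R := R)) _).trans ?_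
  rw [List.map_map]
  exact congrArg List.prod (List.map_congr_left fun x _ => hg x)

end Dilation

theorem trace_prod_dilation_sq_ne {n k K : Type*} [Fintype n] [DecidableEq n] [Field k] [Field K]
    [Algebra k K] {t : Kˣ} (ht : Transcendental k (t : K)) {L : List (Matrix n n k)} (hL : L ≠ [])
    (hprod : trace L.prod ≠ 0) (c : k) :
    trace (L.map fun P => dilation (P.map (algebraMap k K)) t).prod ^ 2 ≠ algebraMap k K c := by
  let M : List (Matrix n n k × Matrix n n k) := L.map fun P => (P, 1)
  let p : k[X] := trace (M.map dilationPolynomial).prod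
  have hcoeff : p.coeff (L.length * 2) = trace L.prod := by
    rw [show L.length = M.length from (List.length_map _).symm]
    simp only [p, trace, finsetSum_coeff, Matrix.diag_apply, coeff_prod_dilationPolynomial]
    simp [Function.comp_def, M]
  have hdeg : p.natDegree ≤ L.length * 2 := natDegree_sum_le_of_forall_le _ _ fun i _ => by
    simpa [M] using natDegree_prod_dilationPolynomial_le M i i
  have heval : aeval (t : K) p =
      (t : K) ^ L.length * trace (L.map fun P => dilation (P.map (algebraMap k K)) t).prod := by
    rw [AddMonoidHom.map_trace (aeval (t : K)), map_aeval_prod_dilationPolynomial, trace_smul]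
    simp [M, Function.comp_def]
  intro h
  have hp : p ^ 2 = C c * X ^ (L.length * 2) := by
    refine sub_eq_zero.1 (by_contra fun hne => ht ⟨_, hne, ?_⟩)
    rw [map_sub, map_pow, heval, mul_pow, h, map_mul, aeval_C, map_pow, aeval_X]
    ring
  have hlen : 2 * (L.length * 2) ≠ L.length * 2 := by
    have := List.length_pos_iff.2 hL
    omega
  have hsq := coeff_pow_of_natDegree_le (m := 2) hdeg
  rw [hp, coeff_C_mul_X_pow, if_neg hlen, hcoeff] at hsq
  exact hprod (pow_eq_zero_iff two_ne_zero |>.1 hsq.symm)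

/-- The projection of the plane onto the line through `(a x, 1)` along the line through
`(a x⁻¹, 1)`, where `x⁻¹` is the letter inverse to the letter `x` of a free group. -/
def letterProjection {ι k : Type*} [Field k] (a : ι × Bool → k) (x : ι × Bool) :
    Matrix (Fin 2) (Fin 2) k :=
  vecMulVec ![a x, 1] ((a x - a (x.1, !x.2))⁻¹ • ![1, -a (x.1, !x.2)])

section LetterProjection

variable {ι k : Type*} [Field k] {a : ι × Bool → k}

theorem trace_letterProjection (ha : Function.Injective a) (x : ι × Bool) :
    trace (letterProjection a x) = 1 := by
  have : a x - a (x.1, !x.2) ≠ 0 := sub_ne_zero.2 (ha.ne (by simp [Prod.ext_iff]))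
  rw [letterProjection, trace_vecMulVec, dotProduct_smul]
  simpa [← sub_eq_add_neg] using inv_mul_cancel₀ this

theorem det_letterProjection (a : ι × Bool → k) (x : ι × Bool) :
    (letterProjection a x).det = 0 :=
  det_vecMulVec _ _

theorem letterProjection_false (ha : Function.Injective a) (i : ι) :
    letterProjection a (i, false) = 1 - letterProjection a (i, true) := by
  have h : a (i, true) - a (i, false) ≠ 0 := sub_ne_zero.2 (ha.ne (by simp))
  have h' : a (i, false) - a (i, true) ≠ 0 := sub_ne_zero.2 (ha.ne (by simp))
  ext r s
  fin_cases r <;> fin_cases s <;> simp [letterProjection, vecMulVec_apply] <;> field_simp <;> ring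

theorem trace_prod_letterProjection_ne_zero (ha : Function.Injective a) {L : List (ι × Bool)}
    (hL : FreeGroup.IsCyclicallyReduced L) (hne : L ≠ []) :
    trace (L.map (letterProjection a)).prod ≠ 0 := by
  have hdot {x y : ι × Bool} (h : x.1 = y.1 → x.2 = y.2) :
      ((a x - a (x.1, !x.2))⁻¹ • ![1, -a (x.1, !x.2)]) ⬝ᵥ ![a y, 1] ≠ 0 := by
    have hx : a x ≠ a (x.1, !x.2) := ha.ne (by simp [Prod.ext_iff])
    have hy : a y ≠ a (x.1, !x.2) := ha.ne fun hy => by simp_all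
    rw [smul_dotProduct, smul_eq_mul]
    refine mul_ne_zero (inv_ne_zero (sub_ne_zero.2 hx)) ?_
    simpa [← sub_eq_add_neg, sub_eq_zero] using hy
  let f (x : ι × Bool) := (![a x, 1], (a x - a (x.1, !x.2))⁻¹ • ![1, -a (x.1, !x.2)])
  have := trace_prod_vecMulVec_ne_zero (L := L.map f) (by simpa using hne)
    (List.isChain_map_of_isChain f (fun _ _ => hdot) hL.isReduced)
    (by
      simp only [List.getLast?_map, List.head?_map, Option.mem_map, forall_exists_index, and_imp]
      rintro _ x hx rfl _ y hy rfl
      exact hdot (hL.2 x hx y hy))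
  rwa [List.map_map] at this

end LetterProjection

theorem isAnisotropicRep_of_forall_isCyclicallyReduced {ι R : Type*} [CommRing R]
    {ρ : FreeGroup ι →* SL(2, R)}
    (h : ∀ L, FreeGroup.IsCyclicallyReduced L → L ≠ [] → trace (ρ (.mk L)).1 ^ 2 ≠ 4) :
    IsAnisotropicRep ρ := by
  classical
  intro g hg
  have hred := FreeGroup.reduceCyclically.isCyclicallyReduced (FreeGroup.isReduced_toWord (x := g))
  have hconj := FreeGroup.reduceCyclically.conj_conjugator_reduceCyclically g.toWord
  set L := FreeGroup.reduceCyclically g.toWord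
  set N := FreeGroup.reduceCyclically.conjugator g.toWord
  have hgL : g = .mk N * .mk L * (.mk N)⁻¹ := by
    rw [FreeGroup.inv_mk, FreeGroup.mul_mk, FreeGroup.mul_mk, hconj, FreeGroup.mk_toWord]
  have hL : L ≠ [] := by
    intro h
    rw [h, ← FreeGroup.one_eq_mk, mul_one, mul_inv_cancel] at hgL
    exact hg hgL
  have htr : trace (ρ g).1 = trace (ρ (.mk L)).1 := by
    rw [hgL, map_mul, map_mul, map_inv, trace_conj_specialLinearGroup]
  exact htr ▸ h L hred hL

theorem exists_isAnisotropicRep_freeGroup_of_transcendental {ι k K : Type*} [Field k] [Field K]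
    [Algebra k K] {a : ι × Bool → k} (ha : Function.Injective a) {t : K}
    (ht : Transcendental k t) : ∃ ρ : FreeGroup ι →* SL(2, K), IsAnisotropicRep ρ := by
  obtain ⟨t, rfl⟩ : IsUnit t := isUnit_iff_ne_zero.2 fun h => ht (h ▸ isAlgebraic_zero)
  obtain ⟨ρ, hρ⟩ := exists_map_mk_eq_prod_dilation
    (P := fun x => (letterProjection a x).map (algebraMap k K))
    (fun x => by rw [← AddMonoidHom.map_trace, trace_letterProjection ha, map_one])
    (fun x => by
      rw [← RingHom.mapMatrix_apply, ← RingHom.map_det, det_letterProjection, map_zero])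
    (fun i => by
      rw [letterProjection_false ha, Matrix.map_sub _ (map_sub _),
        Matrix.map_one _ (map_zero _) (map_one _)]) t
  refine ⟨ρ, isAnisotropicRep_of_forall_isCyclicallyReduced fun L hred hL => ?_⟩
  have htr := trace_prod_dilation_sq_ne ht (L := L.map (letterProjection a)) (by simpa using hL)
    (trace_prod_letterProjection_ne_zero ha hred hL) 4
  rwa [List.map_map, map_ofNat, Function.comp_def, ← hρ] at htr

theorem exists_isAnisotropicRep_freeGroup (ι : Type u) :
    ∃ (K : Type u) (_ : Field K) (_ : IsAlgClosed K) (ρ : FreeGroup ι →* SL(2, K)),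
      IsAnisotropicRep ρ := by
  let k := FractionRing (MvPolynomial (ι × Bool) ℚ)
  let K := AlgebraicClosure (RatFunc k)
  let a (x : ι × Bool) : k := algebraMap (MvPolynomial (ι × Bool) ℚ) k (MvPolynomial.X x)
  have ha : Function.Injective a :=
    (IsFractionRing.injective (MvPolynomial (ι × Bool) ℚ) k).comp MvPolynomial.X_injective
  have ht : Transcendental k (algebraMap (RatFunc k) K RatFunc.X) :=
    (transcendental_algebraMap_iff (algebraMap (RatFunc k) K).injective).2 RatFunc.transcendental_X
  obtain ⟨ρ, hρ⟩ := exists_isAnisotropicRep_freeGroup_of_transcendental ha ht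
  exact ⟨K, inferInstance, inferInstance, ρ, hρ⟩

end FreeGroup

end AnisotropicRep

section FullyResiduallyFree

open scoped commutatorElement

theorem freeGroup_commute_trans {ι : Type*} {u a b : FreeGroup ι} (hu : u ≠ 1)
    (ha : Commute a u) (hb : Commute b u) : Commute a b := by
  obtain ⟨K, _, _, ρ, hρ⟩ := exists_isAnisotropicRep_freeGroup ι
  exact hρ.commute_trans hu ha hb

theorem freeGroup_commute_of_commute_conj {ι : Type*} {u g : FreeGroup ι} (hu : u ≠ 1)
    (h : Commute (g * u * g⁻¹) u) : Commute g u := by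
  obtain ⟨K, _, _, ρ, hρ⟩ := exists_isAnisotropicRep_freeGroup ι
  exact hρ.commute_of_commute_conj hu h

namespace IsFullyResiduallyFree

variable {H : Type u} [Group H]

theorem exists_map_ne_one_and_not_commute (hH : IsFullyResiduallyFree H) {u a b : H} (hu : u ≠ 1)
    (hab : ¬ Commute a b) :
    ∃ (ι : Type) (f : H →* FreeGroup ι), f u ≠ 1 ∧ ¬ Commute (f a) (f b) := by
  classical
  rw [← commutatorElement_eq_one_iff_commute] at hab
  obtain ⟨ι, f, hf⟩ := hH {u, ⁅a, b⁆} (by simp [hu, hab])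
  refine ⟨ι, f, hf u (by simp), ?_⟩
  rw [← commutatorElement_eq_one_iff_commute, ← map_commutatorElement]
  exact hf _ (by simp)

theorem commute_trans (hH : IsFullyResiduallyFree H) {u a b : H} (hu : u ≠ 1)
    (ha : Commute a u) (hb : Commute b u) : Commute a b := by
  by_contra hab
  obtain ⟨ι, f, hfu, hfab⟩ := hH.exists_map_ne_one_and_not_commute hu hab
  exact hfab (freeGroup_commute_trans hfu (ha.map f) (hb.map f))

theorem commute_of_commute_conj (hH : IsFullyResiduallyFree H) {u g : H} (hu : u ≠ 1)
    (h : Commute (g * u * g⁻¹) u) : Commute g u := by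
  by_contra hgu
  obtain ⟨ι, f, hfu, hfgu⟩ := hH.exists_map_ne_one_and_not_commute hu hgu
  exact hfgu (freeGroup_commute_of_commute_conj hfu (by simpa using h.map f))

end IsFullyResiduallyFree

end FullyResiduallyFree

namespace CentralizerExtension

open HNNExtension

variable {H : Type u} [Group H] {w : H}

section Lift

variable {K : Type*} [Group K] (f : H →* K) (x : K) (hx : ∀ h, Commute h w → Commute x (f h))

/-- The homomorphism from an extension of a centralizer given by the image of the base group and
the image of the new letter. -/
def lift : CentralizerExtension H w →* K :=
  HNNExtension.lift f x fun a => hx a (Subgroup.mem_centralizer_singleton_iff.1 a.2)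

@[simp]
theorem lift_of (h : H) : lift f x hx (of h) = f h :=
  HNNExtension.lift_of _ _ _ _

@[simp]
theorem lift_t : lift f x hx t = x :=
  HNNExtension.lift_t _ _ _

end Lift

theorem of_injective : Function.Injective (of : H →* CentralizerExtension H w) :=
  HNNExtension.of_injective _

theorem of_eq_one_iff {h : H} : (of h : CentralizerExtension H w) = 1 ↔ h = 1 :=
  map_eq_one_iff of of_injective

theorem commute_of_of_iff {a b : H} :
    Commute (of a : CentralizerExtension H w) (of b) ↔ Commute a b :=
  commute_map_iff of_injective

theorem commute_t_of {h : H} (hh : Commute h w) :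
    Commute (t : CentralizerExtension H w) (of h) :=
  t_mul_of (φ := MulEquiv.refl _) ⟨h, Subgroup.mem_centralizer_singleton_iff.2 hh⟩

theorem commute_t_zpow_of {h : H} (hh : Commute h w) (e : ℤ) :
    Commute ((t : CentralizerExtension H w) ^ e) (of h) :=
  (commute_t_of hh).zpow_left e

section NormalForm

theorem mem_toSubgroup {h : H} (e : ℤˣ) :
    h ∈ toSubgroup (Subgroup.centralizer {w}) (Subgroup.centralizer {w}) e ↔ Commute h w := by
  rcases Int.units_eq_one_or e with rfl | rfl <;>
    exact Subgroup.mem_centralizer_singleton_iff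

theorem exists_reduced_list (g : CentralizerExtension H w) :
    ∃ (h : H) (L : List (ℤˣ × H)), L.IsChain (fun a b => Commute a.2 w → a.1 = b.1) ∧
      g = of h * (L.map fun x => (t : CentralizerExtension H w) ^ (x.1 : ℤ) * of x.2).prod := by
  obtain ⟨d⟩ := NormalWord.TransversalPair.nonempty H (Subgroup.centralizer {w})
    (Subgroup.centralizer {w})
  let W := NormalWord.equiv (MulEquiv.refl _) d g
  refine ⟨W.head, W.toList, ?_, ?_⟩
  · exact W.chain.imp fun a b hab hcomm => hab ((mem_toSubgroup _).2 hcomm)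
  · exact ((NormalWord.equiv (MulEquiv.refl _) d).symm_apply_apply g).symm

/-- **Britton's lemma**. -/
theorem eq_nil_of_prod_mem_range (h : H) (L : List (ℤˣ × H))
    (hch : L.IsChain (fun a b => Commute a.2 w → a.1 = b.1))
    (hmem : of h * (L.map fun x => (t : CentralizerExtension H w) ^ (x.1 : ℤ) * of x.2).prod ∈
      (of : H →* CentralizerExtension H w).range) : L = [] :=
  ReducedWord.toList_eq_nil_of_mem_of_range (MulEquiv.refl _)
    ⟨h, L, hch.imp fun _ _ hab hmem => hab ((mem_toSubgroup _).1 hmem)⟩ hmem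

end NormalForm

section Retraction

open scoped commutatorElement

/-- The retraction that maps the new letter to `w ^ N`. -/
def retraction (w : H) (N : ℕ) : CentralizerExtension H w →* H :=
  lift (MonoidHom.id H) (w ^ N) fun _ hh => hh.symm.pow_left N

@[simp]
theorem retraction_of (N : ℕ) (h : H) : retraction w N (of h) = h := lift_of _ _ _ _

@[simp]
theorem retraction_t (N : ℕ) : retraction w N t = w ^ N := lift_t _ _ _

theorem map_retraction_of_mul_prod {F : Type*} [Group F] (f : H →* F) (N : ℕ) (h : H)
    (L : List (ℤˣ × H)) :
    f (retraction w N (of h * (L.map fun x => t ^ (x.1 : ℤ) * of x.2).prod)) =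
      f h * ((L.map fun x => (x.1, f x.2)).map fun x => (f w ^ N) ^ (x.1 : ℤ) * x.2).prod := by
  simp only [map_mul, map_list_prod, List.map_map, retraction_of, Function.comp_def, map_zpow,
    retraction_t, map_pow]

theorem exists_finset_forall_finite_setOf_map_retraction_eq_one (hw : w ≠ 1)
    {g : CentralizerExtension H w} (hg : g ≠ 1) :
    ∃ S : Finset H, (∀ s ∈ S, s ≠ 1) ∧ ∀ (ι : Type) (f : H →* FreeGroup ι), (∀ s ∈ S, f s ≠ 1) →
      {N : ℕ | f (retraction w N g) = 1}.Finite := by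
  classical
  obtain ⟨h, L, hch, rfl⟩ := exists_reduced_list g
  refine ⟨(insert w (insert h (L.map fun x => ⁅x.2, w⁆).toFinset)).filter (· ≠ 1),
    fun s hs => (Finset.mem_filter.1 hs).2, fun ι f hf => ?_⟩
  simp only [Finset.mem_filter, Finset.mem_insert, List.mem_toFinset, List.mem_map] at hf
  have hfw : f w ≠ 1 := hf w ⟨.inl rfl, hw⟩
  simp only [map_retraction_of_mul_prod]
  rcases eq_or_ne L [] with rfl | hL
  · have hfh : f h ≠ 1 := hf h ⟨.inr (.inl rfl), by rintro rfl; simp at hg⟩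
    simp [hfh]
  · have hfcomm : ∀ x ∈ L, Commute (f x.2) (f w) → Commute x.2 w := by
      intro x hx hfx
      by_contra hxw
      rw [← commutatorElement_eq_one_iff_commute] at hxw hfx
      exact hf _ ⟨.inr (.inr ⟨x, hx, rfl⟩), hxw⟩ (by rwa [map_commutatorElement])
    obtain ⟨K, _, _, ρ, hρ⟩ := exists_isAnisotropicRep_freeGroup ι
    simp only [mul_eq_one_iff_inv_eq, eq_comm (a := (f h)⁻¹)]
    refine hρ.finite_setOf_prod_eq (not_isOfFinOrder_of_isMulTorsionFree hfw) _ _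
      (by simpa using hL) ?_
    rw [List.isChain_map]
    exact hch.imp_of_mem_imp fun a b ha _ hab hfa => hab (hfcomm a ha hfa)

theorem exists_retraction_of_finset (hH : IsFullyResiduallyFree H) (hw : w ≠ 1)
    (A : Finset (CentralizerExtension H w)) (hA : ∀ g ∈ A, g ≠ 1) :
    ∃ (N : ℕ) (ι : Type) (f : H →* FreeGroup ι), ∀ g ∈ A, f (retraction w N g) ≠ 1 := by
  classical
  choose! S hS hfin using fun (g : CentralizerExtension H w) (hg : g ≠ 1) =>
    exists_finset_forall_finite_setOf_map_retraction_eq_one hw hg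
  obtain ⟨ι, f, hf⟩ := hH (A.biUnion S) fun s hs => by
    obtain ⟨g, hg, hsg⟩ := Finset.mem_biUnion.1 hs
    exact hS g (hA g hg) s hsg
  obtain ⟨N, hN⟩ := (A.finite_toSet.biUnion fun g hg => hfin g (hA g hg) ι f fun s hs =>
    hf s (Finset.mem_biUnion.2 ⟨g, hg, hs⟩)).exists_notMem
  exact ⟨N, ι, f, fun g hg hgN => hN (Set.mem_biUnion hg hgN)⟩

theorem isFullyResiduallyFree (hH : IsFullyResiduallyFree H) (hw : w ≠ 1) :
    IsFullyResiduallyFree (CentralizerExtension H w) := by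
  intro A hA
  obtain ⟨N, ι, f, hf⟩ := exists_retraction_of_finset hH hw A hA
  exact ⟨ι, f.comp (retraction w N), hf⟩

theorem exists_retraction_ne_one (hH : IsFullyResiduallyFree H) (hw : w ≠ 1)
    {g : CentralizerExtension H w} (hg : g ≠ 1) : ∃ N, retraction w N g ≠ 1 := by
  obtain ⟨N, ι, f, hf⟩ := exists_retraction_of_finset hH hw {g} (by simpa using hg)
  exact ⟨N, fun h => hf g (Finset.mem_singleton_self _) (by rw [h, map_one])⟩

end Retraction

section Commutation

theorem commute_and_eq_of_conj_eq_of {e : ℤˣ} {h g : H}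
    (heq : (t : CentralizerExtension H w) ^ (e : ℤ) * of h * t ^ (-(e : ℤ)) = of g) :
    Commute h w ∧ h = g := by
  have hc : Commute h w := by
    by_contra hc
    have := eq_nil_of_prod_mem_range (w := w) 1 [(e, h), (-e, 1)] (by simp [hc])
      ⟨g, by rw [← heq]; simp⟩
    simp at this
  refine ⟨hc, of_injective (w := w) ?_⟩
  rw [← heq, (commute_t_zpow_of hc e).eq, mul_assoc, ← zpow_add, add_neg_cancel, zpow_zero, mul_one]

theorem not_commute_of_mul_conj (hH : IsFullyResiduallyFree H) (e : ℤˣ) {a b g : H}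
    (hb : ¬ Commute b w) (hg : g ≠ 1) :
    ¬ Commute (of g : CentralizerExtension H w)
      (of a * (t ^ (-(e : ℤ)) * of b * t ^ (e : ℤ))) := by
  intro hc
  have hw : w ≠ 1 := by
    rintro rfl
    exact hb (Commute.one_right b)
  have hconj : t ^ (-(e : ℤ)) * of b * t ^ (e : ℤ) * of g * t ^ (-(e : ℤ)) * of b⁻¹ *
      t ^ (e : ℤ) = (of (a⁻¹ * g * a) : CentralizerExtension H w) := by
    have := hc.eq
    simp only [map_mul, map_inv, zpow_neg, mul_assoc] at this ⊢
    rw [eq_inv_mul_iff_mul_eq]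
    simp only [← mul_assoc] at this ⊢
    rw [← this]
    group
  have hgw : Commute g w := by
    by_contra hgw
    have := eq_nil_of_prod_mem_range (w := w) 1 [(-e, b), (e, g), (-e, b⁻¹), (e, 1)]
      (by simp [hb, hgw])
      ⟨a⁻¹ * g * a, by rw [← hconj]; simp [mul_assoc]⟩
    simp at this
  have htg : t ^ (e : ℤ) * of g * t ^ (-(e : ℤ)) = (of g : CentralizerExtension H w) := by
    rw [(commute_t_zpow_of hgw _).eq, mul_assoc, ← zpow_add, add_neg_cancel, zpow_zero, mul_one]
  have hconj' : t ^ ((-e : ℤˣ) : ℤ) * of (b * g * b⁻¹) * t ^ (-((-e : ℤˣ) : ℤ)) =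
      (of (a⁻¹ * g * a) : CentralizerExtension H w) := by
    rw [← hconj, map_mul, map_mul]
    conv_lhs => rw [← htg]
    simp [mul_assoc]
  have hbg : Commute b g := hH.commute_of_commute_conj hg
    (hH.commute_trans hw (commute_and_eq_of_conj_eq_of hconj').1 hgw)
  exact hb (hH.commute_trans hg hbg hgw.symm)

theorem not_commute_of_mul_t {a b h : H} (ha : ¬ Commute a w) (hb : ¬ Commute b w) :
    ¬ Commute (of h * t : CentralizerExtension H w) (of a * (t⁻¹ * of b * t)) := by
  intro hc
  have hred : t * of a * t⁻¹ * of (b * h⁻¹) * t⁻¹ * of b⁻¹ * t =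
      (of (h⁻¹ * a) : CentralizerExtension H w) := by
    have := hc.eq
    simp only [map_mul, map_inv, mul_assoc] at this ⊢
    rw [eq_inv_mul_iff_mul_eq]
    simp only [← mul_assoc] at this ⊢
    rw [mul_left_inj] at this
    rw [this]
    group
  have := eq_nil_of_prod_mem_range (w := w) 1 [(1, a), (-1, b * h⁻¹), (-1, b⁻¹), (1, 1)]
    (by simp [ha, hb])
    ⟨h⁻¹ * a, by rw [← hred]; simp [mul_assoc]⟩
  simp at this

theorem commute_of_commute_t_mul {a g : H}
    (hc : Commute (of g : CentralizerExtension H w) (t * of a)) : Commute g w ∧ Commute g a := by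
  have hconj : t ^ ((-1 : ℤˣ) : ℤ) * of g * t ^ (-((-1 : ℤˣ) : ℤ)) =
      (of (a * g * a⁻¹) : CentralizerExtension H w) := by
    simp only [map_mul, map_inv, Units.val_neg, Units.val_one, zpow_neg, zpow_one, inv_inv]
    rw [eq_mul_inv_iff_mul_eq, mul_assoc, mul_assoc, inv_mul_eq_iff_eq_mul, hc.eq, mul_assoc]
  obtain ⟨hgw, heq⟩ := commute_and_eq_of_conj_eq_of hconj
  exact ⟨hgw, eq_mul_inv_iff_mul_eq.1 heq⟩

theorem commute_of_commute_conj_inv_mul {a b : H}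
    (hc : Commute (t⁻¹ * of a * t : CentralizerExtension H w) (t⁻¹ * of b)) : Commute a b := by
  have hconj : t ^ ((-1 : ℤˣ) : ℤ) * of a * t ^ (-((-1 : ℤˣ) : ℤ)) =
      (of (b⁻¹ * a * b) : CentralizerExtension H w) := by
    simp only [map_mul, map_inv, Units.val_neg, Units.val_one, zpow_neg, zpow_one, inv_inv]
    rw [mul_assoc (of b)⁻¹, eq_inv_mul_iff_mul_eq]
    simpa only [mul_assoc, mul_inv_cancel_left, mul_right_inj] using hc.eq.symm
  have heq := (commute_and_eq_of_conj_eq_of hconj).2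
  rw [mul_assoc, eq_inv_mul_iff_mul_eq] at heq
  exact heq.symm

end Commutation

end CentralizerExtension

namespace CentralizerExtension

open HNNExtension

variable {H : Type u} [Group H] {w : H} {Γ J : Type*} [Group Γ]

/-- `IsLift w φ B s l γ h L` says that `γ` is spelled by elements of `B` and letters `s j` in such
a way that, when `b ∈ B` is sent to `φ b` and `s j ^ e` to `l e j * t ^ e * (l (-e) j)⁻¹`, the image
of `γ` is `h` followed by the product of the reduced list `L`. -/
inductive IsLift (w : H) (φ : Γ →* H) (B : Subgroup Γ) (s : J → Γ) (l : ℤˣ → J → H) :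
    Γ → H → List (ℤˣ × H) → Prop
  | base {b : Γ} (hb : b ∈ B) : IsLift w φ B s l b (φ b) []
  | cons {b γ : Γ} {h : H} {L : List (ℤˣ × H)} (hb : b ∈ B) (hγ : IsLift w φ B s l γ h L) (e : ℤˣ)
      (j : J) (hred : ∀ x ∈ L.head?, Commute ((l (-e) j)⁻¹ * h) w → e = x.1) :
      IsLift w φ B s l (b * (s j ^ (e : ℤ) * γ)) (φ b * l e j) ((e, (l (-e) j)⁻¹ * h) :: L)

namespace IsLift

variable {f : Γ →* CentralizerExtension H w} {φ : Γ →* H} {B : Subgroup Γ} {s : J → Γ}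
  {l : ℤˣ → J → H} {γ : Γ} {h : H} {L : List (ℤˣ × H)}

theorem mul_left (hγ : IsLift w φ B s l γ h L) {b : Γ} (hb : b ∈ B) :
    IsLift w φ B s l (b * γ) (φ b * h) L := by
  cases hγ with
  | base hb' => exact map_mul φ _ _ ▸ .base (mul_mem hb hb')
  | cons hb' hγ e j hred =>
    rw [← mul_assoc, ← mul_assoc (φ b), ← map_mul]
    exact .cons (mul_mem hb hb') hγ e j hred

theorem isChain (hγ : IsLift w φ B s l γ h L) :
    L.IsChain fun a b => Commute a.2 w → a.1 = b.1 := by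
  induction hγ with
  | base => exact .nil
  | cons _ _ e j hred ih => exact List.isChain_cons.2 ⟨hred, ih⟩

theorem map_eq (hγ : IsLift w φ B s l γ h L) (hB : ∀ b ∈ B, f b = of (φ b))
    (hs : ∀ (e : ℤˣ) j, f (s j ^ (e : ℤ)) = of (l e j) * t ^ (e : ℤ) * of (l (-e) j)⁻¹) :
    f γ = of h * (L.map fun x => t ^ (x.1 : ℤ) * of x.2).prod := by
  induction hγ with
  | base hb => simp [hB _ hb]
  | cons hb _ e j _ ih =>
    rw [map_mul, map_mul, hB _ hb, hs, ih]
    simp only [map_mul, List.map_cons, List.prod_cons, mul_assoc]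

theorem letter_mul (hγ : IsLift w φ B s l γ h L)
    (hpinch : ∀ (e : ℤˣ) i j, ∀ b ∈ B, Commute ((l (-e) i)⁻¹ * φ b * l (-e) j) w →
      s i ^ (e : ℤ) * b * s j ^ (-(e : ℤ)) ∈ B) (e : ℤˣ) (j : J) :
    ∃ h' L', IsLift w φ B s l (s j ^ (e : ℤ) * γ) h' L' := by
  by_cases hred : ∀ x ∈ L.head?, Commute ((l (-e) j)⁻¹ * h) w → e = x.1
  · exact ⟨_, _, by simpa only [one_mul] using IsLift.cons B.one_mem hγ e j hred⟩
  · cases hγ with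
    | base => simp at hred
    | @cons b γ h' L hb hγ e' j' =>
      simp only [List.head?_cons, Option.mem_some_iff, forall_eq', Classical.not_imp] at hred
      obtain ⟨hcomm, hne⟩ := hred
      obtain rfl : e' = -e := Int.units_ne_iff_eq_neg.1 (Ne.symm hne)
      have hmem := hpinch e j j' b hb (by rwa [mul_assoc])
      have hassoc : s j ^ (e : ℤ) * (b * (s j' ^ ((-e : ℤˣ) : ℤ) * γ)) =
          s j ^ (e : ℤ) * b * s j' ^ (-(e : ℤ)) * γ := by
        simp only [Units.val_neg, mul_assoc]
      exact ⟨_, _, hassoc ▸ hγ.mul_left hmem⟩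

theorem exists_of_mem_closure
    (hpinch : ∀ (e : ℤˣ) i j, ∀ b ∈ B, Commute ((l (-e) i)⁻¹ * φ b * l (-e) j) w →
      s i ^ (e : ℤ) * b * s j ^ (-(e : ℤ)) ∈ B)
    (hγ : γ ∈ Subgroup.closure (B ∪ Set.range s)) : ∃ h L, IsLift w φ B s l γ h L := by
  induction hγ using Subgroup.closure_induction_left with
  | one => exact ⟨_, _, .base B.one_mem⟩
  | mul_left x hx y _ ih =>
    obtain ⟨h, L, hy⟩ := ih
    rcases hx with hx | ⟨j, rfl⟩
    · exact ⟨_, _, hy.mul_left hx⟩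
    · simpa using hy.letter_mul hpinch 1 j
  | inv_mul_cancel x hx y _ ih =>
    obtain ⟨h, L, hy⟩ := ih
    rcases hx with hx | ⟨j, rfl⟩
    · exact ⟨_, _, hy.mul_left (B.inv_mem hx)⟩
    · simpa using hy.letter_mul hpinch (-1) j

end IsLift

variable {f : Γ →* CentralizerExtension H w} {φ : Γ →* H} {B : Subgroup Γ}

theorem mem_of_mem_closure_of_map_mem_range {s : J → Γ} {p q : J → H}
    (hB : ∀ b ∈ B, f b = of (φ b)) (hs : ∀ j, f (s j) = of (p j) * t * of (q j))
    (hq : ∀ i j, ∀ b ∈ B, Commute (q i * φ b * (q j)⁻¹) w → s i * b * (s j)⁻¹ ∈ B)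
    (hp : ∀ i j, ∀ b ∈ B, Commute ((p i)⁻¹ * φ b * p j) w → (s i)⁻¹ * b * s j ∈ B)
    {γ : Γ} (hγ : γ ∈ Subgroup.closure (B ∪ Set.range s))
    (hfγ : f γ ∈ (of : H →* CentralizerExtension H w).range) : γ ∈ B := by
  let l : ℤˣ → J → H := fun e j => if e = 1 then p j else (q j)⁻¹
  have hone : ∀ j, l 1 j = p j := fun j => if_pos rfl
  have hneg : ∀ j, l (-1) j = (q j)⁻¹ := fun j => if_neg (by decide)
  have hletter : ∀ (e : ℤˣ) j,
      f (s j ^ (e : ℤ)) = of (l e j) * t ^ (e : ℤ) * of (l (-e) j)⁻¹ := by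
    intro e j
    rcases Int.units_eq_one_or e with rfl | rfl
    · simp [hone, hneg, hs]
    · simp [hone, hneg, hs, mul_assoc]
  have hpinch : ∀ (e : ℤˣ) i j, ∀ b ∈ B, Commute ((l (-e) i)⁻¹ * φ b * l (-e) j) w →
      s i ^ (e : ℤ) * b * s j ^ (-(e : ℤ)) ∈ B := by
    intro e i j b hb hc
    rcases Int.units_eq_one_or e with rfl | rfl
    · simpa using hq i j b hb (by simpa [hneg] using hc)
    · simpa using hp i j b hb (by simpa [hone] using hc)
  obtain ⟨h, L, hL⟩ := IsLift.exists_of_mem_closure hpinch hγ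
  obtain rfl : L = [] := eq_nil_of_prod_mem_range h L hL.isChain (hL.map_eq hB hletter ▸ hfγ)
  cases hL with
  | base hb => exact hb

theorem eq_one_of_mem_closure_union_range {s : J → Γ} {p q : J → H}
    (hB : ∀ b ∈ B, f b = of (φ b)) (hs : ∀ j, f (s j) = of (p j) * t * of (q j))
    (hinj : ∀ b ∈ B, φ b = 1 → b = 1)
    (hq : ∀ i j, ∀ b ∈ B, Commute (q i * φ b * (q j)⁻¹) w → s i * b * (s j)⁻¹ ∈ B)
    (hp : ∀ i j, ∀ b ∈ B, Commute ((p i)⁻¹ * φ b * p j) w → (s i)⁻¹ * b * s j ∈ B)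
    {γ : Γ} (hγ : γ ∈ Subgroup.closure (B ∪ Set.range s)) (hfγ : f γ = 1) : γ = 1 := by
  have hγB : γ ∈ B := mem_of_mem_closure_of_map_mem_range hB hs hq hp hγ (hfγ ▸ one_mem _)
  exact hinj γ hγB (of_eq_one_iff.1 ((hB γ hγB).symm.trans hfγ))

theorem eq_one_of_mem_closure_union_singleton {s : Γ} {p q : H}
    (hB : ∀ b ∈ B, f b = of (φ b)) (hs : f s = of p * t * of q)
    (hinj : ∀ b ∈ B, φ b = 1 → b = 1) (hq : ∀ b ∈ B, Commute (q * φ b * q⁻¹) w → φ b = 1)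
    (hp : ∀ b ∈ B, Commute (p⁻¹ * φ b * p) w → φ b = 1) {γ : Γ}
    (hγ : γ ∈ Subgroup.closure (B ∪ {s})) (hfγ : f γ = 1) : γ = 1 := by
  refine eq_one_of_mem_closure_union_range (J := Unit) (s := fun _ => s) hB (fun _ => hs) hinj
    (fun _ _ b hb h => ?_) (fun _ _ b hb h => ?_) (by simpa using hγ) hfγ
  · simp [hinj b hb (hq b hb h)]
  · simp [hinj b hb (hp b hb h)]

theorem mem_of_mem_closure_union_singleton {N : Subgroup Γ} [N.Normal] {s : Γ} {p q : H}
    (hNf : N ≤ f.ker) (hNφ : N ≤ φ.ker) (hB : ∀ b ∈ B, f b = of (φ b))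
    (hs : f s = of p * t * of q) (hinj : ∀ b ∈ B, φ b = 1 → b ∈ N)
    (hq : ∀ b ∈ B, Commute (q * φ b * q⁻¹) w → ∃ b' ∈ B, b'⁻¹ * (s * b * s⁻¹) ∈ N)
    (hp : ∀ b ∈ B, Commute (p⁻¹ * φ b * p) w → ∃ b' ∈ B, b'⁻¹ * (s⁻¹ * b * s) ∈ N)
    {γ : Γ} (hγ : γ ∈ Subgroup.closure (B ∪ {s})) (hfγ : f γ = 1) : γ ∈ N := by
  let π := QuotientGroup.mk' N
  have hmem : ∀ {x b' : Γ}, b' ∈ B → b'⁻¹ * x ∈ N → π x ∈ B.map π := fun hb' h =>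
    ⟨_, hb', QuotientGroup.eq.2 h⟩
  rw [← QuotientGroup.eq_one_iff]
  refine eq_one_of_mem_closure_union_range (J := Unit) (f := QuotientGroup.lift N f hNf)
    (φ := QuotientGroup.lift N φ hNφ) (B := B.map π) (s := fun _ => π s) ?_ (fun _ => hs) ?_ ?_ ?_
    ?_ hfγ
  · rintro _ ⟨b, hb, rfl⟩
    exact hB b hb
  · rintro _ ⟨b, hb, rfl⟩ hφb
    exact (QuotientGroup.eq_one_iff b).2 (hinj b hb hφb)
  · rintro - - _ ⟨b, hb, rfl⟩ hc
    obtain ⟨b', hb', h⟩ := hq b hb hc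
    exact hmem hb' h
  · rintro - - _ ⟨b, hb, rfl⟩ hc
    obtain ⟨b', hb', h⟩ := hp b hb hc
    exact hmem hb' h
  · have := Subgroup.mem_map_of_mem π hγ
    rwa [MonoidHom.map_closure, Set.image_union, Set.image_singleton, ← Subgroup.coe_map,
      ← Set.range_const (ι := Unit)] at this

end CentralizerExtension

/-- The free product of `M` with an infinite cyclic group, as an HNN extension. -/
abbrev FreeLetterExtension (M : Type*) [Group M] : Type _ :=
  HNNExtension M ⊥ ⊥ (MulEquiv.refl _)

namespace FreeLetterExtension

open HNNExtension

variable {M : Type*} [Group M] {h h' : M} {L L' W : List (ℤˣ × M)}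

/-- The word `h, (e₁, a₁), …, (eₖ, aₖ)` spells `h * t ^ e₁ * a₁ * ⋯ * t ^ eₖ * aₖ`. -/
def wordProd (h : M) (L : List (ℤˣ × M)) : FreeLetterExtension M :=
  of h * (L.map fun x => t ^ (x.1 : ℤ) * of x.2).prod

/-- A word is reduced if it has no subword `t * t⁻¹` or `t⁻¹ * t`. -/
def IsReducedWord (L : List (ℤˣ × M)) : Prop :=
  L.IsChain fun a b => a.2 = 1 → a.1 = b.1

theorem wordProd_cons (h : M) (x : ℤˣ × M) (L : List (ℤˣ × M)) :
    wordProd h (x :: L) = of h * t ^ (x.1 : ℤ) * wordProd x.2 L := by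
  simp [wordProd, mul_assoc]

theorem wordProd_append (h : M) (L L' : List (ℤˣ × M)) :
    wordProd h (L ++ L') = wordProd h L * wordProd 1 L' := by
  simp [wordProd, mul_assoc]

theorem wordProd_concat_mul_of (h : M) (L : List (ℤˣ × M)) (e : ℤˣ) (a b : M) :
    wordProd h (L ++ [(e, a)]) * of b = wordProd h (L ++ [(e, a * b)]) := by
  simp [wordProd, mul_assoc]

theorem exists_eq_wordProd (g : FreeLetterExtension M) : ∃ h L, g = wordProd h L := by
  obtain ⟨d⟩ := NormalWord.TransversalPair.nonempty M ⊥ ⊥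
  exact ⟨_, _, ((NormalWord.equiv (MulEquiv.refl _) d).symm_apply_apply g).symm⟩

theorem exists_length_lt_of_not_isReducedWord (h : M) (hL : ¬ IsReducedWord L) :
    ∃ h' L', L'.length < L.length ∧ wordProd h' L' = wordProd h L := by
  induction L generalizing h with
  | nil => exact absurd List.isChain_nil hL
  | cons x L ih =>
    by_cases hred : IsReducedWord L
    · cases L with
      | nil => exact absurd (List.isChain_singleton x) hL
      | cons y L =>
        obtain ⟨hx, hxy⟩ := Classical.not_imp.1 fun hxy => hL (List.isChain_cons_cons.2 ⟨hxy, hred⟩)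
        refine ⟨h * y.2, L, by simp, ?_⟩
        have hy : y.1 = -x.1 := Int.units_ne_iff_eq_neg.1 (Ne.symm hxy)
        simp [wordProd, hx, hy, mul_assoc]
    · obtain ⟨h', L', hlen, heq⟩ := ih x.2 hred
      exact ⟨h, (x.1, h') :: L', by simpa using hlen, by rw [wordProd_cons, wordProd_cons, heq]⟩

theorem exists_isReducedWord_length_le (h : M) (L : List (ℤˣ × M)) :
    ∃ h' L', IsReducedWord L' ∧ L'.length ≤ L.length ∧ wordProd h' L' = wordProd h L := by
  induction hn : L.length using Nat.strong_induction_on generalizing h L with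
  | _ n ih =>
    by_cases hL : IsReducedWord L
    · exact ⟨h, L, hL, hn.le, rfl⟩
    · obtain ⟨h₁, L₁, hlen, heq⟩ := exists_length_lt_of_not_isReducedWord h hL
      obtain ⟨h₂, L₂, hL₂, hlen₂, heq₂⟩ := ih _ (hn ▸ hlen) h₁ L₁ rfl
      exact ⟨h₂, L₂, hL₂, by omega, heq₂.trans heq⟩

theorem mem_zpowers_of_append_comm (hne : W ≠ [])
    (hprim : ∀ k, 0 < k → k < W.length → W.rotate k ≠ W) (hL : L ++ W = W ++ L) :
    wordProd 1 L ∈ Subgroup.zpowers (wordProd 1 W) := by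
  induction hn : L.length using Nat.strong_induction_on generalizing L with
  | _ n ih =>
    rcases le_or_gt W.length L.length with hlen | hlen
    · obtain ⟨L, rfl⟩ := List.prefix_of_prefix_length_le (hL ▸ List.prefix_append W L)
        (List.prefix_append L W) hlen
      have hL' : L ++ W = W ++ L := List.append_cancel_left (by rwa [List.append_assoc] at hL)
      have hlt : L.length < n := by simpa [← hn] using List.length_pos_of_ne_nil hne
      rw [wordProd_append]
      exact mul_mem (Subgroup.mem_zpowers _) (ih _ hlt hL' rfl)
    · obtain ⟨V, rfl⟩ := List.prefix_of_prefix_length_le (List.prefix_append L W)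
        (hL ▸ List.prefix_append W L) hlen.le
      have hV : L ++ V = V ++ L := List.append_cancel_left (by rwa [List.append_assoc] at hL)
      have hL0 : L = [] := by
        by_contra hL0
        exact hprim L.length (List.length_pos_of_ne_nil hL0) hlen
          ((List.rotate_append_length_eq L V).trans hV.symm)
      subst hL0
      simp [wordProd]

namespace IsReducedWord

theorem eq_of_wordProd_eq (hL : IsReducedWord L) (hL' : IsReducedWord L')
    (heq : wordProd h L = wordProd h' L') : h = h' ∧ L = L' := by
  let d : NormalWord.TransversalPair M ⊥ ⊥ :=
    { set := fun _ => Set.univ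
      compl := fun e => by
        rcases Int.units_eq_one_or e with rfl | rfl <;>
          simpa [toSubgroup, Subgroup.IsComplement] using Subgroup.isComplement_singleton_univ }
  have hmem : ∀ (e : ℤˣ), ∀ a ∈ toSubgroup (⊥ : Subgroup M) ⊥ e, a = 1 := by
    intro e _ ha
    rcases Int.units_eq_one_or e with rfl | rfl <;> exact ha
  let word : M → (l : List (ℤˣ × M)) → IsReducedWord l → NormalWord d := fun a l hl =>
    { head := a
      toList := l
      chain := hl.imp fun x _ hxy hx => hxy (hmem _ _ hx)
      mem_set := fun _ _ _ => Set.mem_univ _ }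
  have hword : word h L hL = word h' L' hL' := NormalWord.prod_injective (MulEquiv.refl _) d heq
  exact ⟨congrArg (fun x => x.head) hword, congrArg (fun x => x.toList) hword⟩

theorem length_le (hL : IsReducedWord L) (heq : wordProd h L = wordProd h' L') :
    L.length ≤ L'.length := by
  obtain ⟨h₁, L₁, hL₁, hlen, heq₁⟩ := exists_isReducedWord_length_le h' L'
  rwa [(hL.eq_of_wordProd_eq hL₁ (heq.trans heq₁.symm)).2]

theorem eq_of_length_le (hL : IsReducedWord L) (hlen : L'.length ≤ L.length)
    (heq : wordProd h L = wordProd h' L') : L = L' := by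
  refine (hL.eq_of_wordProd_eq (not_not.1 fun hL' => ?_) heq).2
  obtain ⟨h₁, L₁, hlt, heq₁⟩ := exists_length_lt_of_not_isReducedWord h' hL'
  exact (hlt.trans_le hlen).not_ge (hL.length_le (heq.trans heq₁.symm))

theorem exists_mul_of_eq (hL : IsReducedWord (W ++ L)) (hne : L ≠ []) (b : M) :
    ∃ L', IsReducedWord (W ++ L') ∧ L' ≠ [] ∧ wordProd 1 L * of b = wordProd 1 L' := by
  obtain ⟨L, ⟨e, a⟩, rfl⟩ := (List.eq_nil_or_concat' L).resolve_left hne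
  refine ⟨L ++ [(e, a * b)], ?_, by simp, wordProd_concat_mul_of 1 L e a b⟩
  rw [IsReducedWord, ← List.append_assoc, List.isChain_append] at hL ⊢
  simpa using hL

theorem exists_pow_mul_eq (hW : IsReducedWord (W ++ W)) (hne : W ≠ [])
    (g : FreeLetterExtension M) : ∃ (k : ℕ) (L : List (ℤˣ × M)),
      IsReducedWord (W ++ L) ∧ L ≠ [] ∧ wordProd 1 W ^ k * g = wordProd 1 L := by
  obtain ⟨h, L, rfl⟩ := exists_eq_wordProd g
  induction L using List.reverseRecOn with
  | nil =>
    obtain ⟨L, hL, hLne, heq⟩ := exists_mul_of_eq hW hne h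
    exact ⟨1, L, hL, hLne, by simpa [wordProd] using heq⟩
  | append_singleton L₀ x ih =>
    obtain ⟨k, L, hL, hLne, heq⟩ := ih
    have hmul : wordProd 1 W ^ k * wordProd h (L₀ ++ [x]) = wordProd 1 (L ++ [x]) := by
      rw [wordProd_append, wordProd_append, ← mul_assoc, heq]
    by_cases hred : IsReducedWord (L ++ [x])
    · exact ⟨k, L ++ [x], List.append_assoc W L _ ▸ hL.append_overlap hred hLne, by simp, hmul⟩
    · obtain ⟨L, ⟨e, a⟩, rfl⟩ := (List.eq_nil_or_concat' L).resolve_left hLne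
      rw [IsReducedWord, List.append_assoc, List.singleton_append,
        List.isChain_append_cons_cons] at hred
      obtain ⟨ha, hex⟩ := Classical.not_imp.1 fun hx =>
        hred ⟨hL.right_of_append, hx, List.isChain_singleton x⟩
      obtain rfl : a = 1 := ha
      have hx : x.1 = -e := Int.units_ne_iff_eq_neg.1 (Ne.symm hex)
      have hcancel : wordProd 1 (L ++ [(e, 1)] ++ [x]) = wordProd 1 L * of x.2 := by
        simp [wordProd, hx]
      have hWL : IsReducedWord (W ++ L) := by
        rw [← List.append_assoc] at hL
        exact hL.left_of_append
      obtain ⟨L', hL', hLne', heq'⟩ :=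
        exists_mul_of_eq (List.append_assoc W W L ▸ hW.append_overlap hWL hne)
          (List.append_ne_nil_of_left_ne_nil hne L) x.2
      refine ⟨k + 1, L', hL', hLne', ?_⟩
      rw [pow_succ', mul_assoc, hmul, hcancel, ← heq', wordProd_append, mul_assoc]

theorem mem_zpowers_of_commute (hW : IsReducedWord (W ++ W)) (hne : W ≠ [])
    (hprim : ∀ k, 0 < k → k < W.length → W.rotate k ≠ W) {g : FreeLetterExtension M}
    (hg : Commute g (wordProd 1 W)) : g ∈ Subgroup.zpowers (wordProd 1 W) := by
  obtain ⟨k, L, hL, -, heq⟩ := hW.exists_pow_mul_eq hne g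
  have hcomm : wordProd 1 (W ++ L) = wordProd 1 (L ++ W) := by
    rw [wordProd_append, wordProd_append, ← heq]
    exact (((Commute.refl _).pow_left k).mul_left hg).eq.symm
  have happend : L ++ W = W ++ L := (hL.eq_of_length_le (by simp [add_comm]) hcomm).symm
  rw [← Subgroup.mul_mem_cancel_left _ (Subgroup.pow_mem _ (Subgroup.mem_zpowers _) k), heq]
  exact mem_zpowers_of_append_comm hne hprim happend

end IsReducedWord

theorem mem_zpowers_t_of_commute {g : FreeLetterExtension M} (hg : Commute g t) :
    g ∈ Subgroup.zpowers (t : FreeLetterExtension M) := by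
  have ht : wordProd (1 : M) [(1, 1)] = t := by simp [wordProd]
  rw [← ht] at hg ⊢
  exact IsReducedWord.mem_zpowers_of_commute (by simp [IsReducedWord]) (by simp) (by simp; omega) hg

theorem mem_zpowers_of_commute_conj_mul {c c' : M} (hc : c ≠ 1) (hc' : c' ≠ 1)
    {g : FreeLetterExtension M} (hg : Commute g (t⁻¹ * of c * t * of c')) :
    g ∈ Subgroup.zpowers (t⁻¹ * of c * t * of c' : FreeLetterExtension M) := by
  have hw : wordProd 1 [(-1, c), (1, c')] = t⁻¹ * of c * t * of c' := by
    simp [wordProd, mul_assoc]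
  rw [← hw] at hg ⊢
  refine IsReducedWord.mem_zpowers_of_commute (by simp [IsReducedWord, hc, hc']) (by simp)
    (fun k hk hk' => ?_) hg
  obtain rfl : k = 1 := by simp at hk'; omega
  simp

end FreeLetterExtension

namespace GX

variable {G : Type u} [Group G] {m n : ℕ}

section generated

variable {Y : Set (QVar m n)} {γ : GX G m n}

/-- The subgroup of `G[X]` generated by the constants and the variables in `Y`. -/
def generated (G : Type u) [Group G] (Y : Set (QVar m n)) : Subgroup (GX G m n) :=
  Subgroup.closure (Set.range const ∪ var '' Y)

theorem const_mem_generated (g : G) (Y : Set (QVar m n)) : const g ∈ generated G Y :=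
  Subgroup.subset_closure (Or.inl ⟨g, rfl⟩)

theorem var_mem_generated {w : QVar m n} (hw : w ∈ Y) : var w ∈ generated G Y :=
  Subgroup.subset_closure (Or.inr ⟨w, hw, rfl⟩)

theorem generated_mono {Y' : Set (QVar m n)} (h : Y ⊆ Y') : generated G Y ≤ generated G Y' :=
  Subgroup.closure_mono (Set.union_subset_union_right _ (Set.image_mono h))

theorem generated_le {K : Subgroup (GX G m n)} (hc : ∀ g, const g ∈ K)
    (hv : ∀ w ∈ Y, var w ∈ K) : generated G Y ≤ K := by
  rw [generated, Subgroup.closure_le]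
  exact Set.union_subset (Set.range_subset_iff.2 hc) (Set.image_subset_iff.2 hv)

theorem eq_of_mem_generated {K : Type*} [Group K] {f g : GX G m n →* K}
    (hc : ∀ a, f (const a) = g (const a)) (hv : ∀ w ∈ Y, f (var w) = g (var w))
    (hγ : γ ∈ generated G Y) : f γ = g γ :=
  generated_le (K := MonoidHom.eqLocus f g) hc hv hγ

theorem hom_ext {K : Type*} [Group K] {f g : GX G m n →* K}
    (hc : ∀ a, f (const a) = g (const a)) (hv : ∀ w, f (var w) = g (var w)) : f = g :=
  Monoid.Coprod.hom_ext (MonoidHom.ext hc) (FreeGroup.ext_hom _ _ hv)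

theorem generated_univ : generated G (Set.univ : Set (QVar m n)) = ⊤ := by
  rw [eq_top_iff, ← Monoid.Coprod.range_inl_sup_range_inr, sup_le_iff]
  constructor
  · rintro _ ⟨g, rfl⟩
    exact const_mem_generated g _
  · rw [MonoidHom.range_eq_map, ← FreeGroup.closure_range_of, MonoidHom.map_closure,
      Subgroup.closure_le]
    rintro _ ⟨_, ⟨w, rfl⟩, rfl⟩
    exact var_mem_generated (Set.mem_univ w)

theorem const_injective : Function.Injective (const : G → GX G m n) :=
  Monoid.Coprod.inl_injective

theorem const_eq_one_iff {g : G} : (const g : GX G m n) = 1 ↔ g = 1 :=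
  const_injective.eq_iff' (map_one Monoid.Coprod.inl)

theorem var_ne_one (v : QVar m n) : (var v : GX G m n) ≠ 1 := by
  intro h
  have hsnd := congrArg (Monoid.Coprod.snd : GX G m n →* _) h
  simp [var, FreeGroup.of_ne_one] at hsnd

end generated

section eval

variable {H K : Type*} [Group H] [Group K] (ι : G →* H) (v : QVar m n → H)

/-- The homomorphism `G[X] → H` with given restriction to `G` and given values of the variables. -/
def eval : GX G m n →* H :=
  Monoid.Coprod.lift ι (FreeGroup.lift v)

@[simp]
theorem eval_const (g : G) : eval ι v (const g) = ι g := by simp [eval, const]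

@[simp]
theorem eval_var (w : QVar m n) : eval ι v (var w) = v w := by simp [eval, var]

variable {ι v}

theorem map_eval_of_mem (f : H →* K) {ι' : G →* K} {v' : QVar m n → K} {Y : Set (QVar m n)}
    (hι : ∀ g, f (ι g) = ι' g) (hv : ∀ w ∈ Y, f (v w) = v' w) {γ : GX G m n}
    (hγ : γ ∈ generated G Y) : f (eval ι v γ) = eval ι' v' γ :=
  eq_of_mem_generated (f := f.comp (eval ι v)) (by simpa using hι) (by simpa using hv) hγ

theorem map_eval (f : H →* K) {ι' : G →* K} {v' : QVar m n → K}
    (hι : ∀ g, f (ι g) = ι' g) (hv : ∀ w, f (v w) = v' w) (γ : GX G m n) :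
    f (eval ι v γ) = eval ι' v' γ :=
  map_eval_of_mem f hι (fun w _ => hv w) (Y := Set.univ) (by simp [generated_univ])

end eval

section Centralizers

variable {v : QVar m n} {w γ : GX G m n}

open HNNExtension in
theorem exists_freeLetter (hw : w ∈ generated G {z | z ≠ v}) :
    ∃ φ : GX G m n →* FreeLetterExtension (GX G m n), Function.Injective φ ∧
      φ (var v * w) = t ∧ ∀ γ ∈ generated G {z | z ≠ v}, φ γ = of γ := by
  classical
  let φ : GX G m n →* FreeLetterExtension (GX G m n) :=
    eval (of.comp Monoid.Coprod.inl) fun z => if z = v then t * (of w)⁻¹ else of (var z)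
  let ψ : FreeLetterExtension (GX G m n) →* GX G m n :=
    HNNExtension.lift (MonoidHom.id _) (var v * w) fun a => by
      simp [Subgroup.mem_bot.1 a.2]
  have hφof : ∀ γ ∈ generated G {z | z ≠ v}, φ γ = of γ := fun γ =>
    eq_of_mem_generated (fun g => eval_const _ _ g) fun z hz =>
      (eval_var _ _ z).trans (if_neg hz)
  have hφv : φ (var v) = t * (of w)⁻¹ := (eval_var _ _ v).trans (if_pos rfl)
  have hψφ : ψ.comp φ = MonoidHom.id _ := by
    refine hom_ext (fun g => ?_) fun z => ?_
    · exact (congrArg ψ (hφof _ (const_mem_generated g _))).trans (HNNExtension.lift_of _ _ _ _)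
    · by_cases hz : z = v
      · simp [hz, hφv, ψ]
      · simp [hφof _ (var_mem_generated hz), ψ]
  exact ⟨φ, Function.LeftInverse.injective (g := ψ) (DFunLike.congr_fun hψφ),
    by rw [map_mul, hφv, hφof w hw, inv_mul_cancel_right], hφof⟩

theorem mem_zpowers_of_map_mem {A B : Type*} [Group A] [Group B] {φ : A →* B}
    (hφ : Function.Injective φ) {a b : A} (h : φ a ∈ Subgroup.zpowers (φ b)) :
    a ∈ Subgroup.zpowers b := by
  rwa [← MonoidHom.map_zpowers, Subgroup.mem_map_iff_mem hφ] at h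

theorem mem_zpowers_var_mul_of_commute (hw : w ∈ generated G {z | z ≠ v})
    (h : Commute γ (var v * w)) : γ ∈ Subgroup.zpowers (var v * w) := by
  obtain ⟨φ, hφ, hφt, -⟩ := exists_freeLetter hw
  have hcomm := h.map φ
  rw [hφt] at hcomm
  exact mem_zpowers_of_map_mem hφ (hφt ▸ FreeLetterExtension.mem_zpowers_t_of_commute hcomm)

theorem mem_zpowers_var_of_commute (h : Commute γ (var v)) :
    γ ∈ Subgroup.zpowers (var v : GX G m n) := by
  have := mem_zpowers_var_mul_of_commute (w := 1) (γ := γ) (one_mem _) (by rwa [mul_one])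
  rwa [mul_one] at this

variable {c c' : GX G m n}

theorem mem_zpowers_conj_var_mul_of_commute (hw : w ∈ generated G {z | z ≠ v})
    (hc : c ∈ generated G {z | z ≠ v}) (hc' : c' ∈ generated G {z | z ≠ v}) (hc1 : c ≠ 1)
    (hc1' : c' ≠ 1) (h : Commute γ ((var v * w)⁻¹ * c * (var v * w) * c')) :
    γ ∈ Subgroup.zpowers ((var v * w)⁻¹ * c * (var v * w) * c') := by
  obtain ⟨φ, hφ, hφt, hφof⟩ := exists_freeLetter hw
  have hcomm := h.map φ
  refine mem_zpowers_of_map_mem hφ ?_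
  rw [map_mul, map_mul, map_mul, map_inv, hφt, hφof c hc, hφof c' hc'] at hcomm ⊢
  exact FreeLetterExtension.mem_zpowers_of_commute_conj_mul hc1 hc1' hcomm

theorem mem_zpowers_conj_mul_of_commute (hc : c ∈ generated G {z | z ≠ v})
    (hc' : c' ∈ generated G {z | z ≠ v}) (hc1 : c ≠ 1) (hc1' : c' ≠ 1)
    (h : Commute γ ((var v)⁻¹ * c * var v * c')) :
    γ ∈ Subgroup.zpowers ((var v)⁻¹ * c * var v * c') := by
  have := mem_zpowers_conj_var_mul_of_commute (w := 1) (γ := γ) (one_mem _) hc hc' hc1 hc1'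
    (by rwa [mul_one])
  rwa [mul_one] at this

theorem conj_var_mul_ne_one (hc : c ∈ generated G {z | z ≠ v})
    (hc' : c' ∈ generated G {z | z ≠ v}) (hc1 : c ≠ 1) : (var v)⁻¹ * c * var v * c' ≠ 1 := by
  intro h
  by_cases hc1' : c' = 1
  · rw [hc1', mul_one, mul_assoc, inv_mul_eq_one, eq_comm, mul_eq_right] at h
    exact hc1 h
  · have hv : var v ∈ Subgroup.zpowers ((var v)⁻¹ * c * var v * c') :=
      mem_zpowers_conj_mul_of_commute hc hc' hc1 hc1' (h ▸ Commute.one_right _)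
    rw [h, Subgroup.zpowers_one_eq_bot, Subgroup.mem_bot] at hv
    exact var_ne_one v hv

end Centralizers

end GX

namespace CentralizerExtension

open HNNExtension

variable {H : Type u} [Group H] {w v h : H}

theorem commute_conj_of_commute_of {x : ℤˣ × H} {L : List (ℤˣ × H)}
    (hL : (x :: L).IsChain fun a b => Commute a.2 w → a.1 = b.1)
    (hc : Commute (of h * ((x :: L).map fun x =>
      (t : CentralizerExtension H w) ^ (x.1 : ℤ) * of x.2).prod) (of v)) :
    Commute v (h * w * h⁻¹) := by
  obtain ⟨L', y, hL'⟩ := (List.eq_nil_or_concat' (x :: L)).resolve_left (List.cons_ne_nil x L)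
  have hchain : (L' ++ [(y.1, y.2 * v)]).IsChain fun a b => Commute a.2 w → a.1 = b.1 := by
    rw [hL', List.isChain_append] at hL
    exact List.isChain_append.2 ⟨hL.1, List.isChain_singleton _, by simpa using hL.2.2⟩
  have heq : of (v * h) * ((x :: L).map fun x =>
      (t : CentralizerExtension H w) ^ (x.1 : ℤ) * of x.2).prod =
      of h * ((L' ++ [(y.1, y.2 * v)]).map fun x =>
      (t : CentralizerExtension H w) ^ (x.1 : ℤ) * of x.2).prod := by
    rw [map_mul, mul_assoc, ← hc.eq, hL']
    simp [mul_assoc]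
  have hmem := (ReducedWord.map_fst_eq_and_of_prod_eq (MulEquiv.refl _)
    (w₁ := ⟨v * h, x :: L, hL.imp fun _ _ hab ha => hab ((mem_toSubgroup _).1 ha)⟩)
    (w₂ := ⟨h, L' ++ [(y.1, y.2 * v)], hchain.imp fun _ _ hab ha =>
      hab ((mem_toSubgroup _).1 ha)⟩) heq).2 x.1 (by simp)
  rw [← Commute.conj_iff h⁻¹]
  simpa [mul_assoc] using ((mem_toSubgroup _).1 hmem).inv_left

theorem commute_conj_t_of (h' : Commute v (h * w * h⁻¹)) :
    Commute (of h * t * (of h)⁻¹ : CentralizerExtension H w) (of v) := by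
  rw [← Commute.conj_iff h⁻¹] at h'
  rw [← Commute.conj_iff (of h)⁻¹]
  have ht : Commute (t : CentralizerExtension H w) (of (h⁻¹ * v * h)) :=
    commute_t_of (by simpa [mul_assoc] using h')
  simpa [mul_assoc] using ht

theorem mem_closure_of_commute_of {g : CentralizerExtension H w} (hg : Commute g (of v)) :
    g ∈ Subgroup.closure
      (of '' {h | Commute h v} ∪
        (fun h => of h * t * (of h)⁻¹) '' {h | Commute v (h * w * h⁻¹)}) := by
  obtain ⟨h, L, hL, rfl⟩ := exists_reduced_list g
  induction L generalizing h with
  | nil =>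
    simp only [List.map_nil, List.prod_nil, mul_one] at hg ⊢
    exact Subgroup.subset_closure (Or.inl ⟨h, commute_of_of_iff.1 hg, rfl⟩)
  | cons x L ih =>
    have hconj := commute_conj_of_commute_of hL hg
    set k : CentralizerExtension H w := of h * t * (of h)⁻¹ with hk
    have hsplit : of h * ((x :: L).map fun x =>
        (t : CentralizerExtension H w) ^ (x.1 : ℤ) * of x.2).prod =
        k ^ (x.1 : ℤ) * (of (h * x.2) * (L.map fun x =>
        (t : CentralizerExtension H w) ^ (x.1 : ℤ) * of x.2).prod) := by
      rw [hk, conj_zpow]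
      simp [mul_assoc]
    have hcomm : Commute (k ^ (x.1 : ℤ)) (of v) := (commute_conj_t_of hconj).zpow_left _
    rw [hsplit] at hg ⊢
    refine mul_mem (Subgroup.zpow_mem _ ?_ _) (ih _ (List.isChain_cons.1 hL).2 ?_)
    · exact Subgroup.subset_closure (Or.inr ⟨h, hconj, rfl⟩)
    · simpa only [inv_mul_cancel_left] using hcomm.inv_left.mul_left hg

end CentralizerExtension

namespace QVar

variable {m n : ℕ}

/-- The index of the atom in which a variable occurs. -/
def pos : QVar m n → ℕ
  | x i => m + i
  | y i => m + i
  | z i => i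

end QVar

namespace Move

variable {m n : ℕ}

/-- The index of the first atom affected by a step. -/
def lo : Move m n → ℕ
  | zz i => i
  | zx _ _ => m - 1
  | twistY i => m + i
  | twistX i => m + i
  | xx i => m + i

/-- The index of the last atom affected by a step. -/
def hi : Move m n → ℕ
  | zz i => i + 1
  | zx _ _ => m
  | twistY i => m + i
  | twistX i => m + i
  | xx i => m + i + 1

section act

variable {K K' : Type u} [Group K] [Group K'] {v v' : QVar m n → K} {k l : Move m n}

theorem act_of_outside (t : K) {w : QVar m n} (hw : w.pos < k.lo ∨ k.hi < w.pos) :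
    k.act t v w = v w := by
  rcases k with i | ⟨hm, hn⟩ | i | i | i <;> rcases w with j | j | j <;>
    simp only [QVar.pos, lo, hi, act, Fin.ext_iff] at hw ⊢ <;> (repeat' split) <;>
    first | rfl | (exfalso; omega)

theorem act_congr (t : K) (k : Move m n) {w : QVar m n} (hw : v w = v' w) :
    k.act t v w = k.act t v' w := by
  rcases k with i | ⟨hm, hn⟩ | i | i | i <;> rcases w with j | j | j <;>
    simp only [act, hw]

theorem act_one (v : QVar m n → K) (k : Move m n) : k.act 1 v = v := by
  funext w
  rcases k with i | ⟨hm, hn⟩ | i | i | i <;> rcases w with j | j | j <;>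
    simp [act]

theorem map_act (f : K →* K') (t : K) (v : QVar m n → K) (k : Move m n) :
    (fun w => f (k.act t v w)) = k.act (f t) fun w => f (v w) := by
  funext w
  rcases k with i | ⟨hm, hn⟩ | i | i | i <;> rcases w with j | j | j <;>
    simp only [act] <;> (repeat' split) <;> simp

theorem act_act_comm (hkl : k.hi < l.lo ∨ l.hi < k.lo) (a b : K) (v : QVar m n → K) :
    k.act a (l.act b v) = l.act b (k.act a v) := by
  funext w
  have hdisj : (w.pos < k.lo ∨ k.hi < w.pos) ∨ (w.pos < l.lo ∨ l.hi < w.pos) := by omega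
  rcases hdisj with hw | hw
  · rw [act_of_outside a hw, act_congr b l (act_of_outside a hw)]
  · rw [act_of_outside b hw, act_congr a k (act_of_outside b hw)]

end act

end Move

namespace QuadEq

variable {G : Type u} [Group G] {m n : ℕ} (E : QuadEq G m n)

theorem atom_of_lt {i : ℕ} (hi : i < m) (hi' : i < m + n) :
    E.atom ⟨i, hi'⟩ =
      (GX.var (.z ⟨i, hi⟩))⁻¹ * GX.const (E.c ⟨i, hi⟩) * GX.var (.z ⟨i, hi⟩) :=
  Fin.append_left _ _ (⟨i, hi⟩ : Fin m)

theorem atom_add {i : ℕ} (hi : i < n) (hi' : m + i < m + n) :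
    E.atom ⟨m + i, hi'⟩ = (GX.var (.x ⟨i, hi⟩))⁻¹ * (GX.var (.y ⟨i, hi⟩))⁻¹ *
      GX.var (.x ⟨i, hi⟩) * GX.var (.y ⟨i, hi⟩) :=
  Fin.append_right _ _ (⟨i, hi⟩ : Fin n)

theorem atom_mem_generated (i : Fin (m + n)) : E.atom i ∈ GX.generated G {w | w.pos = i} := by
  obtain ⟨i, hi⟩ := i
  have hvar : ∀ w : QVar m n, w.pos = i → GX.var w ∈ GX.generated G {w | w.pos = i} :=
    fun w hw => GX.var_mem_generated hw
  rcases lt_or_ge i m with h | h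
  · rw [E.atom_of_lt h hi]
    have hz := hvar (.z ⟨i, h⟩) rfl
    exact mul_mem (mul_mem (inv_mem hz) (GX.const_mem_generated _ _)) hz
  · obtain ⟨j, rfl⟩ := Nat.exists_eq_add_of_le h
    have hj : j < n := by omega
    rw [E.atom_add hj hi]
    have hx := hvar (.x ⟨j, hj⟩) rfl
    have hy := hvar (.y ⟨j, hj⟩) rfl
    exact mul_mem (mul_mem (mul_mem (inv_mem hx) (inv_mem hy)) hx) hy

end QuadEq

namespace Move

variable {G : Type u} [Group G] {m n : ℕ}

theorem period_mem_generated (E : QuadEq G m n) (k : Move m n) :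
    k.period E ∈ GX.generated G {w | k.lo ≤ w.pos ∧ w.pos ≤ k.hi} := by
  have hatom : ∀ i : Fin (m + n), k.lo ≤ i → (i : ℕ) ≤ k.hi →
      E.atom i ∈ GX.generated G {w | k.lo ≤ w.pos ∧ w.pos ≤ k.hi} := fun i hlo hhi =>
    GX.generated_mono (fun w (hw : w.pos = i) => by
      rw [← hw] at hlo hhi; exact ⟨hlo, hhi⟩) (E.atom_mem_generated i)
  have hvar : ∀ w : QVar m n, k.lo ≤ w.pos → w.pos ≤ k.hi →
      (GX.var w : GX G m n) ∈ GX.generated G {w | k.lo ≤ w.pos ∧ w.pos ≤ k.hi} :=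
    fun w hlo hhi => GX.var_mem_generated ⟨hlo, hhi⟩
  cases k with
  | zz i => exact mul_mem (hatom _ le_rfl (Nat.le_succ _)) (hatom _ (Nat.le_succ _) le_rfl)
  | zx hm hn =>
    exact mul_mem (hatom _ le_rfl (Nat.sub_le _ _))
      (inv_mem (hvar _ (by simp [lo, QVar.pos]) (by simp [hi, QVar.pos])))
  | twistY i => exact hvar _ le_rfl le_rfl
  | twistX i => exact hvar _ le_rfl le_rfl
  | xx i =>
    exact mul_mem (hvar _ le_rfl (Nat.le_succ _))
      (inv_mem (hvar _ (by simp [lo, QVar.pos]) le_rfl))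

end Move

theorem prod_ofFn_congr_of_adjacent {M : Type*} [Monoid M] {N : ℕ} {f g : Fin N → M} {i : ℕ}
    (hi : i + 1 < N) (hfg : ∀ j : Fin N, (j : ℕ) ≠ i → (j : ℕ) ≠ i + 1 → f j = g j)
    (h : f ⟨i, Nat.lt_of_succ_lt hi⟩ * f ⟨i + 1, hi⟩ =
      g ⟨i, Nat.lt_of_succ_lt hi⟩ * g ⟨i + 1, hi⟩) :
    (List.ofFn f).prod = (List.ofFn g).prod := by
  induction N generalizing i with
  | zero => exact absurd hi (Nat.not_lt_zero _)
  | succ N ih =>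
    cases i with
    | zero =>
      obtain ⟨N, rfl⟩ : ∃ N', N = N' + 1 := Nat.exists_eq_succ_of_ne_zero (by omega)
      have htail : (fun j : Fin N => f j.succ.succ) = fun j => g j.succ.succ :=
        funext fun j => hfg _ (by simp) (by simp)
      rw [List.ofFn_succ, List.ofFn_succ, List.ofFn_succ, List.ofFn_succ, htail]
      simp only [List.prod_cons, ← mul_assoc]
      exact congrArg (· * _) h
    | succ i =>
      rw [List.ofFn_succ, List.ofFn_succ, List.prod_cons, List.prod_cons,
        hfg 0 (by simp) (by simp)]
      congr 1
      exact ih (f := fun j => f j.succ) (g := fun j => g j.succ) (i := i) (by omega)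
        (fun j hj hj' => hfg _ (by simpa using hj) (by simpa using hj')) h

namespace GX

variable {G : Type u} [Group G] {m n : ℕ} (E : QuadEq G m n)

section Word

variable {K : Type u} [Group K] (ι : G →* K) (v : QVar m n → K)

theorem eval_word :
    eval ι v E.word = (List.ofFn fun i => eval ι v (E.atom i)).prod * ι E.d⁻¹ := by
  rw [QuadEq.word, map_mul, eval_const, map_list_prod, List.map_ofFn]
  rfl

theorem eval_atom_of_lt {i : ℕ} (hi : i < m) (hi' : i < m + n) :
    eval ι v (E.atom ⟨i, hi'⟩) = (v (.z ⟨i, hi⟩))⁻¹ * ι (E.c ⟨i, hi⟩) * v (.z ⟨i, hi⟩) := by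
  simp [E.atom_of_lt hi hi']

theorem eval_atom_add {i : ℕ} (hi : i < n) (hi' : m + i < m + n) :
    eval ι v (E.atom ⟨m + i, hi'⟩) =
      (v (.x ⟨i, hi⟩))⁻¹ * (v (.y ⟨i, hi⟩))⁻¹ * v (.x ⟨i, hi⟩) * v (.y ⟨i, hi⟩) := by
  simp [E.atom_add hi hi']

variable {ι v} {t : K}

theorem eval_act_of_mem {k : Move m n} {Y : Set (QVar m n)} {γ : GX G m n}
    (hY : ∀ w ∈ Y, w.pos < k.lo ∨ k.hi < w.pos) (hγ : γ ∈ generated G Y) :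
    eval ι (k.act t v) γ = eval ι v γ :=
  eq_of_mem_generated (by simp)
    (fun w hw => by simpa using Move.act_of_outside t (hY w hw)) hγ

theorem eval_act_atom_of_outside {k : Move m n} {j : Fin (m + n)}
    (hj : (j : ℕ) < k.lo ∨ k.hi < (j : ℕ)) :
    eval ι (k.act t v) (E.atom j) = eval ι v (E.atom j) :=
  eval_act_of_mem (fun w (hw : w.pos = j) => by rwa [hw]) (E.atom_mem_generated j)

variable {E}

theorem eval_act_twistY_atom {i : Fin n} (ht : Commute t (v (.x i))) :
    eval ι ((Move.twistY i).act t v) (E.atom ⟨m + i, by omega⟩) =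
      eval ι v (E.atom ⟨m + i, by omega⟩) := by
  rw [eval_atom_add E _ _ i.2, eval_atom_add E _ _ i.2]
  simpa [Move.act, mul_assoc] using congrArg (· * v (.y i)) ht.inv_mul_cancel

theorem eval_act_twistX_atom {i : Fin n} (ht : Commute t (v (.y i))) :
    eval ι ((Move.twistX i).act t v) (E.atom ⟨m + i, by omega⟩) =
      eval ι v (E.atom ⟨m + i, by omega⟩) := by
  rw [eval_atom_add E _ _ i.2, eval_atom_add E _ _ i.2]
  simpa [Move.act, mul_assoc] using
    congrArg (· * (v (.x i) * v (.y i))) ht.inv_right.inv_mul_cancel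

theorem eval_act_zz_atoms {i : Fin (m - 1)}
    (ht : Commute t (eval ι v ((Move.zz i : Move m n).period E))) :
    eval ι ((Move.zz i).act t v) (E.atom ⟨i, by omega⟩) *
        eval ι ((Move.zz i).act t v) (E.atom ⟨i + 1, by omega⟩) =
      eval ι v (E.atom ⟨i, by omega⟩) * eval ι v (E.atom ⟨i + 1, by omega⟩) := by
  have hperiod := ht.inv_mul_cancel
  rw [Move.period, map_mul] at hperiod
  rw [← hperiod]
  simp [eval_atom_of_lt E _ _ (i := i) (by omega), eval_atom_of_lt E _ _ (i := i + 1) (by omega),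
    Move.act, mul_assoc]

theorem eval_act_zx_atoms {hm : 0 < m} {hn : 0 < n}
    (ht : Commute t (eval ι v ((Move.zx hm hn).period E))) :
    eval ι ((Move.zx hm hn).act t v) (E.atom ⟨m - 1, by omega⟩) *
        eval ι ((Move.zx hm hn).act t v) (E.atom ⟨m, by omega⟩) =
      eval ι v (E.atom ⟨m - 1, by omega⟩) * eval ι v (E.atom ⟨m, by omega⟩) := by
  have hperiod := ht.inv_mul_cancel
  rw [Move.period, map_mul, map_inv, eval_var, eval_atom_of_lt E _ _ (by omega)] at hperiod
  have hhandle (v' : QVar m n → K) := eval_atom_add E ι v' hn (by omega)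
  simp only [add_zero] at hhandle
  simpa [eval_atom_of_lt E _ _ (Nat.sub_lt hm one_pos), hhandle, Move.act, mul_assoc] using congrArg
      (· * ((v (.y ⟨0, hn⟩))⁻¹ * v (.x ⟨0, hn⟩) * v (.y ⟨0, hn⟩))) hperiod

theorem eval_act_xx_atoms {i : Fin (n - 1)}
    (ht : Commute t (eval ι v ((Move.xx i : Move m n).period E))) :
    eval ι ((Move.xx i).act t v) (E.atom ⟨m + i, by omega⟩) *
        eval ι ((Move.xx i).act t v) (E.atom ⟨m + (i + 1), by omega⟩) =
      eval ι v (E.atom ⟨m + i, by omega⟩) * eval ι v (E.atom ⟨m + (i + 1), by omega⟩) := by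
  have hi : i.1 + 1 < n := by omega
  have hperiod := ht.inv_mul_cancel
  rw [Move.period, map_mul, map_inv, eval_var, eval_var] at hperiod
  simpa [eval_atom_add E _ _ hi, eval_atom_add E _ _ (Nat.lt_of_succ_lt hi), Move.act,
    mul_assoc] using congrArg (fun p => (v (.x ⟨i, by omega⟩))⁻¹ * (v (.y ⟨i, by omega⟩))⁻¹ *
      v (.x ⟨i, by omega⟩) * p * ((v (.y ⟨i + 1, hi⟩))⁻¹ * v (.x ⟨i + 1, hi⟩) *
        v (.y ⟨i + 1, hi⟩))) hperiod

theorem eval_act_word {k : Move m n} (ht : Commute t (eval ι v (k.period E))) :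
    eval ι (k.act t v) E.word = eval ι v E.word := by
  rw [eval_word, eval_word]
  congr 1
  have houtside (j : Fin (m + n)) (hj : (j : ℕ) < k.lo ∨ k.hi < (j : ℕ)) :
      eval ι (k.act t v) (E.atom j) = eval ι v (E.atom j) := eval_act_atom_of_outside E hj
  cases k with
  | zz i =>
    exact prod_ofFn_congr_of_adjacent (by omega)
      (fun j _ _ => houtside j (by simp only [Move.lo, Move.hi]; omega)) (eval_act_zz_atoms ht)
  | zx hm hn =>
    have hnext : ∀ h, (⟨m - 1 + 1, h⟩ : Fin (m + n)) = ⟨m, by omega⟩ := fun h =>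
      Fin.ext (Nat.sub_add_cancel hm)
    refine prod_ofFn_congr_of_adjacent (i := m - 1) (by omega)
      (fun j _ _ => houtside j (by simp only [Move.lo, Move.hi]; omega)) ?_
    rw [hnext]
    exact eval_act_zx_atoms ht
  | xx i =>
    exact prod_ofFn_congr_of_adjacent (by omega)
      (fun j _ _ => houtside j (by simp only [Move.lo, Move.hi]; omega)) (eval_act_xx_atoms ht)
  | twistY i =>
    refine congrArg (fun f => (List.ofFn f).prod) (funext fun j => ?_)
    by_cases hj : j = ⟨m + i, by omega⟩
    · exact hj ▸ eval_act_twistY_atom (by rwa [Move.period, eval_var] at ht)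
    · exact houtside j (by simp only [Move.lo, Move.hi, Fin.ext_iff] at hj ⊢; omega)
  | twistX i =>
    refine congrArg (fun f => (List.ofFn f).prod) (funext fun j => ?_)
    by_cases hj : j = ⟨m + i, by omega⟩
    · exact hj ▸ eval_act_twistX_atom (by rwa [Move.period, eval_var] at ht)
    · exact houtside j (by simp only [Move.lo, Move.hi, Fin.ext_iff] at hj ⊢; omega)

end Word

section Step

open HNNExtension

variable {H K : Type u} [Group H] [Group K] (ι : G →* H) (v : QVar m n → H)

/-- The values of the variables after a step that extends the centralizer of `u`. -/
def stepVal (k : Move m n) (u : H) : QVar m n → CentralizerExtension H u :=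
  k.act t fun w => of (v w)

/-- The canonical homomorphism after a step that extends the centralizer of `u`. -/
def stepIncl (u : H) : G →* CentralizerExtension H u := of.comp ι

@[simp]
theorem stepIncl_apply (u : H) (g : G) : stepIncl ι u g = of (ι g) := rfl

variable {ι v} {E} {k l : Move m n} {u : H}

theorem stepVal_of_outside {w : QVar m n} (hw : w.pos < k.lo ∨ k.hi < w.pos) :
    stepVal v k u w = of (v w) :=
  Move.act_of_outside t hw

theorem eval_stepIncl_of (γ : GX G m n) :
    eval (stepIncl ι u) (fun w => of (v w)) γ = of (eval ι v γ) :=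
  (map_eval of (fun _ => rfl) (fun _ => rfl) γ).symm

theorem eval_step_of_mem {Y : Set (QVar m n)} {γ : GX G m n}
    (hY : ∀ w ∈ Y, w.pos < k.lo ∨ k.hi < w.pos) (hγ : γ ∈ generated G Y) :
    eval (stepIncl ι u) (stepVal v k u) γ = of (eval ι v γ) :=
  (eval_act_of_mem hY hγ).trans (eval_stepIncl_of γ)

theorem eval_step_atom_of_outside {j : Fin (m + n)} (hj : (j : ℕ) < k.lo ∨ k.hi < (j : ℕ)) :
    eval (stepIncl ι u) (stepVal v k u) (E.atom j) = of (eval ι v (E.atom j)) :=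
  (eval_act_atom_of_outside E hj).trans (eval_stepIncl_of _)

theorem eval_step_word :
    eval (stepIncl ι (eval ι v (k.period E))) (stepVal v k (eval ι v (k.period E))) E.word =
      of (eval ι v E.word) := by
  refine (eval_act_word ?_).trans (eval_stepIncl_of _)
  rw [eval_stepIncl_of]
  exact CentralizerExtension.commute_t_of (Commute.refl _)

/-- The pair `(ι, v)` of a homomorphism from `G` and values of the variables maps to `(ι', v')`. -/
def Dominates (ι : G →* H) (v : QVar m n → H) (ι' : G →* K) (v' : QVar m n → K) : Prop :=
  ∃ f : H →* K, (∀ g, f (ι g) = ι' g) ∧ ∀ w, f (v w) = v' w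

theorem Dominates.step {ι' : G →* K} {v' : QVar m n → K} (h : Dominates ι v ι' v') (k : Move m n)
    (γ : GX G m n) : Dominates (stepIncl ι (eval ι v γ)) (stepVal v k (eval ι v γ))
      (stepIncl ι' (eval ι' v' γ)) (stepVal v' k (eval ι' v' γ)) := by
  obtain ⟨f, hι, hv⟩ := h
  refine ⟨CentralizerExtension.lift (of.comp f) t fun h hh =>
    CentralizerExtension.commute_t_of (map_eval f hι hv γ ▸ hh.map f), fun g => ?_,
    congrFun ?_⟩
  · simp [hι]
  · unfold stepVal
    rw [Move.map_act]
    simp [hv]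

theorem step_dominates (k : Move m n) (u : H) : Dominates (stepIncl ι u) (stepVal v k u) ι v := by
  refine ⟨CentralizerExtension.lift (MonoidHom.id _) 1 fun h _ => Commute.one_left _,
    fun g => by simp, congrFun ?_⟩
  unfold stepVal
  rw [Move.map_act]
  simp [Move.act_one]

theorem step_step_dominates (hkl : k.hi < l.lo ∨ l.hi < k.lo) (u u' : H) :
    Dominates (stepIncl (stepIncl ι u) (of u' : CentralizerExtension H u))
      (stepVal (stepVal v k u) l (of u' : CentralizerExtension H u))
      (stepIncl (stepIncl ι u') (of u : CentralizerExtension H u'))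
      (stepVal (stepVal v l u') k (of u : CentralizerExtension H u')) := by
  let f : CentralizerExtension H u →* CentralizerExtension (CentralizerExtension H u') (of u) :=
    CentralizerExtension.lift (of.comp of) t fun h hh =>
      CentralizerExtension.commute_t_of (hh.map of)
  have hf_of (h : H) : f (of h) = of (of h) := CentralizerExtension.lift_of _ _ _ _
  have hf_t : f t = t := CentralizerExtension.lift_t _ _ _
  have hf_commute : Subgroup.closure (of '' {h | Commute h u'} ∪
      (fun h => of h * t * (of h)⁻¹) '' {h | Commute u' (h * u * h⁻¹)}) ≤
        (Subgroup.centralizer {of t}).comap f := by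
    rw [Subgroup.closure_le]
    rintro _ (⟨h, hh, rfl⟩ | ⟨h, hh, rfl⟩) <;>
      rw [SetLike.mem_coe, Subgroup.mem_comap, Subgroup.mem_centralizer_singleton_iff]
    · rw [hf_of]
      exact ((CentralizerExtension.commute_t_of hh).map of).symm
    · rw [map_mul, map_mul, map_inv, hf_of, hf_t]
      refine CentralizerExtension.commute_conj_t_of ?_
      rw [← map_mul, ← map_inv, ← map_mul]
      exact CentralizerExtension.commute_t_of hh.symm
  refine ⟨CentralizerExtension.lift f (of t) fun g hg => Commute.symm <|
    Subgroup.mem_centralizer_singleton_iff.1 <|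
      hf_commute (CentralizerExtension.mem_closure_of_commute_of hg), fun g => ?_, congrFun ?_⟩
  · simp [hf_of]
  · simp only [stepVal]
    rw [Move.map_act, CentralizerExtension.lift_t]
    simp only [CentralizerExtension.lift_of]
    rw [Move.map_act, Move.map_act, hf_t, Move.act_act_comm hkl]
    simp only [hf_of]

end Step

end GX

namespace Stage

open HNNExtension

variable {G : Type u} [Group G] {m n : ℕ} (E : QuadEq G m n)

theorem hom_eq_eval (s : Stage G m n) : s.hom = GX.eval s.incl s.val := rfl

theorem step_hom_word (s : Stage G m n) (k : Move m n) :
    (s.step E k).hom E.word =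
      (of (s.hom E.word) : CentralizerExtension s.carrier (s.hom (k.period E))) :=
  GX.eval_step_word

theorem foldl_step_hom_word {s : Stage G m n} (hs : s.hom E.word = 1) (L : List (Move m n)) :
    (L.foldl (step E) s).hom E.word = 1 :=
  List.foldlRecOn (motive := fun s => s.hom E.word = 1) L (step E) hs fun s hs k _ => by
    rw [step_hom_word, hs]
    exact map_one _

/-- There is a homomorphism of the groups of two stages that is compatible with the canonical
homomorphisms and the values of the variables. -/
def MapsTo (s s' : Stage G m n) : Prop :=
  GX.Dominates s.incl s.val s'.incl s'.val

theorem MapsTo.refl (s : Stage G m n) : s.MapsTo s :=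
  ⟨MonoidHom.id _, fun _ => rfl, fun _ => rfl⟩

theorem MapsTo.trans {s s' s'' : Stage G m n} (h : s.MapsTo s') (h' : s'.MapsTo s'') :
    s.MapsTo s'' := by
  obtain ⟨f, hι, hv⟩ := h
  obtain ⟨f', hι', hv'⟩ := h'
  exact ⟨f'.comp f, fun g => by simp [hι, hι'], fun w => by simp [hv, hv']⟩

theorem MapsTo.ker_le {s s' : Stage G m n} (h : s.MapsTo s') : s.hom.ker ≤ s'.hom.ker := by
  obtain ⟨f, hι, hv⟩ := h
  intro γ hγ
  rw [MonoidHom.mem_ker, hom_eq_eval] at hγ ⊢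
  rw [← GX.map_eval f hι hv, hγ, map_one]

theorem MapsTo.step {s s' : Stage G m n} (h : s.MapsTo s') (k : Move m n) :
    (s.step E k).MapsTo (s'.step E k) :=
  GX.Dominates.step h k (k.period E)

theorem step_mapsTo (s : Stage G m n) (k : Move m n) : (s.step E k).MapsTo s :=
  GX.step_dominates k _

theorem step_hom_period (s : Stage G m n) {k l : Move m n} (hkl : k.hi < l.lo ∨ l.hi < k.lo) :
    (s.step E k).hom (l.period E) =
      (of (s.hom (l.period E)) : CentralizerExtension s.carrier (s.hom (k.period E))) :=
  GX.eval_step_of_mem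
    (fun w (hw : l.lo ≤ w.pos ∧ w.pos ≤ l.hi) => by omega) (l.period_mem_generated E)

theorem step_step_mapsTo (s : Stage G m n) {k l : Move m n} (hkl : k.hi < l.lo ∨ l.hi < k.lo) :
    ((s.step E k).step E l).MapsTo ((s.step E l).step E k) := by
  have h := GX.step_step_dominates (ι := s.incl) (v := s.val) hkl (s.hom (k.period E))
    (s.hom (l.period E))
  rw [← s.step_hom_period E hkl, ← s.step_hom_period E hkl.symm] at h
  exact h

theorem MapsTo.foldl : ∀ {s s' : Stage G m n}, s.MapsTo s' → ∀ L : List (Move m n),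
    (L.foldl (Stage.step E) s).MapsTo (L.foldl (Stage.step E) s')
  | _, _, h, [] => h
  | _, _, h, k :: L => (h.step E k).foldl L

/-- The result of the first list of steps maps to the result of the second one, whatever the
stage from which both lists start. -/
def Refines (L L' : List (Move m n)) : Prop :=
  ∀ s : Stage G m n, (L.foldl (step E) s).MapsTo (L'.foldl (step E) s)

variable {E}

theorem Refines.refl (L : List (Move m n)) : Refines E L L := fun _ => MapsTo.refl _

theorem Refines.trans {L L' L'' : List (Move m n)} (h : Refines E L L') (h' : Refines E L' L'') :
    Refines E L L'' := fun s => (h s).trans (h' s)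

theorem Refines.append_left (L₀ : List (Move m n)) {L L' : List (Move m n)} (h : Refines E L L') :
    Refines E (L₀ ++ L) (L₀ ++ L') := fun s => by
  rw [List.foldl_append, List.foldl_append]
  exact h _

theorem Refines.append_right {L L' : List (Move m n)} (h : Refines E L L')
    (L₀ : List (Move m n)) : Refines E (L ++ L₀) (L' ++ L₀) := fun s => by
  rw [List.foldl_append, List.foldl_append]
  exact (h s).foldl E L₀

theorem refines_of_sublist {L L' : List (Move m n)} (h : L'.Sublist L) : Refines E L L' := by
  induction h with
  | slnil => exact Refines.refl _
  | cons k _ ih => exact fun s => ((step_mapsTo E s k).foldl E _).trans (ih s)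
  | cons_cons k _ ih => exact fun s => ih _

theorem refines_cons_append {k : Move m n} {L : List (Move m n)}
    (h : ∀ l ∈ L, k.hi < l.lo ∨ l.hi < k.lo) : Refines E (k :: L) (L ++ [k]) := by
  induction L with
  | nil => exact Refines.refl _
  | cons l L ih =>
    have hswap : Refines E (k :: l :: L) (l :: k :: L) := fun s =>
      (step_step_mapsTo E s (h l List.mem_cons_self)).foldl E L
    exact hswap.trans ((ih fun l' hl' => h l' (List.mem_cons_of_mem _ hl')).append_left [l])

theorem refines_append_comm {L L' : List (Move m n)}
    (h : ∀ k ∈ L, ∀ l ∈ L', k.hi < l.lo ∨ l.hi < k.lo) : Refines E (L ++ L') (L' ++ L) := by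
  induction L with
  | nil => simpa using Refines.refl _
  | cons k L ih =>
    have htail := (ih fun k' hk' => h k' (List.mem_cons_of_mem _ hk')).append_left [k]
    have hhead := (refines_cons_append (E := E) (h k List.mem_cons_self)).append_right L
    simpa using htail.trans hhead

theorem refines_interleave {a b : ℕ → List (Move m n)}
    (h : ∀ i j, i + 2 ≤ j → ∀ k ∈ a j, ∀ l ∈ b i, k.hi < l.lo ∨ l.hi < k.lo) (N : ℕ) :
    Refines E ((List.range (N + 1)).flatMap a ++ (List.range N).flatMap b)
      (a 0 ++ (List.range N).flatMap fun i => a (i + 1) ++ b i) := by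
  induction N with
  | zero => simpa using Refines.refl _
  | succ N ih =>
    have hcomm : Refines E (a (N + 1) ++ (List.range N).flatMap b)
        ((List.range N).flatMap b ++ a (N + 1)) := refines_append_comm fun k hk l hl => by
      obtain ⟨i, hi, hl⟩ := List.mem_flatMap.1 hl
      have := List.mem_range.1 hi
      exact h i (N + 1) (by omega) k hk l hl
    have hmove := (hcomm.append_left ((List.range (N + 1)).flatMap a)).append_right (b N)
    have hrest := ih.append_right (a (N + 1) ++ b N)
    simp only [List.range_succ (n := N + 1), List.range_succ (n := N), List.flatMap_append,
      List.flatMap_singleton, List.append_assoc] at hmove hrest ⊢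
    exact hmove.trans hrest

end Stage

theorem ne_one_of_not_commute {K : Type*} [Group K] {a b : K} (h : ¬ Commute a b) : b ≠ 1 := by
  rintro rfl
  exact h (Commute.one_right a)

theorem commute_mul_right_self_iff {K : Type*} [Group K] {a b : K} :
    Commute b (a * b) ↔ Commute b a :=
  ⟨fun h => by simpa using h.mul_right (Commute.refl b).inv_right,
    fun h => h.mul_right (Commute.refl b)⟩

theorem commute_mul_left_self_iff {K : Type*} [Group K] {a b : K} :
    Commute a (a * b) ↔ Commute a b :=
  ⟨fun h => by simpa using (Commute.refl a).inv_right.mul_right h,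
    fun h => (Commute.refl a).mul_right h⟩

/-- `H` is fully residually free, and its non-trivial elements survive in retractions onto `G`.
These are the properties of the groups of the chain that the steps preserve. -/
structure IsSeparated {G H : Type u} [Group G] [Group H] (ι : G →* H) : Prop where
  isFullyResiduallyFree : IsFullyResiduallyFree H
  exists_retraction : ∀ h : H, h ≠ 1 → ∃ r : H →* G, (∀ g, r (ι g) = g) ∧ r h ≠ 1

/-- The homomorphism is injective on the subgroup. -/
def IsFaithfulOn {Γ K : Type*} [Group Γ] [Group K] (f : Γ →* K) (B : Subgroup Γ) : Prop :=
  ∀ b ∈ B, f b = 1 → b = 1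

section IsFaithfulOn

open scoped commutatorElement

variable {Γ K : Type*} [Group Γ] [Group K] {f : Γ →* K} {B B' : Subgroup Γ}

theorem IsFaithfulOn.mono (h : IsFaithfulOn f B) (hB : B' ≤ B) : IsFaithfulOn f B' :=
  fun b hb => h b (hB hb)

theorem IsFaithfulOn.commute (h : IsFaithfulOn f B) {a b : Γ} (ha : a ∈ B) (hb : b ∈ B)
    (hab : Commute (f a) (f b)) : Commute a b := by
  rw [← commutatorElement_eq_one_iff_commute] at hab ⊢
  refine h _ ?_ ((map_commutatorElement f a b).trans hab)
  exact mul_mem (mul_mem (mul_mem ha hb) (inv_mem ha)) (inv_mem hb)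

end IsFaithfulOn

namespace CentralizerExtension

open HNNExtension

theorem not_commute_conj_t {H : Type u} [Group H] (hH : IsFullyResiduallyFree H) {u b g : H}
    (hb : ¬ Commute b u) (hg : g ≠ 1) :
    ¬ Commute (t⁻¹ * of b * t) (of g : CentralizerExtension H u) := fun hc =>
  not_commute_of_mul_conj (a := 1) hH 1 hb hg (by simpa using hc.symm)

/-- If the extended centralizer contains no non-trivial element of the image of `f`, then the
new letter is free over this image. -/
theorem isFaithfulOn_closure_union_singleton {Γ H K : Type*} [Group Γ] [Group H] [Group K] {u : K}
    {f : H →* K} (hfree : ∀ h, h ≠ 1 → ¬ Commute (f h) u)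
    {e : Γ →* CentralizerExtension K u} {φ : Γ →* H} {B : Subgroup Γ} (hφ : IsFaithfulOn φ B)
    (hB : ∀ b ∈ B, e b = of (f (φ b))) {s : Γ} {p q : H} (hs : e s = of (f p) * t * of (f q)) :
    IsFaithfulOn e (Subgroup.closure (B ∪ {s})) := by
  have hcentralizer : ∀ h, Commute (f h) u → h = 1 := fun h hcomm => by
    by_contra hh
    exact hfree h hh hcomm
  intro γ hγ
  refine eq_one_of_mem_closure_union_singleton (φ := f.comp φ) hB hs (fun b hb hb1 => ?_)
    (fun b _ hcomm => ?_) (fun b _ hcomm => ?_) hγ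
  · refine hφ b hb (hcentralizer _ ?_)
    rw [show f (φ b) = 1 from hb1]
    exact Commute.one_left u
  · rw [MonoidHom.comp_apply, ← map_inv, ← map_mul, ← map_mul] at hcomm
    rw [MonoidHom.comp_apply, conj_eq_one_iff.1 (hcentralizer _ hcomm), map_one]
  · rw [MonoidHom.comp_apply, ← map_inv, ← map_mul, ← map_mul] at hcomm
    have hb : φ b = 1 := by simpa [mul_assoc, inv_mul_eq_one] using hcentralizer _ hcomm
    rw [MonoidHom.comp_apply, hb, map_one]

end CentralizerExtension

namespace GX

open HNNExtension CentralizerExtension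

variable {G : Type u} [Group G] {m n : ℕ} {H : Type u} [Group H] {ι : G →* H}
  {v : QVar m n → H}

theorem _root_.IsSeparated.step (h : IsSeparated ι) {u : H} (hu : u ≠ 1) :
    IsSeparated (stepIncl ι u) where
  isFullyResiduallyFree := CentralizerExtension.isFullyResiduallyFree h.1 hu
  exists_retraction := fun x hx => by
    obtain ⟨N, hN⟩ := exists_retraction_ne_one h.1 hu hx
    obtain ⟨r, hrι, hr⟩ := h.2 _ hN
    exact ⟨r.comp (retraction u N), fun g => by simp [hrι], hr⟩

variable (E : QuadEq G m n)

/-- The invariants of a point of the construction at which the values of the variables of the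
first `j` atoms are independent over `G`, in the form in which the next atoms preserve them. -/
structure IsReady (ι : G →* H) (v : QVar m n → H) (j : ℕ) : Prop where
  separated : IsSeparated ι
  faithful : IsFaithfulOn (eval ι v) (generated G {w | w.pos < j})
  handle : ∀ i : Fin n, j ≤ m + i → ¬ Commute (v (.x i)) (v (.y i))
  zz : ∀ h : j + 2 < m, ¬ Commute (eval ι v (E.atom ⟨j + 1, by omega⟩))
    (eval ι v (E.atom ⟨j + 2, by omega⟩))
  zx : ∀ (h : j + 2 = m) (hn : 0 < n), ¬ Commute (eval ι v (E.atom ⟨j + 1, by omega⟩))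
    (v (.x ⟨0, hn⟩))
  zzz : ∀ (_ : n = 0) (h : j + 3 = m), ¬ Commute (eval ι v (E.atom ⟨j, by omega⟩))
    (eval ι v (E.atom ⟨j + 1, by omega⟩) * eval ι v (E.atom ⟨j + 2, by omega⟩))

variable {E}

theorem IsReady.injective {j : ℕ} (h : IsReady E ι v j) : Function.Injective ι := by
  refine (injective_iff_map_eq_one ι).2 fun g hg => ?_
  have hconst : (const g : GX G m n) = 1 :=
    h.faithful (const g) (const_mem_generated g _) (by simpa using hg)
  exact const_eq_one_iff.1 hconst

theorem generated_pos_lt_succ_le {j : ℕ} (hj : j < m) :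
    generated G {w : QVar m n | w.pos < j + 1} ≤
      Subgroup.closure (generated G {w : QVar m n | w.pos < j} ∪ {var (.z ⟨j, hj⟩)}) := by
  refine generated_le (fun g => Subgroup.subset_closure (Or.inl (const_mem_generated g _)))
    fun w (hw : w.pos < j + 1) => ?_
  by_cases hwj : w.pos < j
  · exact Subgroup.subset_closure (Or.inl (var_mem_generated hwj))
  · rcases w with i | i | i <;> simp only [QVar.pos] at hwj hw
    · omega
    · omega
    · obtain rfl : i = ⟨j, hj⟩ := Fin.ext (by simp only; omega)
      exact Subgroup.subset_closure (Or.inr rfl)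

theorem isFaithfulOn_generated_pos_lt_zero (hι : Function.Injective ι) :
    IsFaithfulOn (eval ι v) (generated G {w : QVar m n | w.pos < 0}) := by
  intro γ hγ hγ1
  have hconst :
      generated G {w : QVar m n | w.pos < 0} ≤ (Monoid.Coprod.inl : G →* GX G m n).range :=
    generated_le (fun g => ⟨g, rfl⟩) fun w hw => absurd hw (Nat.not_lt_zero _)
  obtain ⟨g, rfl⟩ := hconst hγ
  have hg : ι g = 1 := (eval_const ι v g).symm.trans hγ1
  rw [hι (hg.trans (map_one ι).symm), map_one]

theorem stepVal_zz_left {i : ℕ} (hi : i < m - 1) (u : H) (hi' : i < m) :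
    stepVal v (.zz ⟨i, hi⟩) u (.z ⟨i, hi'⟩) = of (v (.z ⟨i, hi'⟩)) * t := by
  simp [stepVal, Move.act]

theorem stepVal_zz_right {i : ℕ} (hi : i < m - 1) (u : H) (hi' : i + 1 < m) :
    stepVal v (.zz ⟨i, hi⟩) u (.z ⟨i + 1, hi'⟩) = of (v (.z ⟨i + 1, hi'⟩)) * t := by
  simp [stepVal, Move.act]

theorem stepVal_zx_z (hm : 0 < m) (hn : 0 < n) (u : H) {i : ℕ} (hi : i < m) (hi' : i + 1 = m) :
    stepVal v (.zx hm hn) u (.z ⟨i, hi⟩) = of (v (.z ⟨i, hi⟩)) * t := by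
  have : i = m - 1 := by omega
  simp [stepVal, Move.act, this]

theorem eval_atom_ne_one (hι : Function.Injective ι) (hc : ∀ i, E.c i ≠ 1) {i : ℕ} (hi : i < m)
    (hi' : i < m + n) : eval ι v (E.atom ⟨i, hi'⟩) ≠ 1 := by
  rw [eval_atom_of_lt E _ _ hi]
  intro h
  rw [mul_assoc, inv_mul_eq_one, right_eq_mul] at h
  exact hc _ (hι (h.trans (map_one ι).symm))

section Step

variable {k : Move m n} {u : H} {i : ℕ}

theorem eval_step_atom_of_val_eq (hi : i < m) (hi' : i < m + n)
    (hz : stepVal v k u (.z ⟨i, hi⟩) = of (v (.z ⟨i, hi⟩)) * t) :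
    eval (stepIncl ι u) (stepVal v k u) (E.atom ⟨i, hi'⟩) =
      t⁻¹ * of (eval ι v (E.atom ⟨i, hi'⟩)) * t := by
  rw [eval_atom_of_lt E _ _ hi, eval_atom_of_lt E _ _ hi, hz]
  simp [stepIncl, mul_assoc]

theorem not_commute_stepVal_handle (hk : k.hi < m) {l : Fin n}
    (hl : ¬ Commute (v (.x l)) (v (.y l))) :
    ¬ Commute (stepVal v k u (.x l)) (stepVal v k u (.y l)) := by
  rw [stepVal_of_outside, stepVal_of_outside, commute_of_of_iff]
  · exact hl
  all_goals exact Or.inr (hk.trans_le (Nat.le_add_right m l))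

theorem not_commute_stepVal_zx_handle (hm : 0 < m) (hn : 0 < n) {l : Fin n}
    (hl : ¬ Commute (v (.x l)) (v (.y l))) :
    ¬ Commute (stepVal v (.zx hm hn) u (.x l)) (stepVal v (.zx hm hn) u (.y l)) := by
  by_cases hl0 : l.1 = 0
  · intro hcomm
    refine hl (commute_of_commute_conj_inv_mul (w := u) ?_)
    simpa [stepVal, Move.act, hl0] using hcomm
  · simpa [stepVal, Move.act, hl0, commute_of_of_iff] using hl

theorem not_commute_step_atom_atom_succ (hH : IsFullyResiduallyFree H)
    (hι : Function.Injective ι) (hc : ∀ i, E.c i ≠ 1) (hi : i + 1 < m) (hk : k.hi ≤ i)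
    (hz : stepVal v k u (.z ⟨i, by omega⟩) = of (v (.z ⟨i, by omega⟩)) * t)
    (hu : ¬ Commute (eval ι v (E.atom ⟨i, by omega⟩)) u) :
    ¬ Commute (eval (stepIncl ι u) (stepVal v k u) (E.atom ⟨i, by omega⟩))
      (eval (stepIncl ι u) (stepVal v k u) (E.atom ⟨i + 1, by omega⟩)) := by
  rw [eval_step_atom_of_val_eq (by omega) _ hz,
    eval_step_atom_of_outside (Or.inr (Nat.lt_succ_of_le hk))]
  exact not_commute_conj_t hH hu (eval_atom_ne_one hι hc hi _)

theorem not_commute_step_atom_x (hH : IsFullyResiduallyFree H) (hi : i < m) (hk : k.hi < m)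
    (hz : stepVal v k u (.z ⟨i, hi⟩) = of (v (.z ⟨i, hi⟩)) * t)
    (hu : ¬ Commute (eval ι v (E.atom ⟨i, by omega⟩)) u) {l : Fin n}
    (hl : ¬ Commute (v (.x l)) (v (.y l))) :
    ¬ Commute (eval (stepIncl ι u) (stepVal v k u) (E.atom ⟨i, by omega⟩))
      (stepVal v k u (.x l)) := by
  rw [eval_step_atom_of_val_eq hi _ hz,
    stepVal_of_outside (w := .x l) (Or.inr (hk.trans_le (Nat.le_add_right m l)))]
  exact not_commute_conj_t hH hu (ne_one_of_not_commute fun h => hl h.symm)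

end Step

section StepStep

variable {j : ℕ} {k : Move m n} {u : H}

theorem eval_step_period_zz (hj : j + 1 < m) (hk : j < k.lo)
    (hz : stepVal v k u (.z ⟨j + 1, hj⟩) = of (v (.z ⟨j + 1, hj⟩)) * t) :
    eval (stepIncl ι u) (stepVal v k u) (Move.period E (.zz ⟨j, by omega⟩)) =
      of (eval ι v (E.atom ⟨j, by omega⟩)) *
        (t⁻¹ * of (eval ι v (E.atom ⟨j + 1, by omega⟩)) * t) := by
  rw [Move.period, map_mul, eval_step_atom_of_val_eq hj _ hz,
    eval_step_atom_of_outside (Or.inl hk)]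

theorem not_commute_of_step_period_zz (hH : IsFullyResiduallyFree H) (hj : j + 1 < m)
    (hk : j < k.lo) (hz : stepVal v k u (.z ⟨j + 1, hj⟩) = of (v (.z ⟨j + 1, hj⟩)) * t)
    (hu : ¬ Commute (eval ι v (E.atom ⟨j + 1, by omega⟩)) u) {g : H} (hg : g ≠ 1) :
    ¬ Commute (of g)
      (eval (stepIncl ι u) (stepVal v k u) (Move.period E (.zz ⟨j, by omega⟩))) := by
  rw [eval_step_period_zz hj hk hz]
  simpa using not_commute_of_mul_conj hH 1 hu hg (a := eval ι v (E.atom ⟨j, by omega⟩))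

variable {u' : CentralizerExtension H u}

theorem IsReady.isSeparated_step_step (h : IsReady E ι v j) (hj : j + 1 < m) (hk : j < k.lo)
    (hz : stepVal v k u (.z ⟨j + 1, hj⟩) = of (v (.z ⟨j + 1, hj⟩)) * t)
    (hu : ¬ Commute (eval ι v (E.atom ⟨j + 1, by omega⟩)) u)
    (hu' : u' = eval (stepIncl ι u) (stepVal v k u) (Move.period E (.zz ⟨j, by omega⟩))) :
    IsSeparated (stepIncl (stepIncl ι u) u') := by
  have hu1 : u ≠ 1 := ne_one_of_not_commute hu
  have hcomm := not_commute_of_step_period_zz h.separated.1 hj hk hz hu hu1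
  exact (h.separated.step hu1).step (hu' ▸ ne_one_of_not_commute hcomm)

theorem IsReady.isFaithfulOn_step_step (h : IsReady E ι v j) (hj : j + 1 < m) (hk : j < k.lo)
    (hz : stepVal v k u (.z ⟨j + 1, hj⟩) = of (v (.z ⟨j + 1, hj⟩)) * t)
    (hu : ¬ Commute (eval ι v (E.atom ⟨j + 1, by omega⟩)) u)
    (hu' : u' = eval (stepIncl ι u) (stepVal v k u) (Move.period E (.zz ⟨j, by omega⟩))) :
    IsFaithfulOn (eval (stepIncl (stepIncl ι u) u')
      (stepVal (stepVal v k u) (.zz ⟨j, by omega⟩) u')) (generated G {w | w.pos < j + 1}) := by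
  have hfree : ∀ g, g ≠ 1 → ¬ Commute (of g) u' := fun g hg =>
    hu' ▸ not_commute_of_step_period_zz h.separated.1 hj hk hz hu hg
  have hold : ∀ b ∈ generated G {w : QVar m n | w.pos < j},
      eval (stepIncl (stepIncl ι u) u') (stepVal (stepVal v k u) (.zz ⟨j, by omega⟩) u') b =
        of (of (eval ι v b)) := fun b hb => by
    rw [eval_step_of_mem (k := .zz ⟨j, _⟩) (fun w (hw : w.pos < j) => Or.inl hw) hb,
      eval_step_of_mem (fun w (hw : w.pos < j) => Or.inl (hw.trans hk)) hb]
  refine (isFaithfulOn_closure_union_singleton hfree h.faithful hold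
    (p := v (.z ⟨j, by omega⟩)) (q := 1) ?_).mono (generated_pos_lt_succ_le (by omega))
  rw [eval_var, stepVal_zz_left, stepVal_of_outside (w := .z ⟨j, _⟩) (Or.inl hk), map_one,
    map_one, mul_one]

theorem IsReady.not_commute_zz_zz_atom_mul (h : IsReady E ι v j) (hc : ∀ i, E.c i ≠ 1)
    (hj : j + 3 < m)
    (hbu : ¬ Commute (eval ι v (E.atom ⟨j + 1, by omega⟩)) u)
    (hcu : ¬ Commute (eval ι v (E.atom ⟨j + 2, by omega⟩)) u)
    (hu' : u' = eval (stepIncl ι u) (stepVal v (.zz ⟨j + 1, by omega⟩) u)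
      (Move.period E (.zz ⟨j, by omega⟩))) :
    ¬ Commute
      (eval (stepIncl (stepIncl ι u) u')
        (stepVal (stepVal v (.zz ⟨j + 1, by omega⟩) u) (.zz ⟨j, by omega⟩) u')
        (E.atom ⟨j + 1, by omega⟩))
      (eval (stepIncl (stepIncl ι u) u')
          (stepVal (stepVal v (.zz ⟨j + 1, by omega⟩) u) (.zz ⟨j, by omega⟩) u')
          (E.atom ⟨j + 2, by omega⟩) *
        eval (stepIncl (stepIncl ι u) u')
          (stepVal (stepVal v (.zz ⟨j + 1, by omega⟩) u) (.zz ⟨j, by omega⟩) u')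
          (E.atom ⟨j + 3, by omega⟩)) := by
  have hne {i : ℕ} (hi : i < m) : eval ι v (E.atom ⟨i, by omega⟩) ≠ 1 :=
    eval_atom_ne_one h.injective hc hi _
  have hz1 : stepVal v (.zz ⟨j + 1, by omega⟩) u (.z ⟨j + 1, by omega⟩) =
      of (v (.z ⟨j + 1, by omega⟩)) * t := stepVal_zz_left _ _ _
  have hz2 : stepVal v (.zz ⟨j + 1, by omega⟩) u (.z ⟨j + 2, by omega⟩) =
      of (v (.z ⟨j + 2, by omega⟩)) * t := stepVal_zz_right _ _ _
  rw [eval_step_atom_of_outside (j := ⟨j + 2, _⟩) (Or.inr (by simp only [Move.hi]; omega)),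
    eval_step_atom_of_outside (j := ⟨j + 3, _⟩) (Or.inr (by simp only [Move.hi]; omega)),
    ← map_mul, eval_step_atom_of_val_eq (by omega) _ (stepVal_zz_right _ _ _)]
  refine not_commute_conj_t (h.separated.step (ne_one_of_not_commute hbu)).1 ?_ ?_
  · rw [hu', eval_step_period_zz (by omega) (by simp [Move.lo]) hz1,
      eval_step_atom_of_val_eq (by omega) _ hz1, commute_mul_right_self_iff]
    exact not_commute_conj_t h.separated.1 hbu (hne (by omega))
  · rw [eval_step_atom_of_val_eq (by omega) _ hz2,
      eval_step_atom_of_outside (Or.inr (by simp only [Move.hi]; omega))]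
    intro hprod
    refine not_commute_conj_t h.separated.1 hcu (hne (i := j + 3) (by omega)) ?_
    rw [mul_eq_one_iff_eq_inv.1 hprod]
    exact (Commute.refl _).inv_left

theorem IsReady.zz_zz (h : IsReady E ι v j) (hc : ∀ i, E.c i ≠ 1) (hj : j + 2 < m)
    (hu : u = eval ι v (Move.period E (.zz ⟨j + 1, by omega⟩)))
    (hu' : u' = eval (stepIncl ι u) (stepVal v (.zz ⟨j + 1, by omega⟩) u)
      (Move.period E (.zz ⟨j, by omega⟩))) :
    IsReady E (stepIncl (stepIncl ι u) u')
      (stepVal (stepVal v (.zz ⟨j + 1, by omega⟩) u) (.zz ⟨j, by omega⟩) u') (j + 1) := by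
  rw [Move.period, map_mul] at hu
  have hbu : ¬ Commute (eval ι v (E.atom ⟨j + 1, by omega⟩)) u := by
    rw [hu, commute_mul_left_self_iff]
    exact h.zz hj
  have hcu : ¬ Commute (eval ι v (E.atom ⟨j + 2, by omega⟩)) u := by
    rw [hu, commute_mul_right_self_iff]
    exact fun hcomm => h.zz hj hcomm.symm
  have hz1 : stepVal v (.zz ⟨j + 1, by omega⟩) u (.z ⟨j + 1, by omega⟩) =
      of (v (.z ⟨j + 1, by omega⟩)) * t := stepVal_zz_left _ _ _
  have hz2 : stepVal v (.zz ⟨j + 1, by omega⟩) u (.z ⟨j + 2, by omega⟩) =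
      of (v (.z ⟨j + 2, by omega⟩)) * t := stepVal_zz_right _ _ _
  have hhandle (i : Fin n) : ¬ Commute (v (.x i)) (v (.y i)) := h.handle i (by omega)
  refine ⟨h.isSeparated_step_step (by omega) (by simp [Move.lo]) hz1 hbu hu',
    h.isFaithfulOn_step_step (by omega) (by simp [Move.lo]) hz1 hbu hu',
    fun i _ => ?_, fun hj' => ?_, fun hj' hn => ?_, fun _ hj' => ?_⟩
  · refine not_commute_stepVal_handle ?_ (not_commute_stepVal_handle ?_ (hhandle i))
    all_goals simp only [Move.hi]; omega
  · rw [eval_step_atom_of_outside (j := ⟨j + 1 + 1, _⟩),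
      eval_step_atom_of_outside (j := ⟨j + 1 + 2, _⟩), commute_of_of_iff]
    · exact not_commute_step_atom_atom_succ h.separated.1 h.injective hc hj' (by simp [Move.hi])
        hz2 hcu
    all_goals right; simp only [Move.hi]; omega
  · rw [eval_step_atom_of_outside, stepVal_of_outside, commute_of_of_iff]
    · exact not_commute_step_atom_x h.separated.1 hj (by simpa [Move.hi]) hz2 hcu (hhandle ⟨0, hn⟩)
    all_goals right; simp only [Move.hi, QVar.pos]; omega
  · exact h.not_commute_zz_zz_atom_mul hc (by omega) hbu hcu hu'

theorem IsReady.zx_zz (h : IsReady E ι v j) (hj : j + 2 = m) (hm : 0 < m) (hn : 0 < n)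
    (hu : u = eval ι v (Move.period E (.zx hm hn)))
    (hu' : u' = eval (stepIncl ι u) (stepVal v (.zx hm hn) u)
      (Move.period E (.zz ⟨j, by omega⟩))) :
    IsReady E (stepIncl (stepIncl ι u) u')
      (stepVal (stepVal v (.zx hm hn) u) (.zz ⟨j, by omega⟩) u') (j + 1) := by
  subst hj
  have hbu : ¬ Commute (eval ι v (E.atom ⟨j + 1, by omega⟩)) u := by
    rw [hu, Move.period, map_mul, map_inv, eval_var]
    exact fun hcomm => h.zx rfl hn (by simpa using (commute_mul_left_self_iff.1 hcomm).inv_right)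
  have hz := stepVal_zx_z (v := v) hm hn u (Nat.lt_succ_self (j + 1)) rfl
  refine ⟨h.isSeparated_step_step (by omega) (by simp [Move.lo]) hz hbu hu',
    h.isFaithfulOn_step_step (by omega) (by simp [Move.lo]) hz hbu hu',
    fun i _ => ?_, fun _ => by omega, fun _ => by omega, fun _ => by omega⟩
  exact not_commute_stepVal_handle (by simp only [Move.hi]; omega)
    (not_commute_stepVal_zx_handle hm hn (h.handle i (by omega)))

end StepStep

theorem isReady_zero (hs : IsSeparated ι) (hι : Function.Injective ι)
    (hh : ∀ i : Fin n, ¬ Commute (v (.x i)) (v (.y i))) (hm : m ≤ 1) : IsReady E ι v 0 :=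
  ⟨hs, isFaithfulOn_generated_pos_lt_zero hι, fun i _ => hh i, fun _ => by omega,
    fun _ => by omega, fun _ _ => by omega⟩

theorem not_commute_step_zz_atom_mul (hH : IsFullyResiduallyFree H) {i : ℕ} (hi : i + 2 < m)
    {u : H} (hu : u = eval ι v (Move.period E (.zz ⟨i, by omega⟩)))
    (hau : ¬ Commute (eval ι v (E.atom ⟨i, by omega⟩)) u)
    (habc : eval ι v (E.atom ⟨i, by omega⟩) * eval ι v (E.atom ⟨i + 1, by omega⟩) *
      eval ι v (E.atom ⟨i + 2, by omega⟩) ≠ 1) :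
    ¬ Commute
      (eval (stepIncl ι u) (stepVal v (.zz ⟨i, by omega⟩) u) (E.atom ⟨i, by omega⟩))
      (eval (stepIncl ι u) (stepVal v (.zz ⟨i, by omega⟩) u) (E.atom ⟨i + 1, by omega⟩) *
        eval (stepIncl ι u) (stepVal v (.zz ⟨i, by omega⟩) u) (E.atom ⟨i + 2, by omega⟩)) := by
  rw [Move.period, map_mul] at hu
  -- `t` commutes with `u`, so the step does not change the product of the three atoms
  have ht : t⁻¹ * of u * t = (of u : CentralizerExtension H u) := by
    rw [mul_assoc, ← (commute_t_of (Commute.refl u)).eq, inv_mul_cancel_left]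
  have hprod : t⁻¹ * of (eval ι v (E.atom ⟨i, by omega⟩)) * t *
      (t⁻¹ * of (eval ι v (E.atom ⟨i + 1, by omega⟩)) * t *
        of (eval ι v (E.atom ⟨i + 2, by omega⟩))) =
      (of (u * eval ι v (E.atom ⟨i + 2, by omega⟩)) : CentralizerExtension H u) := by
    rw [map_mul of u, ← ht, congrArg of hu, map_mul]
    simp [mul_assoc]
  rw [eval_step_atom_of_val_eq (by omega) _ (stepVal_zz_left _ _ _),
    eval_step_atom_of_val_eq (by omega) _ (stepVal_zz_right _ _ _),
    eval_step_atom_of_outside (j := ⟨i + 2, _⟩) (Or.inr (by simp [Move.hi])),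
    ← commute_mul_left_self_iff, hprod]
  exact not_commute_conj_t hH hau (by rwa [hu])

theorem isReady_zz_zero (hs : IsSeparated ι) (hι : Function.Injective ι) (hc : ∀ i, E.c i ≠ 1)
    (hh : ∀ i : Fin n, ¬ Commute (v (.x i)) (v (.y i))) (hm : 1 < m)
    (h01 : ¬ Commute (eval ι v (E.atom ⟨0, by omega⟩)) (eval ι v (E.atom ⟨1, by omega⟩)))
    (h012 : ∀ (_ : n = 0) (h : 3 = m), eval ι v (E.atom ⟨0, by omega⟩) *
      eval ι v (E.atom ⟨1, by omega⟩) * eval ι v (E.atom ⟨2, by omega⟩) ≠ 1) {u : H}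
    (hu : u = eval ι v (Move.period E (.zz ⟨0, by omega⟩))) :
    IsReady E (stepIncl ι u) (stepVal v (.zz ⟨0, by omega⟩) u) 0 := by
  have hu_mul := hu
  rw [Move.period, map_mul] at hu_mul
  have hau : ¬ Commute (eval ι v (E.atom ⟨0, by omega⟩)) u := by
    rwa [hu_mul, commute_mul_left_self_iff]
  have hbu : ¬ Commute (eval ι v (E.atom ⟨1, by omega⟩)) u := by
    rw [hu_mul, commute_mul_right_self_iff]
    exact fun hcomm => h01 hcomm.symm
  have hz1 : stepVal v (.zz ⟨0, by omega⟩) u (.z ⟨1, by omega⟩) =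
      of (v (.z ⟨1, by omega⟩)) * t := stepVal_zz_right _ _ _
  refine ⟨hs.step (ne_one_of_not_commute hau),
    isFaithfulOn_generated_pos_lt_zero ((of_injective (w := u)).comp hι),
    fun i _ => not_commute_stepVal_handle hm (hh i), fun hj' => ?_, fun _ hn => ?_,
    fun hn hj' => not_commute_step_zz_atom_mul hs.1 (by omega) hu hau (h012 hn hj')⟩
  · exact not_commute_step_atom_atom_succ hs.1 hι hc hj' (by simp [Move.hi]) hz1 hbu
  · exact not_commute_step_atom_x hs.1 hm (by simpa [Move.hi]) hz1 hbu (hh ⟨0, hn⟩)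

end GX

namespace CentralizerExtension

open HNNExtension

variable {H : Type u} [Group H] {x y : H}

theorem of_comp_of_comp_of_injective (u : H) (u' : CentralizerExtension H u)
    (u'' : CentralizerExtension (CentralizerExtension H u) u') :
    Function.Injective ((of.comp (of.comp of)) :
      H →* CentralizerExtension (CentralizerExtension (CentralizerExtension H u) u') u'') :=
  (CentralizerExtension.of_injective (w := u'')).comp
    ((CentralizerExtension.of_injective (w := u')).comp CentralizerExtension.of_injective)

theorem not_commute_t_mul (hxy : ¬ Commute x y) :
    ¬ Commute (of x) (t * of y : CentralizerExtension H x) := fun hcomm =>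
  hxy (commute_of_commute_t_mul hcomm).2

theorem not_commute_of_t_mul (hH : IsFullyResiduallyFree H) (hxy : ¬ Commute x y) {g : H}
    (hg : g ≠ 1) : ¬ Commute (of g) (t * of y : CentralizerExtension H x) := fun hcomm =>
  hxy (hH.commute_trans hg (commute_of_commute_t_mul hcomm).1.symm
    (commute_of_commute_t_mul hcomm).2.symm)

theorem t_mul_of_conj_of (x y : H) :
    (t * of x)⁻¹ * of y * (t * of x) = (of (x⁻¹ * y * x) : CentralizerExtension H y) := by
  have ht : t * of y = (of y * t : CentralizerExtension H y) := (commute_t_of (Commute.refl y)).eq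
  simp only [mul_inv_rev, map_mul, map_inv, mul_assoc, mul_right_inj]
  rw [← mul_assoc (of y), ← ht, mul_assoc, inv_mul_cancel_left]

theorem of_conj_t_mul_of (x y : H) :
    (of x)⁻¹ * (t * of y) * of x = (t * of (x⁻¹ * y * x) : CentralizerExtension H x) := by
  have ht : (of x)⁻¹ * t = (t * (of x)⁻¹ : CentralizerExtension H x) :=
    (commute_t_of (Commute.refl x)).inv_right.eq.symm
  simp only [map_mul, map_inv, ← mul_assoc, ht]

theorem not_commute_of_of_of (hH : IsFullyResiduallyFree H) (hxy : ¬ Commute x y)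
    (u : CentralizerExtension (CentralizerExtension H x) (t * of y)) (a : H) {h : H} (hh : h ≠ 1) :
    ¬ Commute (of (of (of h)) : CentralizerExtension _ u) (of (t * of (of x)) * of (of (of a))) :=
  fun hcomm => by
  have hcomm' : Commute (of (of h)) (t * of (of (x * a)) :
      CentralizerExtension (CentralizerExtension H x) (t * of y)) := by
    rw [← commute_of_of_iff (w := u)]
    simpa only [map_mul, mul_assoc] using hcomm
  exact not_commute_of_t_mul hH hxy hh (commute_of_commute_t_mul hcomm').1

theorem of_t_mul_conj_t_mul (x y : H) :
    (of (t * of x))⁻¹ * (t * of (of y)) * of (t * of x) =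
      (t * of (of (x⁻¹ * y * x)) :
        CentralizerExtension (CentralizerExtension H y) (t * of x)) := by
  rw [of_conj_t_mul_of, t_mul_of_conj_of]

theorem isFaithfulOn_closure_twist {Γ : Type*} [Group Γ] (hH : IsFullyResiduallyFree H)
    (hxy : ¬ Commute x y) {φ : Γ →* H} {B : Subgroup Γ} (hφ : IsFaithfulOn φ B)
    {e : Γ →* CentralizerExtension (CentralizerExtension H x) (t * of y)}
    (hB : ∀ b ∈ B, e b = of (of (φ b))) {s : Γ} {q : H} (hs : e s = t * of (of q)) :
    IsFaithfulOn e (Subgroup.closure (B ∪ {s})) := by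
  refine isFaithfulOn_closure_union_singleton (fun g => not_commute_of_t_mul hH hxy) hφ hB
    (p := 1) (q := q) ?_
  rw [hs, map_one, map_one, one_mul]

end CentralizerExtension

namespace GX

open HNNExtension CentralizerExtension

variable {G : Type u} [Group G] {m n : ℕ} {H K : Type u} [Group H] [Group K] {ι : G →* H}
  {v : QVar m n → H} {E : QuadEq G m n}

/-- The conjugate `y_i ^ x_i`. The twists make it, rather than `y_i`, free over the remaining
variables. -/
def handleConj (G : Type u) [Group G] {m n : ℕ} (i : Fin n) : GX G m n :=
  (var (.x i))⁻¹ * var (.y i) * var (.x i)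

theorem eval_handleConj (i : Fin n) :
    eval ι v (handleConj G i) = (v (.x i))⁻¹ * v (.y i) * v (.x i) := by
  simp only [handleConj, map_mul, map_inv, eval_var]

/-- The effect of the three consecutive twists of the handle `i`: they map `(ι, v)` to `(ι', v')`
by the embedding `f`. -/
structure IsTwist (i : Fin n) (ι : G →* H) (v : QVar m n → H) (f : H →* K) (ι' : G →* K)
    (v' : QVar m n → K) : Prop where
  separated : IsSeparated ι'
  injective : Function.Injective f
  map_incl : ∀ g, f (ι g) = ι' g
  map_val : ∀ w : QVar m n, w.pos ≠ m + i → f (v w) = v' w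
  not_commute : ¬ Commute (v' (.x i)) (v' (.y i))
  free : ∀ a h, h ≠ 1 → ¬ Commute (f h) (v' (.x i) * f a)
  faithful : ∀ B ≤ generated G {w : QVar m n | w.pos ≠ m + i}, IsFaithfulOn (eval ι v) B →
    IsFaithfulOn (eval ι' v') (Subgroup.closure (B ∪ {handleConj G i}))

section Twist

variable {i : Fin n} {u : H}

theorem stepVal_twistY_x : stepVal v (.twistY i) u (.x i) = of (v (.x i)) := by
  simp [stepVal, Move.act]

theorem stepVal_twistY_y : stepVal v (.twistY i) u (.y i) = t * of (v (.y i)) := by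
  simp [stepVal, Move.act]

theorem stepVal_twistX_x : stepVal v (.twistX i) u (.x i) = t * of (v (.x i)) := by
  simp [stepVal, Move.act]

theorem stepVal_twistX_y : stepVal v (.twistX i) u (.y i) = of (v (.y i)) := by
  simp [stepVal, Move.act]

theorem stepVal_twistY_of_pos_ne {w : QVar m n} (hw : w.pos ≠ m + i) :
    stepVal v (.twistY i) u w = of (v w) :=
  stepVal_of_outside (by simpa only [Move.lo, Move.hi] using lt_or_gt_of_ne hw)

theorem stepVal_twistX_of_pos_ne {w : QVar m n} (hw : w.pos ≠ m + i) :
    stepVal v (.twistX i) u w = of (v w) :=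
  stepVal_of_outside (by simpa only [Move.lo, Move.hi] using lt_or_gt_of_ne hw)

theorem stepVal_twist_of_pos_ne {u₂ : CentralizerExtension H u}
    {u₃ : CentralizerExtension _ u₂} {w : QVar m n} (hw : w.pos ≠ m + i) :
    stepVal (stepVal (stepVal v (.twistY i) u) (.twistX i) u₂) (.twistY i) u₃ w =
      of (of (of (v w))) :=
  (stepVal_twistY_of_pos_ne hw).trans (congrArg of ((stepVal_twistX_of_pos_ne hw).trans
    (congrArg of (stepVal_twistY_of_pos_ne hw))))

theorem eval_twist_of_mem {u₂ : CentralizerExtension H u} {u₃ : CentralizerExtension _ u₂}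
    {γ : GX G m n} (hγ : γ ∈ generated G {w : QVar m n | w.pos ≠ m + i}) :
    eval (stepIncl (stepIncl (stepIncl ι u) u₂) u₃)
      (stepVal (stepVal (stepVal v (.twistY i) u) (.twistX i) u₂) (.twistY i) u₃) γ =
      of (of (of (eval ι v γ))) :=
  (eval_step_of_mem (k := .twistY i) (fun _ => lt_or_gt_of_ne) hγ).trans (congrArg of
    ((eval_step_of_mem (k := .twistX i) (fun _ => lt_or_gt_of_ne) hγ).trans (congrArg of
      (eval_step_of_mem (k := .twistY i) (fun _ => lt_or_gt_of_ne) hγ))))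

theorem isTwist (hs : IsSeparated ι) (i : Fin n) (hxy : ¬ Commute (v (.x i)) (v (.y i)))
    {u₁ : H} (h₁ : u₁ = v (.x i)) {u₂ : CentralizerExtension H u₁}
    (h₂ : u₂ = stepVal v (.twistY i) u₁ (.y i)) {u₃ : CentralizerExtension _ u₂}
    (h₃ : u₃ = stepVal (stepVal v (.twistY i) u₁) (.twistX i) u₂ (.x i)) :
    IsTwist i ι v (of.comp (of.comp of)) (stepIncl (stepIncl (stepIncl ι u₁) u₂) u₃)
      (stepVal (stepVal (stepVal v (.twistY i) u₁) (.twistX i) u₂) (.twistY i) u₃) := by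
  subst h₁
  rw [stepVal_twistY_y] at h₂
  subst h₂
  rw [stepVal_twistX_x, stepVal_twistY_x] at h₃
  subst h₃
  have hx : v (.x i) ≠ 1 := ne_one_of_not_commute fun hcomm => hxy hcomm.symm
  have hxy₁ := not_commute_t_mul hxy
  have hxy₂ := not_commute_t_mul fun hcomm => hxy₁ hcomm.symm
  refine ⟨?_, of_comp_of_comp_of_injective _ _ _, fun _ => rfl,
    fun w hw => (stepVal_twist_of_pos_ne hw).symm, ?_, fun a h hh hcomm => ?_,
    fun B hB hf => ?_⟩
  · exact ((hs.step hx).step (ne_one_of_not_commute hxy₁)).step (ne_one_of_not_commute hxy₂)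
  · simp only [stepVal_twistY_x, stepVal_twistY_y, stepVal_twistX_x, stepVal_twistX_y]
    exact not_commute_t_mul fun hcomm => hxy₂ hcomm.symm
  · simp only [stepVal_twistY_x, stepVal_twistX_x] at hcomm
    exact not_commute_of_of_of hs.1 hxy _ a hh hcomm
  · have hf₁ : IsFaithfulOn ((of : H →* CentralizerExtension H (v (.x i))).comp (eval ι v)) B :=
      fun b hb hb1 => hf b hb (of_eq_one_iff.1 hb1)
    refine isFaithfulOn_closure_twist (hs.step hx).1 (fun hcomm => hxy₁ hcomm.symm) hf₁
      (q := (of (v (.x i)))⁻¹ * (t * of (v (.y i))) * of (v (.x i)))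
      (fun b hb => eval_twist_of_mem (hB hb)) ?_
    rw [eval_handleConj]
    simp only [stepVal_twistY_x, stepVal_twistY_y, stepVal_twistX_x, stepVal_twistX_y]
    exact of_t_mul_conj_t_mul (of (v (.x i))) (t * of (v (.y i)))

end Twist

variable {i : Fin n} {f : H →* K} {ι' : G →* K} {v' : QVar m n → K}

theorem IsTwist.map_eval (hf : IsTwist i ι v f ι' v') {γ : GX G m n}
    (hγ : γ ∈ generated G {w : QVar m n | w.pos ≠ m + i}) :
    f (eval ι v γ) = eval ι' v' γ :=
  map_eval_of_mem f hf.map_incl hf.map_val hγ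

theorem IsTwist.not_commute_handle (hf : IsTwist i ι v f ι' v') {l : Fin n}
    (hl : l ≠ i → ¬ Commute (v (.x l)) (v (.y l))) : ¬ Commute (v' (.x l)) (v' (.y l)) := by
  by_cases hli : l = i
  · rw [hli]
    exact hf.not_commute
  · have hpos : m + l.1 ≠ m + i := by omega
    rw [← hf.map_val (.x l) hpos, ← hf.map_val (.y l) hpos, commute_map_iff hf.injective]
    exact hl hli

theorem IsTwist.not_commute_period_zx {hm : 0 < m} {hn : 0 < n}
    (hf : IsTwist ⟨0, hn⟩ ι v f ι' v') {g : H} (hg : g ≠ 1) :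
    ¬ Commute (f g) (eval ι' v' (Move.period E (.zx hm hn))) := fun hcomm => by
  refine hf.free (eval ι v (E.atom ⟨m - 1, by omega⟩))⁻¹ g hg ?_
  have hsub : {w : QVar m n | w.pos = m - 1} ⊆ {w : QVar m n | w.pos ≠ m + 0} :=
    fun w (hw : w.pos = m - 1) => show w.pos ≠ m + 0 by omega
  have hinv := hcomm.inv_right
  rw [Move.period, map_mul, map_inv, eval_var, mul_inv_rev, inv_inv] at hinv
  rwa [map_inv, hf.map_eval (generated_mono hsub (E.atom_mem_generated ⟨m - 1, by omega⟩))]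

theorem IsReady.twist_zx {j : ℕ} (h : IsReady E ι v j) (hj : j + 1 = m) (hm : 0 < m) (hn : 0 < n)
    (hf : IsTwist ⟨0, hn⟩ ι v f ι' v') {u : K}
    (hu : u = eval ι' v' (Move.period E (.zx hm hn))) :
    IsReady E (stepIncl ι' u) (stepVal v' (.zx hm hn) u) (j + 1) := by
  have hfree (g : H) (hg : g ≠ 1) : ¬ Commute (f g) u := hu ▸ hf.not_commute_period_zx hg
  have hhandle (l : Fin n) : ¬ Commute (v (.x l)) (v (.y l)) := h.handle l (by omega)
  have hx : v (.x ⟨0, hn⟩) ≠ 1 := ne_one_of_not_commute fun hcomm => hhandle _ hcomm.symm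
  refine ⟨hf.separated.step (ne_one_of_not_commute (hfree _ hx)), ?_, fun l _ => ?_,
    fun _ => by omega, fun _ => by omega, fun _ _ => by omega⟩
  · refine (isFaithfulOn_closure_union_singleton hfree h.faithful (fun b hb => ?_)
      (p := v (.z ⟨j, by omega⟩)) (q := 1) ?_).mono (generated_pos_lt_succ_le (by omega))
    · rw [hf.map_eval (generated_mono (fun w (hw : w.pos < j) => ?_) hb), eval_step_of_mem _ hb]
      · exact fun w (hw : w.pos < j) => Or.inl (by simp only [Move.lo]; omega)
      · exact show w.pos ≠ m + 0 by omega
    · rw [eval_var, stepVal_zx_z hm hn u _ hj, hf.map_val, map_one, map_one, mul_one]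
      exact show j ≠ m + 0 by omega
  · exact not_commute_stepVal_zx_handle hm hn (hf.not_commute_handle fun _ => hhandle l)

theorem generated_pos_lt_handle_succ_le {l : ℕ} (hl : l < n) :
    generated G {w : QVar m n | w.pos < m + l + 1} ≤ Subgroup.closure
      ((Subgroup.closure (generated G {w : QVar m n | w.pos < m + l} ∪ {handleConj G ⟨l, hl⟩}) :
        Subgroup (GX G m n)) ∪ {(var (.x ⟨l, hl⟩))⁻¹}) := by
  set B : Subgroup (GX G m n) :=
    Subgroup.closure (generated G {w : QVar m n | w.pos < m + l} ∪ {handleConj G ⟨l, hl⟩})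
  set C : Subgroup (GX G m n) := Subgroup.closure (B ∪ {(var (.x ⟨l, hl⟩))⁻¹})
  have hold : generated G {w : QVar m n | w.pos < m + l} ≤ C := fun γ hγ =>
    Subgroup.subset_closure (Or.inl (Subgroup.subset_closure (Or.inl hγ)))
  have hconj : handleConj G ⟨l, hl⟩ ∈ C :=
    Subgroup.subset_closure (Or.inl (Subgroup.subset_closure (Or.inr rfl)))
  have hx : var (.x ⟨l, hl⟩) ∈ C := inv_mem_iff.1 (Subgroup.subset_closure (Or.inr rfl))
  have hy : var (.y ⟨l, hl⟩) ∈ C := by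
    simpa [handleConj, mul_assoc] using mul_mem (mul_mem hx hconj) (inv_mem hx)
  refine generated_le (fun g => hold (const_mem_generated g _))
    fun w (hw : w.pos < m + l + 1) => ?_
  by_cases hwl : w.pos < m + l
  · exact hold (var_mem_generated hwl)
  · rcases w with i | i | i <;> simp only [QVar.pos] at hwl hw
    · obtain rfl : i = ⟨l, hl⟩ := Fin.ext (by simp only; omega)
      exact hx
    · obtain rfl : i = ⟨l, hl⟩ := Fin.ext (by simp only; omega)
      exact hy
    · omega

theorem not_commute_stepVal_xx_handle (l : Fin (n - 1)) {u : H} {i : Fin n} (hi : l.1 < i.1)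
    (hxy : ¬ Commute (v (.x i)) (v (.y i))) :
    ¬ Commute (stepVal v (.xx l) u (.x i)) (stepVal v (.xx l) u (.y i)) := by
  have hil : i.1 ≠ l.1 := hi.ne'
  by_cases hi1 : i.1 = l.1 + 1
  · intro hcomm
    refine hxy (commute_of_commute_conj_inv_mul (w := u) ?_)
    simpa [stepVal, Move.act, hi1] using hcomm
  · simpa [stepVal, Move.act, hil, hi1, commute_of_of_iff] using hxy

variable {K' : Type u} [Group K'] {f' : K →* K'} {ι'' : G →* K'} {v'' : QVar m n → K'} {l : ℕ}

theorem IsTwist.not_commute_period_xx {hl : l + 1 < n} (hf' : IsTwist ⟨l + 1, hl⟩ ι' v' f' ι'' v'')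
    {g : K} (hg : g ≠ 1) :
    ¬ Commute (f' g) (eval ι'' v'' (Move.period E (.xx ⟨l, by omega⟩))) := fun hcomm => by
  refine hf'.free (v' (.y ⟨l, by omega⟩))⁻¹ g hg ?_
  have hinv := hcomm.inv_right
  rw [Move.period, map_mul, map_inv, eval_var, eval_var, mul_inv_rev, inv_inv] at hinv
  rwa [map_inv, hf'.map_val (.y ⟨l, by omega⟩) (Nat.lt_succ_self (m + l)).ne]

theorem IsTwist.eval_step_xx {hl : l + 1 < n} (hf' : IsTwist ⟨l + 1, hl⟩ ι' v' f' ι'' v'')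
    {u : K'} {b : GX G m n}
    (hb : b ∈ Subgroup.closure ((generated G {w : QVar m n | w.pos < m + l} : Set (GX G m n)) ∪
      {handleConj G ⟨l, by omega⟩})) :
    eval (stepIncl ι'' u) (stepVal v'' (.xx ⟨l, by omega⟩) u) b = of (f' (eval ι' v' b)) := by
  have hpos (w : QVar m n) (hw : w.pos < m + l + 1) : w.pos ≠ m + (l + 1) := hw.ne
  refine MonoidHom.eqOn_closure (g := of.comp (f'.comp (eval ι' v'))) ?_ hb
  rintro γ (hγ | rfl)
  · rw [eval_step_of_mem (k := .xx ⟨l, _⟩) (fun w (hw : w.pos < m + l) => Or.inl hw) hγ,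
      MonoidHom.comp_apply, MonoidHom.comp_apply, hf'.map_eval]
    exact generated_mono (fun w hw => hpos w (Nat.lt_succ_of_lt hw)) hγ
  · simp only [eval_handleConj, map_mul, map_inv, MonoidHom.comp_apply,
      hf'.map_val (.x ⟨l, by omega⟩) (hpos _ (Nat.lt_succ_self _)),
      hf'.map_val (.y ⟨l, by omega⟩) (hpos _ (Nat.lt_succ_self _))]
    simp [stepVal, Move.act, mul_assoc]

theorem IsReady.twist_xx (h : IsReady E ι v (m + l)) (hl : l + 1 < n)
    (hf : IsTwist ⟨l, by omega⟩ ι v f ι' v') (hf' : IsTwist ⟨l + 1, hl⟩ ι' v' f' ι'' v'') {u : K'}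
    (hu : u = eval ι'' v'' (Move.period E (.xx ⟨l, by omega⟩))) :
    IsReady E (stepIncl ι'' u) (stepVal v'' (.xx ⟨l, by omega⟩) u) (m + l + 1) := by
  have hfree (g : K) (hg : g ≠ 1) : ¬ Commute (f' g) u := hu ▸ hf'.not_commute_period_xx hg
  have hx : v' (.x ⟨l, by omega⟩) ≠ 1 :=
    ne_one_of_not_commute fun hcomm => hf.not_commute hcomm.symm
  refine ⟨hf'.separated.step (ne_one_of_not_commute (hfree _ hx)), ?_, fun i hi => ?_,
    fun _ => by omega, fun _ => by omega, fun _ _ => by omega⟩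
  · have hfaithful := hf.faithful _ (generated_mono fun w hw => ne_of_lt hw) h.faithful
    refine (isFaithfulOn_closure_union_singleton hfree hfaithful (fun b => hf'.eval_step_xx)
      (p := (v' (.x ⟨l, by omega⟩))⁻¹) (q := 1) ?_).mono
      (generated_pos_lt_handle_succ_le (by omega))
    rw [map_inv, eval_var, map_inv, hf'.map_val (.x ⟨l, by omega⟩) (Nat.lt_succ_self (m + l)).ne]
    simp [stepVal, Move.act]
  · refine not_commute_stepVal_xx_handle _ (by simp only; omega) ?_
    exact hf'.not_commute_handle fun _ => hf.not_commute_handle fun _ => h.handle i (by omega)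

end GX

namespace QuadEq

variable {G : Type u} [Group G] {m n : ℕ} (E : QuadEq G m n)

/-- The product of the first `k` atoms. -/
def partialProd (k : ℕ) (hk : k ≤ m + n) : GX G m n :=
  (List.ofFn fun i : Fin k => E.atom ⟨i, i.2.trans_le hk⟩).prod

@[simp]
theorem partialProd_zero : E.partialProd 0 (Nat.zero_le _) = 1 := rfl

theorem partialProd_succ (k : ℕ) (hk : k + 1 ≤ m + n) :
    E.partialProd (k + 1) hk = E.partialProd k (Nat.le_of_succ_le hk) * E.atom ⟨k, hk⟩ := by
  rw [partialProd, List.ofFn_succ', List.concat_eq_append, List.prod_append, List.prod_singleton]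
  rfl

theorem word_eq_partialProd {k : ℕ} (hk : k = m + n) :
    E.word = E.partialProd k hk.le * GX.const E.d⁻¹ := by
  subst hk
  rfl

theorem partialProd_mem {k : ℕ} (hk : k ≤ m + n) :
    E.partialProd k hk ∈ GX.generated G {w : QVar m n | w.pos < k} := by
  refine Subgroup.list_prod_mem _ fun x hx => ?_
  obtain ⟨i, rfl⟩ := List.mem_ofFn.1 hx
  have hpos : {w : QVar m n | w.pos = i} ⊆ {w : QVar m n | w.pos < k} :=
    fun w (hw : w.pos = i) => show w.pos < k from hw ▸ i.2
  exact GX.generated_mono hpos (E.atom_mem_generated ⟨i, i.2.trans_le hk⟩)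

/-- What the product of the atoms after the first `k` ones is equal to modulo the equation. -/
def tail (k : ℕ) (hk : k ≤ m + n) : GX G m n := (E.partialProd k hk)⁻¹ * GX.const E.d

theorem tail_mem {k : ℕ} (hk : k ≤ m + n) :
    E.tail k hk ∈ GX.generated G {w : QVar m n | w.pos < k} :=
  mul_mem (inv_mem (E.partialProd_mem hk)) (GX.const_mem_generated _ _)

theorem tail_succ {k : ℕ} (hk : k < m) :
    E.tail (k + 1) (by omega) = (GX.var (.z ⟨k, hk⟩))⁻¹ * GX.const (E.c ⟨k, hk⟩)⁻¹ *
      GX.var (.z ⟨k, hk⟩) * E.tail k (by omega) := by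
  rw [tail, tail, partialProd_succ, E.atom_of_lt hk]
  simp [GX.const, mul_assoc]

theorem generated_pos_lt_le_ne {w : QVar m n} {k : ℕ} (hw : k ≤ w.pos) :
    GX.generated G {w : QVar m n | w.pos < k} ≤ GX.generated G {w' | w' ≠ w} :=
  GX.generated_mono fun w' (hw' : w'.pos < k) => by
    rintro rfl
    omega

theorem tail_ne_one (hc : ∀ i, E.c i ≠ 1) (hd : E.d ≠ 1) {k : ℕ} (hk : k ≤ m) :
    E.tail k (by omega) ≠ 1 := by
  cases k with
  | zero =>
    intro htail
    refine hd (GX.const_eq_one_iff (m := m) (n := n).1 ?_)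
    simpa [tail] using htail
  | succ k =>
    rw [tail_succ E hk]
    exact GX.conj_var_mul_ne_one (GX.const_mem_generated _ _)
      (generated_pos_lt_le_ne le_rfl (E.tail_mem _))
      fun hc1 => hc _ (inv_eq_one.1 (GX.const_eq_one_iff.1 hc1))

theorem mem_zpowers_tail (hc : ∀ i, E.c i ≠ 1) (hd : E.d ≠ 1) {k : ℕ} (hk : k < m)
    {γ : GX G m n} (h : Commute γ (E.tail (k + 1) (by omega))) :
    γ ∈ Subgroup.zpowers (E.tail (k + 1) (by omega)) := by
  rw [tail_succ E hk] at h ⊢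
  exact GX.mem_zpowers_conj_mul_of_commute (GX.const_mem_generated _ _)
    (generated_pos_lt_le_ne le_rfl (E.tail_mem _))
    (fun hc1 => hc _ (inv_eq_one.1 (GX.const_eq_one_iff.1 hc1))) (E.tail_ne_one hc hd hk.le) h

/-- The handle `[x_l, y_l]` that ends the equation turns it into `Y * (X * w) * Y⁻¹ = X`. -/
theorem var_inv_mul_conj_mem {N : Subgroup (GX G m n)} [N.Normal] (hword : E.word ∈ N) {l : ℕ}
    (hl : l + 1 = n) :
    (GX.var (.x ⟨l, by omega⟩))⁻¹ * (GX.var (.y ⟨l, by omega⟩) *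
      (GX.var (.x ⟨l, by omega⟩) * E.tail (m + l) (by omega)) * (GX.var (.y ⟨l, by omega⟩))⁻¹) ∈
      N := by
  rw [E.word_eq_partialProd (k := m + l + 1) (by omega), partialProd_succ, E.atom_add (by omega)]
    at hword
  rw [← QuotientGroup.eq_one_iff] at hword ⊢
  simp only [tail, GX.const, map_inv, QuotientGroup.mk_mul, QuotientGroup.mk_inv] at hword ⊢
  rw [mul_inv_eq_one, ← eq_inv_mul_iff_mul_eq] at hword
  rw [← hword]
  simp [mul_assoc]

theorem normalClosure_word_le_ker {K : Type*} [Group K] {f : GX G m n →* K} (hf : f E.word = 1) :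
    Subgroup.normalClosure {E.word} ≤ f.ker :=
  Subgroup.normalClosure_le_normal (by simpa using hf)

end QuadEq

section QuotientGroup

variable {Γ : Type*} [Group Γ] {N : Subgroup Γ} [N.Normal] {a b s : Γ}

theorem zpow_inv_mul_conj_mem (h : a⁻¹ * (s * b * s⁻¹) ∈ N) (k : ℤ) :
    (a ^ k)⁻¹ * (s * b ^ k * s⁻¹) ∈ N := by
  rw [← QuotientGroup.eq] at h ⊢
  rw [← conj_zpow]
  simpa using congrArg (· ^ k) h

theorem inv_mul_conj_inv_mem (h : a⁻¹ * (s * b * s⁻¹) ∈ N) : b⁻¹ * (s⁻¹ * a * s) ∈ N := by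
  rw [← QuotientGroup.eq] at h ⊢
  simp only [QuotientGroup.mk_mul, QuotientGroup.mk_inv] at h ⊢
  simp [h, mul_assoc]

end QuotientGroup

theorem commute_inv_mul_mul_iff {K : Type*} [Group K] {q a b : K} :
    Commute a (q⁻¹ * b * q) ↔ Commute (q * a * q⁻¹) b := by
  rw [← Commute.conj_iff q]
  simp [mul_assoc]

namespace GX

open HNNExtension CentralizerExtension

variable {G : Type u} [Group G] {m n : ℕ} {H : Type u} [Group H] {ι : G →* H}
  {v : QVar m n → H} {E : QuadEq G m n} {l : ℕ}

theorem closure_generated_union_var_x_union_var_y {i : Fin n} (hi : (i : ℕ) + 1 = n) :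
    Subgroup.closure ((Subgroup.closure (generated G {w : QVar m n | w.pos < m + i} ∪ {var (.x i)} :
      Set (GX G m n)) : Set (GX G m n)) ∪ {var (.y i)}) = ⊤ := by
  rw [eq_top_iff, ← generated_univ]
  have hold {γ : GX G m n} (hγ : γ ∈ generated G {w : QVar m n | w.pos < m + i}) :
      γ ∈ Subgroup.closure ((Subgroup.closure (generated G {w : QVar m n | w.pos < m + i} ∪
        {var (.x i)} : Set (GX G m n)) : Set (GX G m n)) ∪ {var (.y i)}) :=
    Subgroup.subset_closure (Or.inl (Subgroup.subset_closure (Or.inl hγ)))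
  refine generated_le (fun g => hold (const_mem_generated g _)) fun w _ => ?_
  by_cases hlt : w.pos < m + i
  · exact hold (var_mem_generated hlt)
  · rcases w with j | j | j <;> simp only [QVar.pos] at hlt
    · obtain rfl : j = i := Fin.ext (by omega)
      exact Subgroup.subset_closure (Or.inl (Subgroup.subset_closure (Or.inr rfl)))
    · obtain rfl : j = i := Fin.ext (by omega)
      exact Subgroup.subset_closure (Or.inr rfl)
    · omega

theorem eval_step_twistY_of_mem (hl : l < n) {u : H} {b : GX G m n}
    (hb : b ∈ Subgroup.closure ((generated G {w : QVar m n | w.pos < m + l} : Set (GX G m n)) ∪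
      {var (.x ⟨l, hl⟩)})) :
    eval (stepIncl ι u) (stepVal v (.twistY ⟨l, hl⟩) u) b = of (eval ι v b) := by
  refine MonoidHom.eqOn_closure (g := of.comp (eval ι v)) ?_ hb
  rintro γ (hγ | rfl)
  · exact eval_step_of_mem (k := .twistY ⟨l, hl⟩) (fun w (hw : w.pos < m + l) => Or.inl hw) hγ
  · rw [eval_var, stepVal_twistY_x, MonoidHom.comp_apply, eval_var]

theorem mem_normalClosure_of_eval_step_twistY (hl : l + 1 = n) (hw : eval ι v E.word = 1)
    (hv : IsFaithfulOn (eval ι v) (Subgroup.closure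
      (generated G {w : QVar m n | w.pos < m + l} ∪ {var (.x ⟨l, by omega⟩)})))
    {u : H} (hu : u = eval ι v (Move.period E (.twistY ⟨l, by omega⟩))) {γ : GX G m n}
    (hγ : eval (stepIncl ι u) (stepVal v (.twistY ⟨l, by omega⟩) u) γ = 1) :
    γ ∈ Subgroup.normalClosure {E.word} := by
  have hln : l < n := by omega
  set X : GX G m n := var (.x ⟨l, hln⟩)
  set Y : GX G m n := var (.y ⟨l, hln⟩)
  set B := Subgroup.closure (generated G {w : QVar m n | w.pos < m + l} ∪ {X} : Set (GX G m n))
  have huX : u = eval ι v X := hu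
  have hXB : X ∈ B := Subgroup.subset_closure (Or.inr rfl)
  have hXw : X * E.tail (m + l) (by omega) ∈ B :=
    mul_mem hXB (Subgroup.subset_closure (Or.inl (E.tail_mem _)))
  have hrel : X⁻¹ * (Y * (X * E.tail (m + l) (by omega)) * Y⁻¹) ∈
      Subgroup.normalClosure {E.word} := E.var_inv_mul_conj_mem
    (Subgroup.subset_normalClosure (Set.mem_singleton _)) hl
  have hφ : Subgroup.normalClosure {E.word} ≤ (eval ι v).ker := E.normalClosure_word_le_ker hw
  have hφrel : eval ι v (X * E.tail (m + l) (by omega)) =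
      (eval ι v Y)⁻¹ * u * eval ι v Y := by
    have hker := hφ (inv_mul_conj_inv_mem hrel)
    rwa [MonoidHom.mem_ker, map_mul, map_inv, inv_mul_eq_one, map_mul (eval ι v) (Y⁻¹ * X),
      map_mul (eval ι v) Y⁻¹, map_inv, ← huX] at hker
  have hgen : γ ∈ Subgroup.closure ((B : Set (GX G m n)) ∪ {Y}) := by
    rw [closure_generated_union_var_x_union_var_y (i := ⟨l, hln⟩) hl]
    exact Subgroup.mem_top γ
  refine mem_of_mem_closure_union_singleton (φ := eval ι v) (p := 1) (q := eval ι v Y)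
    (E.normalClosure_word_le_ker ?_) hφ (fun b => eval_step_twistY_of_mem hln) ?_
    (fun b hb hb1 => hv b hb hb1 ▸ one_mem _) (fun b hb hcomm => ?_) (fun b hb hcomm => ?_)
    hgen hγ
  · rw [hu, eval_step_word, hw, map_one]
  · rw [eval_var, stepVal_twistY_y, map_one, one_mul, eval_var]
  · rw [← commute_inv_mul_mul_iff, ← hφrel] at hcomm
    obtain ⟨k, rfl⟩ := mem_zpowers_var_mul_of_commute
      (QuadEq.generated_pos_lt_le_ne (w := .x ⟨l, hln⟩) le_rfl (E.tail_mem _))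
      (hv.commute hb hXw hcomm)
    exact ⟨X ^ k, zpow_mem hXB k, zpow_inv_mul_conj_mem hrel k⟩
  · rw [inv_one, one_mul, mul_one, huX] at hcomm
    obtain ⟨k, rfl⟩ := mem_zpowers_var_of_commute (hv.commute hb hXB hcomm)
    refine ⟨_, zpow_mem hXw k, ?_⟩
    simpa only [inv_inv] using zpow_inv_mul_conj_mem (s := Y⁻¹) (k := k)
      (by simpa only [inv_inv] using inv_mul_conj_inv_mem hrel)

theorem IsReady.isFaithfulOn_step_twistX (h : IsReady E ι v (m + l)) (hl : l < n) {u : H}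
    (hu : u = v (.x ⟨l, hl⟩)) {u' : CentralizerExtension H u}
    (hu' : u' = t * of (v (.y ⟨l, hl⟩))) :
    IsFaithfulOn (eval (stepIncl (stepIncl ι u) u')
      (stepVal (stepVal v (.twistY ⟨l, hl⟩) u) (.twistX ⟨l, hl⟩) u'))
      (Subgroup.closure (generated G {w : QVar m n | w.pos < m + l} ∪ {var (.x ⟨l, hl⟩)})) := by
  have hfree (g : H) (hg : g ≠ 1) : ¬ Commute (of g) u' := by
    subst hu
    exact hu' ▸ not_commute_of_t_mul h.separated.1 (h.handle ⟨l, hl⟩ le_rfl) hg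
  refine isFaithfulOn_closure_union_singleton hfree h.faithful (p := 1) (q := v (.x ⟨l, hl⟩))
    (fun b hb => ?_) ?_
  · exact (eval_step_of_mem (k := .twistX ⟨l, hl⟩) (fun w (hw : w.pos < m + l) => Or.inl hw)
      hb).trans (congrArg of (eval_step_of_mem (k := .twistY ⟨l, hl⟩)
        (fun w (hw : w.pos < m + l) => Or.inl hw) hb))
  · rw [eval_var, stepVal_twistX_x, stepVal_twistY_x, map_one, map_one, one_mul]

theorem IsReady.mem_of_twist (h : IsReady E ι v (m + l)) (hl : l + 1 = n)
    (hw : eval ι v E.word = 1) {u₁ : H}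
    (h₁ : u₁ = eval ι v (Move.period E (.twistY ⟨l, by omega⟩))) {u₂ : CentralizerExtension H u₁}
    (h₂ : u₂ = eval (stepIncl ι u₁) (stepVal v (.twistY ⟨l, by omega⟩) u₁)
      (Move.period E (.twistX ⟨l, by omega⟩))) {u₃ : CentralizerExtension _ u₂}
    (h₃ : u₃ = eval (stepIncl (stepIncl ι u₁) u₂)
      (stepVal (stepVal v (.twistY ⟨l, by omega⟩) u₁) (.twistX ⟨l, by omega⟩) u₂)
      (Move.period E (.twistY ⟨l, by omega⟩))) {γ : GX G m n}
    (hγ : eval (stepIncl (stepIncl (stepIncl ι u₁) u₂) u₃)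
      (stepVal (stepVal (stepVal v (.twistY ⟨l, by omega⟩) u₁) (.twistX ⟨l, by omega⟩) u₂)
        (.twistY ⟨l, by omega⟩) u₃) γ = 1) : γ ∈ Subgroup.normalClosure {E.word} := by
  have hw₁ : eval (stepIncl ι u₁) (stepVal v (.twistY ⟨l, by omega⟩) u₁) E.word = 1 := by
    rw [h₁, eval_step_word, hw, map_one]
  refine mem_normalClosure_of_eval_step_twistY hl ?_ ?_ h₃ hγ
  · rw [h₂, eval_step_word, hw₁, map_one]
  · refine h.isFaithfulOn_step_twistX (by omega) (h₁.trans (eval_var _ _ _)) ?_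
    rw [h₂, Move.period, eval_var, stepVal_twistY_y]

end GX

namespace CentralizerExtension

open HNNExtension

variable {H : Type u} [Group H] {u : H}

theorem not_commute_conj_of_mul_conj (hH : IsFullyResiduallyFree H) {a b g : H}
    (ha : ¬ Commute a u) (hg : g ≠ 1) :
    ¬ Commute (t⁻¹ * of g * t : CentralizerExtension H u) (of a * (t⁻¹ * of b * t)) := by
  intro hc
  refine not_commute_of_mul_conj (a := b⁻¹) hH (-1) (b := a⁻¹) (w := u)
    (fun h => ha (by simpa using h.inv_left)) hg ?_
  have hconj := congrArg (fun z => (t : CentralizerExtension H u) * z * t⁻¹) hc.inv_right.eq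
  rw [Commute, SemiconjBy]
  simpa [mul_assoc] using hconj

variable {u' : CentralizerExtension H u}

theorem eq_and_eq_one_of_commute_cond (hof : ∀ g, g ≠ 1 → ¬ Commute (of g) u')
    (hconj : ∀ g, g ≠ 1 → ¬ Commute (t⁻¹ * of g * t) u') (ht : ∀ g, ¬ Commute (of g * t) u')
    {a b g : H} {i j : Bool}
    (h : Commute ((cond i (of b * t) (of a))⁻¹ * of g * cond j (of b * t) (of a)) u') :
    i = j ∧ g = 1 := by
  rcases i <;> rcases j <;> simp only [cond_true, cond_false] at h
  · have hg : a⁻¹ * g * a = 1 := not_imp_not.1 (hof _) (by simpa using h)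
    exact ⟨rfl, by simpa [mul_assoc, inv_mul_eq_one] using hg⟩
  · exact absurd (by simpa [mul_assoc] using h) (ht (a⁻¹ * g * b))
  · exact absurd (by simpa [mul_assoc] using h.inv_left) (ht (a⁻¹ * g⁻¹ * b))
  · have hg : b⁻¹ * g * b = 1 := not_imp_not.1 (hconj _) (by simpa [mul_assoc] using h)
    exact ⟨rfl, by simpa [mul_assoc, inv_mul_eq_one] using hg⟩

theorem isFaithfulOn_closure_union_pair (hof : ∀ g, g ≠ 1 → ¬ Commute (of g) u')
    (hconj : ∀ g, g ≠ 1 → ¬ Commute (t⁻¹ * of g * t) u') (ht : ∀ g, ¬ Commute (of g * t) u')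
    {Γ : Type*} [Group Γ] {f : Γ →* CentralizerExtension (CentralizerExtension H u) u'}
    {φ : Γ →* H} {B : Subgroup Γ} (hφ : IsFaithfulOn φ B) (hB : ∀ b ∈ B, f b = of (of (φ b)))
    {s s' : Γ} {a b c : H} (hs : f s = of (of a) * t)
    (hs' : f s' = of (of b * t) * t * (of (of c * t))⁻¹) :
    IsFaithfulOn f (Subgroup.closure (B ∪ {s, s'})) := by
  have hrange : ({s, s'} : Set Γ) = Set.range fun i => cond i s' s :=
    (Bool.range_eq fun i => cond i s' s).symm
  rw [hrange]
  intro γ hγ hfγ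
  refine eq_one_of_mem_closure_union_range (φ := of.comp φ) (p := fun i => cond i (of b * t) (of a))
    (q := fun i => (cond i (of c * t) (of 1))⁻¹) hB ?_ (fun x hx h => hφ x hx (of_eq_one_iff.1 h))
    (fun i j x hx h => ?_) (fun i j x hx h => ?_) hγ hfγ
  · rintro (_ | _)
    · simpa using hs
    · simpa using hs'
  · rw [inv_inv] at h
    obtain ⟨rfl, hx1⟩ := eq_and_eq_one_of_commute_cond hof hconj ht h
    simp [hφ x hx hx1]
  · obtain ⟨rfl, hx1⟩ := eq_and_eq_one_of_commute_cond hof hconj ht h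
    simp [hφ x hx hx1]

end CentralizerExtension

namespace QuadEq

variable {G : Type u} [Group G] {m n : ℕ} (E : QuadEq G m n)

/-- The product of the atoms of `z_i` and `z_{i+1}`, conjugated so as to become a word in
`z_i z_{i+1}⁻¹`. -/
def conjPair (i : ℕ) (hi : i + 1 < m) : GX G m n :=
  (GX.var (.z ⟨i, by omega⟩) * (GX.var (.z ⟨i + 1, hi⟩))⁻¹)⁻¹ * GX.const (E.c ⟨i, by omega⟩) *
    (GX.var (.z ⟨i, by omega⟩) * (GX.var (.z ⟨i + 1, hi⟩))⁻¹) * GX.const (E.c ⟨i + 1, hi⟩)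

theorem period_zz_eq_conj {i : ℕ} (hi : i + 1 < m) :
    Move.period E (.zz ⟨i, by omega⟩) =
      (GX.var (.z ⟨i + 1, hi⟩))⁻¹ * E.conjPair i hi * GX.var (.z ⟨i + 1, hi⟩) := by
  rw [Move.period, E.atom_of_lt (by omega), E.atom_of_lt hi, conjPair]
  simp [mul_assoc]

theorem tail_inv_mul_period_mem {N : Subgroup (GX G m n)} [N.Normal] (hword : E.word ∈ N) {i : ℕ}
    (hi : i + 3 = m) (hn : n = 0) :
    (E.tail (i + 1) (by omega))⁻¹ * Move.period E (.zz ⟨i + 1, by omega⟩) ∈ N := by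
  rw [E.word_eq_partialProd (k := i + 1 + 1 + 1) (by omega), partialProd_succ, partialProd_succ]
    at hword
  rw [tail, Move.period]
  rw [← QuotientGroup.eq_one_iff] at hword ⊢
  simp only [GX.const, map_inv, QuotientGroup.mk_mul, QuotientGroup.mk_inv] at hword ⊢
  rw [mul_inv_eq_one] at hword
  rw [← hword]
  simp [mul_assoc]

theorem map_period_zz_eq_map_tail {K : Type*} [Group K] {f : GX G m n →* K} (hf : f E.word = 1)
    {i : ℕ} (hi : i + 3 = m) (hn : n = 0) :
    f (Move.period E (.zz ⟨i + 1, by omega⟩)) = f (E.tail (i + 1) (by omega)) := by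
  have hker := E.tail_inv_mul_period_mem (N := f.ker) hf hi hn
  rw [MonoidHom.mem_ker, map_mul, map_inv, inv_mul_eq_one] at hker
  exact hker.symm

end QuadEq

namespace GX

open HNNExtension CentralizerExtension

variable {G : Type u} [Group G] {m n : ℕ} {H : Type u} [Group H] {ι : G →* H}
  {v : QVar m n → H} {E : QuadEq G m n} {i : ℕ}

/-- The elements built from the variables before `z_i`, from `z_i`, and from `z_{i+1} z_{i+2}⁻¹`. -/
def generatedQuot (G : Type u) [Group G] {m n i : ℕ} (hi : i + 2 < m) : Subgroup (GX G m n) :=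
  Subgroup.closure (generated G {w : QVar m n | w.pos < i} ∪
    {var (.z ⟨i, by omega⟩), var (.z ⟨i + 1, by omega⟩) * (var (.z ⟨i + 2, hi⟩))⁻¹})

theorem generated_pos_lt_le_generatedQuot (hi : i + 2 < m) :
    (generated G {w : QVar m n | w.pos < i}) ≤ generatedQuot G hi :=
  fun _ hb => Subgroup.subset_closure (Or.inl hb)

theorem var_z_mem_generatedQuot (hi : i + 2 < m) :
    (var (.z ⟨i, by omega⟩) : GX G m n) ∈ generatedQuot G hi :=
  Subgroup.subset_closure (Or.inr (Or.inl rfl))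

theorem var_z_mul_inv_mem_generatedQuot (hi : i + 2 < m) :
    (var (.z ⟨i + 1, by omega⟩) * (var (.z ⟨i + 2, hi⟩))⁻¹ : GX G m n) ∈ generatedQuot G hi :=
  Subgroup.subset_closure (Or.inr (Or.inr rfl))

theorem const_mem_generatedQuot (hi : i + 2 < m) (g : G) :
    (const g : GX G m n) ∈ generatedQuot G hi :=
  generated_pos_lt_le_generatedQuot hi (const_mem_generated g _)

theorem tail_mem_generatedQuot (hi : i + 2 < m) :
    E.tail (i + 1) (by omega) ∈ generatedQuot G hi := by
  rw [E.tail_succ (by omega)]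
  exact mul_mem (mul_mem (mul_mem (inv_mem (var_z_mem_generatedQuot hi))
    (const_mem_generatedQuot hi _)) (var_z_mem_generatedQuot hi))
    (generated_pos_lt_le_generatedQuot hi (E.tail_mem _))

theorem conjPair_mem_generatedQuot (hi : i + 2 < m) :
    E.conjPair (i + 1) hi ∈ generatedQuot G hi :=
  mul_mem (mul_mem (mul_mem (inv_mem (var_z_mul_inv_mem_generatedQuot hi))
    (const_mem_generatedQuot hi _)) (var_z_mul_inv_mem_generatedQuot hi))
    (const_mem_generatedQuot hi _)

theorem IsReady.isFaithfulOn_step_zz_zz (h : IsReady E ι v i) (hi : i + 3 = m) (hn : n = 0)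
    {u : H} (hu : u = eval ι v (Move.period E (.zz ⟨i + 1, by omega⟩)))
    {u' : CentralizerExtension H u}
    (hu' : u' = eval (stepIncl ι u) (stepVal v (.zz ⟨i + 1, by omega⟩) u)
      (Move.period E (.zz ⟨i, by omega⟩))) :
    IsFaithfulOn (eval (stepIncl (stepIncl ι u) u')
      (stepVal (stepVal v (.zz ⟨i + 1, by omega⟩) u) (.zz ⟨i, by omega⟩) u'))
      (generatedQuot G (by omega : i + 2 < m)) := by
  rw [Move.period, map_mul] at hu
  have hau : ¬ Commute (eval ι v (E.atom ⟨i, by omega⟩)) u := by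
    rw [hu]
    exact h.zzz hn hi
  have hbu : ¬ Commute (eval ι v (E.atom ⟨i + 1, by omega⟩)) u := by
    rw [hu, commute_mul_left_self_iff]
    exact h.zz (by omega)
  have hz1 : stepVal v (.zz ⟨i + 1, by omega⟩) u (.z ⟨i + 1, by omega⟩) =
      of (v (.z ⟨i + 1, by omega⟩)) * t := stepVal_zz_left _ _ _
  have hz2 : stepVal v (.zz ⟨i + 1, by omega⟩) u (.z ⟨i + 2, by omega⟩) =
      of (v (.z ⟨i + 2, by omega⟩)) * t := stepVal_zz_right _ _ _
  have hu'_eq := hu'.trans (eval_step_period_zz (by omega) (by simp [Move.lo]) hz1)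
  refine isFaithfulOn_closure_union_pair
    (fun g hg => hu' ▸ not_commute_of_step_period_zz h.separated.1 (by omega) (by simp [Move.lo])
      hz1 hbu hg)
    (fun g hg => hu'_eq ▸ not_commute_conj_of_mul_conj h.separated.1 hau hg)
    (fun g => hu'_eq ▸ not_commute_of_mul_t hau hbu) h.faithful (fun b hb => ?_)
    (a := v (.z ⟨i, by omega⟩)) (b := v (.z ⟨i + 1, by omega⟩)) (c := v (.z ⟨i + 2, by omega⟩))
    ?_ ?_
  · exact (eval_step_of_mem (k := .zz ⟨i, by omega⟩) (fun w (hw : w.pos < i) => Or.inl hw)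
      hb).trans (congrArg of (eval_step_of_mem (k := .zz ⟨i + 1, by omega⟩)
        (fun w (hw : w.pos < i) => Or.inl (Nat.lt_succ_of_lt hw)) hb))
  · rw [eval_var, stepVal_zz_left, stepVal_of_outside (k := .zz ⟨i + 1, _⟩) (w := .z ⟨i, _⟩)
      (Or.inl (Nat.lt_succ_self i))]
  · rw [map_mul, map_inv, eval_var, eval_var, stepVal_zz_right,
      stepVal_of_outside (k := .zz ⟨i, _⟩) (w := .z ⟨i + 2, _⟩) (Or.inr (Nat.lt_succ_self (i + 1))),
      hz1, hz2]

theorem closure_generatedQuot_union_var_z (hi : i + 3 = m) (hn : n = 0) :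
    Subgroup.closure
      (((generatedQuot G (by omega : i + 2 < m) : Subgroup (GX G m n)) : Set (GX G m n)) ∪
        {var (.z ⟨i + 2, by omega⟩)}) = ⊤ := by
  have hi2 : i + 2 < m := by omega
  set B : Subgroup (GX G m n) := generatedQuot G hi2
  set z : GX G m n := var (.z ⟨i + 2, hi2⟩)
  have hBC : B ≤ Subgroup.closure ((B : Set (GX G m n)) ∪ {z}) :=
    fun b hb => Subgroup.subset_closure (Or.inl hb)
  have hz : z ∈ Subgroup.closure ((B : Set (GX G m n)) ∪ {z}) :=
    Subgroup.subset_closure (Or.inr rfl)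
  rw [eq_top_iff, ← generated_univ]
  refine generated_le (fun g => hBC (const_mem_generatedQuot hi2 g)) fun w _ => ?_
  by_cases hlt : w.pos < i
  · exact hBC (generated_pos_lt_le_generatedQuot hi2 (var_mem_generated hlt))
  · rcases w with j | j | ⟨j, hj⟩ <;> simp only [QVar.pos] at hlt
    · omega
    · omega
    · obtain rfl | rfl | rfl : j = i ∨ j = i + 1 ∨ j = i + 2 := by omega
      · exact hBC (var_z_mem_generatedQuot hi2)
      · simpa [z] using mul_mem (hBC (var_z_mul_inv_mem_generatedQuot hi2)) hz
      · exact hz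

theorem eval_step_zz_of_mem_generatedQuot (hi : i + 2 < m) {u : H} {b : GX G m n}
    (hb : b ∈ generatedQuot G hi) :
    eval (stepIncl ι u) (stepVal v (.zz ⟨i + 1, by omega⟩) u) b = of (eval ι v b) := by
  refine MonoidHom.eqOn_closure (g := of.comp (eval ι v)) ?_ hb
  rintro γ (hγ | rfl | rfl)
  · exact eval_step_of_mem (k := .zz ⟨i + 1, by omega⟩)
      (fun w (hw : w.pos < i) => Or.inl (Nat.lt_succ_of_lt hw)) hγ
  · rw [eval_var, MonoidHom.comp_apply, eval_var]
    exact stepVal_of_outside (Or.inl (Nat.lt_succ_self i))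
  · simp only [MonoidHom.comp_apply, map_mul, map_inv, eval_var, stepVal_zz_left, stepVal_zz_right]
    group

theorem eval_period_zz_ne_one (hi : i + 3 = m) (hn : n = 0) (hc : ∀ i, E.c i ≠ 1) (hd : E.d ≠ 1)
    (hv : IsFaithfulOn (eval ι v) (generatedQuot G (by omega : i + 2 < m)))
    (hw : eval ι v E.word = 1) :
    eval ι v (Move.period E (.zz ⟨i + 1, by omega⟩)) ≠ 1 := by
  rw [E.map_period_zz_eq_map_tail hw hi hn]
  exact fun htail => E.tail_ne_one hc hd (by omega) (hv _ (tail_mem_generatedQuot (by omega)) htail)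

theorem mem_normalClosure_of_eval_step_zz (hi : i + 3 = m) (hn : n = 0) (hc : ∀ i, E.c i ≠ 1)
    (hd : E.d ≠ 1) (hv : IsFaithfulOn (eval ι v) (generatedQuot G (by omega : i + 2 < m)))
    (hw : eval ι v E.word = 1) {u : H}
    (hu : u = eval ι v (Move.period E (.zz ⟨i + 1, by omega⟩))) {γ : GX G m n}
    (hγ : eval (stepIncl ι u) (stepVal v (.zz ⟨i + 1, by omega⟩) u) γ = 1) :
    γ ∈ Subgroup.normalClosure {E.word} := by
  have hi2 : i + 2 < m := by omega
  set z : GX G m n := var (.z ⟨i + 2, hi2⟩)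
  set Q : GX G m n := E.conjPair (i + 1) hi2
  set g : GX G m n := E.tail (i + 1) (by omega)
  have hgB : g ∈ generatedQuot G hi2 := tail_mem_generatedQuot hi2
  have hQB : Q ∈ generatedQuot G hi2 := conjPair_mem_generatedQuot hi2
  have hrel : g⁻¹ * (z⁻¹ * Q * z⁻¹⁻¹) ∈ Subgroup.normalClosure {E.word} := by
    rw [inv_inv, ← E.period_zz_eq_conj hi2]
    exact E.tail_inv_mul_period_mem (Subgroup.subset_normalClosure (Set.mem_singleton _)) hi hn
  have hrel' : Q⁻¹ * (z * g * z⁻¹) ∈ Subgroup.normalClosure {E.word} := by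
    simpa only [inv_inv] using inv_mul_conj_inv_mem hrel
  have hug : u = eval ι v g := hu.trans (E.map_period_zz_eq_map_tail hw hi hn)
  have huQ : u = (eval ι v z)⁻¹ * eval ι v Q * eval ι v z := by
    rw [hu, E.period_zz_eq_conj hi2, map_mul, map_mul, map_inv]
  have hgen : γ ∈ Subgroup.closure
      (((generatedQuot G hi2 : Subgroup (GX G m n)) : Set (GX G m n)) ∪ {z}) := by
    rw [closure_generatedQuot_union_var_z hi hn]
    exact Subgroup.mem_top γ
  refine mem_of_mem_closure_union_singleton (φ := eval ι v) (p := eval ι v z) (q := 1)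
    (E.normalClosure_word_le_ker ?_) (E.normalClosure_word_le_ker hw)
    (fun b => eval_step_zz_of_mem_generatedQuot hi2) ?_ (fun b hb hb1 => hv b hb hb1 ▸ one_mem _)
    (fun b hb hcomm => ?_) (fun b hb hcomm => ?_) hgen hγ
  · rw [hu, eval_step_word, hw, map_one]
  · rw [eval_var, stepVal_zz_right, map_one, mul_one, eval_var]
  · rw [one_mul, inv_one, mul_one, hug] at hcomm
    obtain ⟨k, rfl⟩ := E.mem_zpowers_tail hc hd (by omega) (hv.commute hb hgB hcomm)
    exact ⟨Q ^ k, zpow_mem hQB k, zpow_inv_mul_conj_mem hrel' k⟩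
  · rw [huQ, commute_inv_mul_mul_iff] at hcomm
    have hcommQ : Commute (eval ι v b) (eval ι v Q) := by simpa [mul_assoc] using hcomm
    have hz : z⁻¹ ∈ generated G {w : QVar m n | w ≠ .z ⟨i + 1, by omega⟩} :=
      inv_mem (var_mem_generated (by simp))
    obtain ⟨k, rfl⟩ : b ∈ Subgroup.zpowers Q := mem_zpowers_conj_var_mul_of_commute hz
      (const_mem_generated _ _) (const_mem_generated _ _) (fun h => hc _ (const_eq_one_iff.1 h))
      (fun h => hc _ (const_eq_one_iff.1 h)) (hv.commute hb hQB hcommQ)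
    exact ⟨g ^ k, zpow_mem hgB k, by simpa only [inv_inv] using zpow_inv_mul_conj_mem hrel k⟩

end GX

namespace Move

variable {m n : ℕ}

/-- The three twists of the handle `(xᵢ, yᵢ)` with `j = m + i`, and no step if the atom of index
`j` is not a commutator. -/
def handleTwists (m n j : ℕ) : List (Move m n) :=
  if h : m ≤ j ∧ j < m + n then
    [twistY ⟨j - m, by omega⟩, twistX ⟨j - m, by omega⟩, twistY ⟨j - m, by omega⟩]
  else []

/-- The step of a round that involves both the atoms of index `j` and `j + 1`, and no step if
there are no such atoms. -/
def links (m n j : ℕ) : List (Move m n) :=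
  if h : j + 1 < m then [zz ⟨j, by omega⟩]
  else if h : j + 1 = m ∧ 0 < n then [zx (by omega) h.2]
  else if h : m ≤ j ∧ j + 1 < m + n then [xx ⟨j - m, by omega⟩]
  else []

/-- The step of the first round that links the atoms of index `j` and `j + 1`, where it is kept.
It makes the atom `j` independent of the atom `j - 1` before the second round links these two; if
the atom `j` is a commutator, its twists have this role. -/
def firstLinks (m n j : ℕ) : List (Move m n) :=
  if j < m ∧ 2 ≤ m then links m n j else []

/-- The steps, taken from both rounds, that extend the independence over `G` of the values of the
variables of the first `j` atoms to those of the atom of index `j`. -/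
def block (m n j : ℕ) : List (Move m n) :=
  handleTwists m n j ++ firstLinks m n (j + 1) ++ handleTwists m n (j + 1) ++ links m n j

theorem handleTwists_of_lt {j : ℕ} (h : j < m) : handleTwists m n j = [] :=
  dif_neg (by omega)

theorem handleTwists_add {i : ℕ} (hi : i < n) :
    handleTwists m n (m + i) = [twistY ⟨i, hi⟩, twistX ⟨i, hi⟩, twistY ⟨i, hi⟩] := by
  simp only [handleTwists, Nat.add_sub_cancel_left]
  exact dif_pos (by omega)

theorem links_of_lt {j : ℕ} (h : j + 1 < m) : links m n j = [zz ⟨j, by omega⟩] := dif_pos h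

theorem links_of_eq {j : ℕ} (h : j + 1 = m) (hm : 0 < m) (hn : 0 < n) :
    links m n j = [zx hm hn] := by
  rw [links, dif_neg (by omega), dif_pos ⟨h, hn⟩]

theorem links_add {i : ℕ} (hi : i < n - 1) : links m n (m + i) = [xx ⟨i, hi⟩] := by
  simp only [links, Nat.add_sub_cancel_left]
  rw [dif_neg (by omega), dif_neg (by omega), dif_pos (by omega)]

theorem links_eq_nil {j : ℕ} (h : m + n ≤ j + 1) : links m n j = [] := by
  rw [links, dif_neg (by omega), dif_neg (by omega), dif_neg (by omega)]

theorem firstLinks_of_le {j : ℕ} (h : m ≤ j) : firstLinks m n j = [] := if_neg (by omega)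

theorem firstLinks_of_lt {j : ℕ} (h : j < m) (hm : 2 ≤ m) : firstLinks m n j = links m n j :=
  if_pos ⟨h, hm⟩

theorem firstLinks_sublist_links (j : ℕ) : (firstLinks m n j).Sublist (links m n j) := by
  rw [firstLinks]
  split
  · exact List.Sublist.refl _
  · exact List.nil_sublist _

theorem lo_hi_of_mem_handleTwists {j : ℕ} {k : Move m n} (hk : k ∈ handleTwists m n j) :
    k.lo = j ∧ k.hi = j := by
  rw [handleTwists] at hk
  split at hk
  · simp only [List.mem_cons, List.not_mem_nil, or_false] at hk
    rcases hk with rfl | rfl | rfl <;> simp only [lo, hi] <;> omega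
  · simp at hk

theorem lo_hi_of_mem_links {j : ℕ} {k : Move m n} (hk : k ∈ links m n j) :
    k.lo = j ∧ k.hi = j + 1 := by
  unfold links at hk
  split_ifs at hk
  · obtain rfl := List.mem_singleton.1 hk
    exact ⟨rfl, rfl⟩
  · obtain rfl := List.mem_singleton.1 hk
    simp only [lo, hi]
    omega
  · obtain rfl := List.mem_singleton.1 hk
    simp only [lo, hi]
    omega
  · simp at hk

theorem map_zz_append_zx (m n : ℕ) :
    (List.finRange (m - 1)).map zz ++ (if h : 0 < m ∧ 0 < n then [zx h.1 h.2] else []) =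
      (List.range m).flatMap fun j => handleTwists m n j ++ links m n j := by
  cases m with
  | zero => simp
  | succ k =>
    rw [List.range_succ, List.flatMap_append, List.flatMap_singleton,
      handleTwists_of_lt (Nat.lt_succ_self k), List.nil_append]
    congr 1
    · rw [← List.map_coe_finRange_eq_range, List.flatMap_map, List.map_eq_flatMap]
      refine List.flatMap_congr fun i _ => ?_
      have hi : i.1 < k := i.2
      rw [handleTwists_of_lt (by omega), links_of_lt (by omega), List.nil_append]
    · by_cases hn : 0 < n
      · rw [dif_pos ⟨Nat.succ_pos k, hn⟩, links_of_eq rfl (Nat.succ_pos k) hn]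
      · rw [dif_neg (by omega), links_eq_nil (by omega)]

theorem round_eq (m n : ℕ) :
    round m n = (List.range (m + n)).flatMap fun j => handleTwists m n j ++ links m n j := by
  rw [List.range_add, List.flatMap_append, round, map_zz_append_zx]
  congr 1
  rw [← List.map_coe_finRange_eq_range, List.flatMap_map, List.flatMap_map]
  refine List.flatMap_congr fun i _ => ?_
  rw [handleTwists_add i.2]
  congr 1
  by_cases hi : i.1 < n - 1
  · rw [dif_pos hi, links_add hi]
  · rw [dif_neg hi, links_eq_nil (by omega)]

theorem flatMap_append_succ {α : Type*} (a b : ℕ → List α) (k : ℕ) :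
    (List.range (k + 1)).flatMap (fun j => a j ++ b j) =
      a 0 ++ (List.range k).flatMap (fun j => b j ++ a (j + 1)) ++ b k := by
  induction k with
  | zero => simp
  | succ k ih =>
    rw [List.range_succ, List.flatMap_append, ih, List.range_succ, List.flatMap_append]
    simp

theorem flatMap_block (k : ℕ) :
    (firstLinks m n 0 ++ handleTwists m n 0) ++ (List.range k).flatMap (fun i =>
      (firstLinks m n (i + 1) ++ handleTwists m n (i + 1)) ++
        (links m n i ++ handleTwists m n (i + 1))) =
      firstLinks m n 0 ++ ((List.range k).flatMap (block m n) ++ handleTwists m n k) := by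
  induction k with
  | zero => simp
  | succ k ih =>
    rw [List.range_succ, List.flatMap_append, ← List.append_assoc, ih, List.flatMap_append]
    simp [block]

theorem firstLinks_handleTwists_sublist_round :
    ((List.range (m + n)).flatMap fun j => firstLinks m n j ++ handleTwists m n j).Sublist
      (round m n) := by
  rw [round_eq]
  refine List.Sublist.flatMap_right _ fun j _ => ?_
  by_cases hj : j < m
  · rw [handleTwists_of_lt hj, List.append_nil, List.nil_append]
    exact firstLinks_sublist_links j
  · rw [firstLinks_of_le (by omega), List.nil_append]
    exact List.sublist_append_left _ _

theorem links_handleTwists_sublist_round {N : ℕ} (hN : m + n = N + 1) :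
    ((List.range N).flatMap fun j => links m n j ++ handleTwists m n (j + 1)).Sublist
      (round m n) := by
  rw [round_eq, hN, flatMap_append_succ]
  exact (List.sublist_append_right _ _).trans (List.sublist_append_left _ _)

theorem flatMap_block_of_eq_zero {i : ℕ} (hi : i + 3 = m) (hn : n = 0) :
    (List.range (i + 2)).flatMap (block m n) ++ handleTwists m n (i + 2) =
      (List.range i).flatMap (block m n) ++
        [.zz ⟨i + 1, by omega⟩, .zz ⟨i, by omega⟩, .zz ⟨i + 1, by omega⟩] := by
  have hblock : block m n i = [.zz ⟨i + 1, by omega⟩, .zz ⟨i, by omega⟩] := by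
    rw [block, handleTwists_of_lt (by omega), handleTwists_of_lt (by omega),
      links_of_lt (by omega), firstLinks_of_lt (by omega) (by omega), links_of_lt (by omega)]
    rfl
  have hblock_succ : block m n (i + 1) = [.zz ⟨i + 1, by omega⟩] := by
    rw [block, handleTwists_of_lt (by omega), handleTwists_of_lt (by omega),
      links_of_lt (by omega), firstLinks_of_lt (by omega) (by omega), links_eq_nil (by omega)]
    rfl
  rw [List.range_succ, List.range_succ, handleTwists_of_lt (by omega)]
  simp [hblock, hblock_succ]

end Move

namespace Stage

variable {G : Type u} [Group G] {m n : ℕ} (E : QuadEq G m n)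

/- The steps of the second round at the atoms of index at most `i + 1` commute with those of the
first round at the atoms of index at least `i + 2`, so the two rounds can be interleaved. -/
theorem refines_round_append_round {N : ℕ} (hN : m + n = N + 1) :
    Refines E (Move.round m n ++ Move.round m n)
      (Move.firstLinks m n 0 ++ ((List.range N).flatMap (Move.block m n) ++
        Move.handleTwists m n N)) := by
  have hfirst := Move.firstLinks_handleTwists_sublist_round (m := m) (n := n)
  rw [hN] at hfirst
  have hsecond := Move.links_handleTwists_sublist_round hN
  refine (refines_of_sublist (hfirst.append hsecond)).trans ?_
  rw [← Move.flatMap_block]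
  refine refines_interleave (fun i j hij k hk l hl => Or.inr ?_) N
  have hlo : k.lo = j := by
    rcases List.mem_append.1 hk with hk | hk
    · exact (Move.lo_hi_of_mem_links ((Move.firstLinks_sublist_links j).subset hk)).1
    · exact (Move.lo_hi_of_mem_handleTwists hk).1
  have hhi : l.hi = i + 1 := by
    rcases List.mem_append.1 hl with hl | hl
    · exact (Move.lo_hi_of_mem_links hl).2
    · exact (Move.lo_hi_of_mem_handleTwists hl).2
  omega

end Stage

namespace Stage

open GX

variable {G : Type u} [Group G] {m n : ℕ} (E : QuadEq G m n)

/-- The canonical homomorphism and the values of the variables of the stage satisfy the invariants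
`GX.IsReady` of index `j`. -/
def IsReady (s : Stage G m n) (j : ℕ) : Prop := GX.IsReady E s.incl s.val j

variable {E} {s : Stage G m n} {j : ℕ}

theorem exists_isTwist_foldl_handleTwists (hs : IsSeparated s.incl) {i : ℕ} (hi : i < n)
    (hxy : ¬ Commute (s.val (.x ⟨i, hi⟩)) (s.val (.y ⟨i, hi⟩))) :
    ∃ f, IsTwist ⟨i, hi⟩ s.incl s.val f
      ((Move.handleTwists m n (m + i)).foldl (step E) s).incl
      ((Move.handleTwists m n (m + i)).foldl (step E) s).val := by
  rw [Move.handleTwists_add hi]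
  exact ⟨_, GX.isTwist hs ⟨i, hi⟩ hxy (eval_var _ _ _) (eval_var _ _ _) (eval_var _ _ _)⟩

theorem IsReady.foldl_block_of_lt (h : IsReady E s j) (hc : ∀ i, E.c i ≠ 1) (hj : j + 1 < m)
    (hn : 0 < n ∨ j + 2 < m) : IsReady E ((Move.block m n j).foldl (step E) s) (j + 1) := by
  rw [Move.block, Move.handleTwists_of_lt (by omega), Move.handleTwists_of_lt hj,
    Move.links_of_lt hj, Move.firstLinks_of_lt hj (by omega)]
  by_cases hj2 : j + 2 < m
  · rw [Move.links_of_lt hj2]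
    exact h.zz_zz hc hj2 rfl rfl
  · have hn : 0 < n := by omega
    have hm : 0 < m := by omega
    rw [Move.links_of_eq (by omega) hm hn]
    exact GX.IsReady.zx_zz h (by omega) hm hn rfl rfl

theorem IsReady.foldl_block_of_eq (h : IsReady E s j) (hj : j + 1 = m) (hn : 0 < n) :
    IsReady E ((Move.block m n j).foldl (step E) s) (j + 1) := by
  obtain ⟨f, hf⟩ := exists_isTwist_foldl_handleTwists (E := E) h.separated hn
    (h.handle ⟨0, hn⟩ (by simp only; omega))
  rw [Move.block, Move.handleTwists_of_lt (by omega), Move.firstLinks_of_le (by omega),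
    Move.links_of_eq hj (by omega) hn, hj, List.nil_append, List.nil_append, List.foldl_append]
  subst hj
  exact GX.IsReady.twist_zx h rfl (by omega) hn hf rfl

theorem IsReady.foldl_block_add {l : ℕ} (h : IsReady E s (m + l)) (hl : l + 1 < n) :
    IsReady E ((Move.block m n (m + l)).foldl (step E) s) (m + l + 1) := by
  obtain ⟨f, hf⟩ := exists_isTwist_foldl_handleTwists (E := E) h.separated
    (Nat.lt_of_succ_lt hl) (h.handle ⟨l, by omega⟩ le_rfl)
  have hpos : m + (l + 1) ≠ m + l := by omega
  have hxy := h.handle ⟨l + 1, hl⟩ (Nat.le_succ _)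
  obtain ⟨f', hf'⟩ := exists_isTwist_foldl_handleTwists (E := E) hf.separated hl (by
    rw [← hf.map_val _ (by exact hpos), ← hf.map_val _ (by exact hpos)]
    exact fun hcomm => hxy (hcomm.of_map hf.injective))
  rw [Move.block, Move.firstLinks_of_le (by omega), Move.links_add (by omega), List.append_nil,
    List.foldl_append, List.foldl_append]
  exact GX.IsReady.twist_xx h hl hf hf' rfl

theorem IsReady.foldl_block (h : IsReady E s j) (hc : ∀ i, E.c i ≠ 1) (hj : j + 1 < m + n)
    (hn : 0 < n ∨ j + 2 < m) : IsReady E ((Move.block m n j).foldl (step E) s) (j + 1) := by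
  rcases lt_trichotomy (j + 1) m with hm | hm | hm
  · exact h.foldl_block_of_lt hc hm hn
  · exact h.foldl_block_of_eq hm (by omega)
  · obtain ⟨l, rfl⟩ := Nat.exists_eq_add_of_le (Nat.lt_succ_iff.1 hm)
    exact h.foldl_block_add (by omega)

theorem IsReady.foldl_flatMap_block (h : IsReady E s 0) (hc : ∀ i, E.c i ≠ 1) {k : ℕ}
    (hk : k < m + n) (hn : 0 < n ∨ k + 2 < m) :
    IsReady E (((List.range k).flatMap (Move.block m n)).foldl (step E) s) k := by
  induction k with
  | zero => exact h
  | succ k ih =>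
    rw [List.range_succ, List.flatMap_append, List.flatMap_singleton, List.foldl_append]
    exact (ih (by omega) (by omega)).foldl_block hc hk (by omega)

theorem isReady_foldl_firstLinks (hs : IsSeparated s.incl)
    (hι : Function.Injective s.incl) (hc : ∀ i, E.c i ≠ 1)
    (hh : ∀ i : Fin n, ¬ Commute (s.val (.x i)) (s.val (.y i)))
    (h01 : ∀ hm : 1 < m, ¬ Commute (s.hom (E.atom ⟨0, by omega⟩)) (s.hom (E.atom ⟨1, by omega⟩)))
    (h012 : ∀ (_ : n = 0) (h : 3 = m), s.hom (E.atom ⟨0, by omega⟩) *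
      s.hom (E.atom ⟨1, by omega⟩) * s.hom (E.atom ⟨2, by omega⟩) ≠ 1) :
    IsReady E ((Move.firstLinks m n 0).foldl (step E) s) 0 := by
  rcases Nat.lt_or_ge 1 m with hm | hm
  · rw [Move.firstLinks_of_lt (by omega) hm, Move.links_of_lt hm]
    exact GX.isReady_zz_zero hs hι hc hh hm (h01 hm) h012 rfl
  · rw [Move.firstLinks, if_neg (by omega)]
    exact GX.isReady_zero hs hι hh hm

theorem IsReady.isSeparated_and_ker_le_of_eq_zero {i : ℕ} (h : IsReady E s i)
    (hc : ∀ i, E.c i ≠ 1) (hd : E.d ≠ 1) (hw : s.hom E.word = 1) (hi : i + 3 = m) (hn : n = 0)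
    {s' : Stage G m n} (hs' : s' = ([.zz ⟨i + 1, by omega⟩, .zz ⟨i, by omega⟩,
      .zz ⟨i + 1, by omega⟩] : List (Move m n)).foldl (step E) s) :
    IsSeparated s'.incl ∧ s'.hom.ker ≤ Subgroup.normalClosure {E.word} := by
  subst hs'
  have hword := foldl_step_hom_word E hw [.zz ⟨i + 1, by omega⟩, .zz ⟨i, by omega⟩]
  have hgood := GX.IsReady.zz_zz h hc (by omega) rfl rfl
  have hfaithful := GX.IsReady.isFaithfulOn_step_zz_zz h hi hn rfl rfl
  exact ⟨hgood.separated.step (eval_period_zz_ne_one hi hn hc hd hfaithful hword),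
    fun _ hγ => mem_normalClosure_of_eval_step_zz hi hn hc hd hfaithful hword rfl hγ⟩

theorem IsReady.isSeparated_and_ker_le_foldl_handleTwists {l : ℕ} (h : IsReady E s (m + l))
    (hw : s.hom E.word = 1) (hl : l + 1 = n) :
    IsSeparated ((Move.handleTwists m n (m + l)).foldl (step E) s).incl ∧
      ((Move.handleTwists m n (m + l)).foldl (step E) s).hom.ker ≤
        Subgroup.normalClosure {E.word} := by
  obtain ⟨f, hf⟩ := exists_isTwist_foldl_handleTwists (E := E) h.separated
    (by omega : l < n) (h.handle _ le_rfl)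
  refine ⟨hf.separated, fun γ hγ => ?_⟩
  rw [Move.handleTwists_add (by omega)] at hγ
  exact GX.IsReady.mem_of_twist h hl hw rfl rfl rfl hγ

theorem IsReady.isSeparated_and_ker_le (h : IsReady E s 0) (hc : ∀ i, E.c i ≠ 1)
    (hw : s.hom E.word = 1) (hn : n = 0 → 3 ≤ m ∧ E.d ≠ 1) {N : ℕ} (hN : m + n = N + 1)
    {s' : Stage G m n} (hs' : s' = ((List.range N).flatMap (Move.block m n) ++
      Move.handleTwists m n N).foldl (step E) s) :
    IsSeparated s'.incl ∧ s'.hom.ker ≤ Subgroup.normalClosure {E.word} := by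
  subst hs'
  rcases Nat.eq_zero_or_pos n with hn0 | hn0
  · obtain ⟨hm, hd⟩ := hn hn0
    obtain ⟨i, rfl⟩ : ∃ i, N = i + 2 := ⟨N - 2, by omega⟩
    rw [Move.flatMap_block_of_eq_zero (by omega) hn0, List.foldl_append]
    exact (h.foldl_flatMap_block hc (by omega) (by omega)).isSeparated_and_ker_le_of_eq_zero hc hd
      (foldl_step_hom_word E hw _) (by omega) hn0 rfl
  · obtain ⟨l, rfl⟩ : ∃ l, N = m + l := ⟨N - m, by omega⟩
    rw [List.foldl_append]
    exact (h.foldl_flatMap_block hc (by omega) (by omega)).isSeparated_and_ker_le_foldl_handleTwists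
      (foldl_step_hom_word E hw _) (by omega)

end Stage

namespace QuadEq

open GX

variable {G : Type u} [Group G] {m n : ℕ} {E : QuadEq G m n} {β : GX G m n →* G}

theorem start_hom (hβ : ∀ g : G, β (const g) = g) : (Stage.start β).hom = β :=
  hom_ext (fun a => (eval_const _ _ a).trans (hβ a).symm) fun w => eval_var _ _ w

theorem IsSolution.start_hom_word (hβ : E.IsSolution β) : (Stage.start β).hom E.word = 1 := by
  rw [start_hom hβ.1]
  exact hβ.2

theorem radical_le_ker {s : Stage G m n} (hs : IsSeparated s.incl) (hw : s.hom E.word = 1) :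
    E.radical ≤ s.hom.ker := by
  intro γ hγ
  rw [MonoidHom.mem_ker]
  by_contra hne
  obtain ⟨r, hr, hrγ⟩ := hs.exists_retraction _ hne
  have hsol : E.IsSolution (r.comp s.hom) :=
    ⟨fun g => (congrArg r (eval_const s.incl s.val g)).trans (hr g),
      by rw [MonoidHom.comp_apply, hw, map_one]⟩
  exact hrγ (Subgroup.mem_iInf.1 hγ ⟨_, hsol⟩)

theorem normalClosure_le_radical : Subgroup.normalClosure {E.word} ≤ E.radical :=
  Subgroup.normalClosure_le_normal <|
    Set.singleton_subset_iff.2 (Subgroup.mem_iInf.2 fun β => β.2.2)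

theorem IsStandard.pos (hE : E.IsStandard) : 0 < m + n := by
  rcases hE.2 with hd | hd <;> omega

theorem IsStandard.d_ne_one (hE : E.IsStandard) (hn : n = 0) : E.d ≠ 1 := by
  rcases hE.2 with hd | hd
  · exact hd.1
  · omega

theorem IsRegular.three_le (hE : E.IsRegular) (hn : n = 0) : 3 ≤ m := by
  rcases hE.2 with ⟨hkappa, -⟩ | hgenus
  · rw [kappa] at hkappa
    split at hkappa <;> omega
  · omega

theorem IsRegular.d_ne_one (hE : E.IsRegular) (hm : m = 0) (hn : n = 1) : E.d ≠ 1 := by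
  rcases hE.2 with ⟨hkappa, -⟩ | ⟨-, -, hd⟩
  · intro hd
    rw [kappa, if_pos hd] at hkappa
    omega
  · exact hd

theorem map_atom_add_of_commute {i : ℕ} (hi : i < n)
    (hxy : Commute (β (var (.x ⟨i, hi⟩))) (β (var (.y ⟨i, hi⟩)))) :
    β (E.atom ⟨m + i, by omega⟩) = 1 := by
  rw [E.atom_add hi]
  simp only [map_mul, map_inv]
  rw [mul_assoc, hxy.eq]
  group

theorem IsSolution.map_partialProd (hβ : E.IsSolution β) {k : ℕ} (hk : k = m + n) :
    β (E.partialProd k hk.le) = E.d := by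
  have hword := hβ.2
  rwa [E.word_eq_partialProd hk, map_mul, hβ.1, mul_inv_eq_one] at hword

theorem not_commute_of_inGeneralPosition (hE : E.IsRegular) (hβ : E.IsSolution β)
    (hgen : E.InGeneralPosition β) (i : Fin n) :
    ¬ Commute (β (var (.x i))) (β (var (.y i))) := by
  obtain ⟨i, hi⟩ := i
  intro hxy
  have hatom : β (E.atom ⟨m + i, by omega⟩) = 1 := map_atom_add_of_commute hi hxy
  by_cases hsucc : m + i + 1 < m + n
  · exact hgen _ hsucc (hatom ▸ Commute.one_left _)
  obtain hzero | ⟨k, hk⟩ : m + i = 0 ∨ ∃ k, m + i = k + 1 := by cases m + i <;> simp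
  · have hprod := hβ.map_partialProd (k := m + i + 1) (by omega)
    simp only [hzero, partialProd_succ, partialProd_zero, one_mul] at hprod hatom
    exact hE.d_ne_one (by omega) (by omega) (hprod.symm.trans hatom)
  · simp only [hk] at hatom
    exact hgen k (by omega) (hatom ▸ Commute.one_right _)

theorem isReady_foldl_firstLinks_start (hG : IsFullyResiduallyFree G) (hE : E.IsRegular)
    (hβ : E.IsSolution β) (hgen : E.InGeneralPosition β) :
    Stage.IsReady E ((Move.firstLinks m n 0).foldl (Stage.step E) (Stage.start β)) 0 := by
  refine Stage.isReady_foldl_firstLinks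
    ⟨hG, fun _ hg => ⟨MonoidHom.id G, fun _ => rfl, hg⟩⟩ Function.injective_id hE.1.1
    (not_commute_of_inGeneralPosition hE hβ hgen) (fun hm => ?_) fun hn hm => ?_
  · rw [start_hom hβ.1]
    exact hgen 0 (by omega)
  · have hprod := hβ.map_partialProd (k := 0 + 1 + 1 + 1) (by omega)
    simp only [partialProd_succ, partialProd_zero, one_mul, map_mul] at hprod
    rw [start_hom hβ.1]
    exact hprod.trans_ne (hE.1.d_ne_one hn)

theorem lambdaHom_word (hβ : E.IsSolution β) : E.lambdaHom β E.word = 1 :=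
  Stage.foldl_step_hom_word E hβ.start_hom_word _

theorem radical_eq_ker_lambdaHom (hG : IsFullyResiduallyFree G) (hE : E.IsRegular)
    (hβ : E.IsSolution β) (hgen : E.InGeneralPosition β) :
    E.radical = (E.lambdaHom β).ker := by
  obtain ⟨N, hN⟩ : ∃ N, m + n = N + 1 := ⟨m + n - 1, by have := hE.1.pos; omega⟩
  have hword := hβ.start_hom_word
  obtain ⟨hsep, hker⟩ := (isReady_foldl_firstLinks_start hG hE hβ hgen).isSeparated_and_ker_le
    hE.1.1 (Stage.foldl_step_hom_word E hword _)
    (fun hn => ⟨hE.three_le hn, hE.1.d_ne_one hn⟩) hN rfl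
  refine le_antisymm ?_ ?_
  · have hradical := radical_le_ker hsep
      (Stage.foldl_step_hom_word E (Stage.foldl_step_hom_word E hword _) _)
    exact hradical.trans (hker.trans (E.normalClosure_word_le_ker (lambdaHom_word hβ)))
  · have hle := (Stage.refines_round_append_round E hN (Stage.start β)).ker_le
    rw [List.foldl_append (l := Move.firstLinks m n 0)] at hle
    exact hle.trans (hker.trans normalClosure_le_radical)

end QuadEq

theorem mainTheorem9_general {G : Type u} [Group G] (hG : IsFullyResiduallyFree G)
    {m n : ℕ} (E : QuadEq G m n) (hE : E.IsRegular)
    (β : GX G m n →* G) (hβ : E.IsSolution β) (hgen : E.InGeneralPosition β) :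
    ∃ lam : E.CoordinateGroup →* E.GUT β,
      lam.comp (QuotientGroup.mk' E.radical) = E.lambdaHom β ∧
      Function.Injective lam := by
  have hker := QuadEq.radical_eq_ker_lambdaHom hG hE hβ hgen
  exact ⟨QuotientGroup.lift E.radical (E.lambdaHom β) hker.le, QuotientGroup.lift_comp_mk' _ _ _,
    (QuotientGroup.injective_lift_iff _ _ hker.le).2 hker⟩

theorem mainTheorem9 {G : Type u} [Group G] [Group.FG G] (hG : IsFullyResiduallyFree G)
    {m n : ℕ} (E : QuadEq G m n) (hE : E.IsRegular)
    (β : GX G m n →* G) (hβ : E.IsSolution β) (hgen : E.InGeneralPosition β) :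
    ∃ lam : E.CoordinateGroup →* E.GUT β,
      lam.comp (QuotientGroup.mk' E.radical) = E.lambdaHom β ∧
      Function.Injective lam :=
  mainTheorem9_general hG E hE β hβ hgen
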